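/- All graphs are finite, undirected and simple. A graph $H$ is a depth-$r$ minor of $G$ if there are pairwise disjoint connected subgraphs $(B_i)_{i\in V(H)}$ of $G$ of radius at most $r$ such that for every edge $ij$ of $H$ some edge of $G$ joins $B_i$ and $B_j$. A class $\mathcal C$ of graphs has bounded expansion if there is $f\colon\mathbb N\to\mathbb N$ such that for all $r\in\mathbb N$, every depth-$r$ minor of a graph in $\mathcal C$ has average degree at most $f(r)$. For a linear order $L$ of $V(G)$ let $\mathrm{WReach}_r[G,L,v]$ be the set of vertices $u$ such that some path of length at most $r$ between $v$ and $u$ has $u$ as its $L$-minimum vertex; the weak $r$-colouring number is $\mathrm{wcol}_r(G)=\min_L\max_v|\mathrm{WReach}_r[G,L,v]|$, and $L$ witnesses $\mathrm{wcol}_r(G)\le k$ if $|\mathrm{WReach}_r[G,L,v]|\le k$ for all $v$. A distance-$r$ dominating set of $G$ is a set $M\subseteq V(G)$ such that every vertex is at distance at most $r$ from $M$; a $k$-approximation of a minimum one is a distance-$r$ dominating set $D$ with $|D|\le k|M|$ for every distance-$r$ dominating set $M$. **Theorem.** For every class $\mathcal C$ of bounded expansion there are a function $c\colon\mathbb N\to\mathbb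 N$ and a single linear-time algorithm which, given adjacency lists (in any order) of a graph $G\in\mathcal C$ with vertex set $\{0,\dots,n-1\}$, and $r\in\mathbb N$, computes * a linear order $L$ of $V(G)$ witnessing $\mathrm{wcol}_{2r}(G)\le c(r)$, and * the set $D=\{\min_L \mathrm{WReach}_r[G,L,w] : w\in V(G)\}$, which is a $c(r)$-approximation of a minimum distance-$r$ dominating set of $G$. Here *linear time* means: there are $T\colon\mathbb N\to\mathbb N$ and $k\in\mathbb N$ (depending only on $\mathcal C$) such that, on a unit-cost random access machine, the algorithm halts after at most $T(r)\cdot(|V(G)|+|E(G)|+1)$ steps, and every number occurring in the run is at most $T(r)\cdot(|V(G)|+|E(G)|+1)^k$ (words of logarithmic length for fixed $r$). -/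

import Mathlib

/-! ## Classes of bounded expansion -/

/-- A class of finite graphs: for every `n`, a set of simple graphs with vertex set
`{0, …, n - 1}`. Every finite graph is isomorphic to such a graph. -/
abbrev GraphClass : Type := ∀ n : ℕ, Set (SimpleGraph (Fin n))

/-- `H` is a depth-`r` minor of `G`: there are pairwise disjoint connected subgraphs of `G` of
radius at most `r`, one for every vertex of `H`, such that for every edge of `H` there is an edge
of `G` between the two corresponding subgraphs. -/
def IsDepthMinor {V W : Type*} (r : ℕ) (H : SimpleGraph W) (G : SimpleGraph V) : Prop :=
  ∃ B : W → G.Subgraph,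
    (∀ i, (B i).Connected ∧ (B i).coe.radius ≤ r) ∧
    (∀ i j, i ≠ j → Disjoint (B i).verts (B j).verts) ∧
    (∀ i j, H.Adj i j → ∃ u ∈ (B i).verts, ∃ v ∈ (B j).verts, G.Adj u v)

/-- The average degree `2 |E(H)| / |V(H)|` (which is `0` for the graph without vertices). -/
noncomputable def avgDegree {W : Type*} (H : SimpleGraph W) : ℚ :=
  2 * (H.edgeSet.ncard : ℚ) / (Nat.card W : ℚ)

/-- A class has bounded expansion if the average degree of the depth-`r` minors of its members is
bounded by a function of `r`. -/
def GraphClass.BoundedExpansion (C : GraphClass) : Prop :=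
  ∃ f : ℕ → ℕ, ∀ (r m n : ℕ) (H : SimpleGraph (Fin m)) (G : SimpleGraph (Fin n)),
    G ∈ C n → IsDepthMinor r H G → avgDegree H ≤ f r

/-! ## Weak reachability and distance-`r` domination -/

/-- `WReach G L r v` is the set of vertices `u` that are weakly `r`-reachable from `v`: some path
of length at most `r` between `v` and `u` has `u` as its minimum with respect to `L`. -/
def WReach {V : Type*} (G : SimpleGraph V) (L : LinearOrder V) (r : ℕ) (v : V) : Set V :=
  {u | ∃ p : G.Walk v u, p.IsPath ∧ p.length ≤ r ∧ ∀ x ∈ p.support, L.le u x}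

/-- The order `L` witnesses that the weak `r`-colouring number
`min_L max_v |WReach_r[G, L, v]|` is at most `k`. -/
def WitnessesWcolLE {V : Type*} (G : SimpleGraph V) (L : LinearOrder V) (r k : ℕ) : Prop :=
  ∀ v, (WReach G L r v).ncard ≤ k

/-- `v` is the minimum, with respect to `L`, of `WReach G L r w`. -/
def IsMinWReach {V : Type*} (G : SimpleGraph V) (L : LinearOrder V) (r : ℕ) (w v : V) : Prop :=
  v ∈ WReach G L r w ∧ ∀ u ∈ WReach G L r w, L.le v u

/-- Every vertex of `G` is at distance at most `r` from some vertex of `M`. -/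
def IsDistDominating {V : Type*} (G : SimpleGraph V) (r : ℕ) (M : Finset V) : Prop :=
  ∀ w, ∃ v ∈ M, G.edist v w ≤ r

/-- `D` is a `k`-approximation of a minimum distance-`r` dominating set: it is a
distance-`r` dominating set of size at most `k` times the size of any other one. -/
def IsDistDominatingApprox {V : Type*} (G : SimpleGraph V) (r k : ℕ) (D : Finset V) : Prop :=
  IsDistDominating G r D ∧ ∀ M : Finset V, IsDistDominating G r M → D.card ≤ k * M.card

/-! ## Random access machines

A program works on registers and on memory arrays, all of whose cells hold natural numbers. It
mentions only finitely many registers and arrays (by their indices); array cells are addressed by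
computed values. Every operation and every memory access takes one step. So that the unit costs
are realistic, a machine comes with a bound `W` on the numbers that it can handle: a run in which
a larger number occurs (as a constant, an address, or an intermediate or final result of a
computation) does not exist. -/

namespace RAM

/-- The arithmetic operations; subtraction is truncated, division rounds down, and comparisons
yield `1` (true) or `0` (false). -/
inductive Op where
  | add | sub | mul | div | lt | eq

/-- The result of an arithmetic operation. -/
def Op.eval : Op → ℕ → ℕ → ℕ
  | .add, a, b => a + b
  | .sub, a, b => a - b
  | .mul, a, b => a * b
  | .div, a, b => a / b
  | .lt, a, b => if a < b then 1 else 0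
  | .eq, a, b => if a = b then 1 else 0

/-- Expressions: constants, registers, array cells, and operations. -/
inductive Expr where
  | const (k : ℕ)
  | reg (x : ℕ)
  | read (a : ℕ) (i : Expr)
  | op (o : Op) (e₁ e₂ : Expr)

/-- Programs. -/
inductive Prog where
  | skip
  | assign (x : ℕ) (e : Expr)
  | write (a : ℕ) (i e : Expr)
  | seq (p q : Prog)
  | ite (e : Expr) (p q : Prog)
  | while (e : Expr) (p : Prog)

/-- The contents `reg x` of the registers, and `arr a i` of the `i`-th cells of the arrays. -/
@[ext] structure State where
  reg : ℕ → ℕ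
  arr : ℕ → ℕ → ℕ

/-- Assign a value to a register. -/
def State.setReg (s : State) (x v : ℕ) : State :=
  { s with reg := Function.update s.reg x v }

/-- Assign a value to an array cell. -/
def State.setArr (s : State) (a i v : ℕ) : State :=
  { s with arr := Function.update s.arr a (Function.update (s.arr a) i v) }

/-- The value of an expression. -/
def Expr.eval (s : State) : Expr → ℕ
  | .const k => k
  | .reg x => s.reg x
  | .read a i => s.arr a (i.eval s)
  | .op o e₁ e₂ => o.eval (e₁.eval s) (e₂.eval s)

/-- The number of steps for the evaluation of an expression: one for every constant, register
access, memory access and operation. -/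
def Expr.cost : Expr → ℕ
  | .const _ => 1
  | .reg _ => 1
  | .read _ i => i.cost + 1
  | .op _ e₁ e₂ => e₁.cost + e₂.cost + 1

/-- All numbers that occur in the evaluation of an expression are at most `W`. -/
def Expr.Fits (W : ℕ) (s : State) : Expr → Prop
  | .const k => k ≤ W
  | .reg x => s.reg x ≤ W
  | .read a i => i.Fits W s ∧ s.arr a (i.eval s) ≤ W
  | .op o e₁ e₂ => e₁.Fits W s ∧ e₂.Fits W s ∧ o.eval (e₁.eval s) (e₂.eval s) ≤ W

/-- `Exec W p s t s'`: started in state `s`, the program `p` halts after exactly `t` steps in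
state `s'`, and all numbers that occur are at most `W`. -/
inductive Exec (W : ℕ) : Prog → State → ℕ → State → Prop
  | skip (s : State) : Exec W .skip s 1 s
  | assign (s : State) (x : ℕ) (e : Expr) : e.Fits W s →
      Exec W (.assign x e) s (e.cost + 1) (s.setReg x (e.eval s))
  | write (s : State) (a : ℕ) (i e : Expr) : i.Fits W s → e.Fits W s →
      Exec W (.write a i e) s (i.cost + e.cost + 1) (s.setArr a (i.eval s) (e.eval s))
  | seq (p q : Prog) (s₁ s₂ s₃ : State) (t₁ t₂ : ℕ) :
      Exec W p s₁ t₁ s₂ → Exec W q s₂ t₂ s₃ → Exec W (.seq p q) s₁ (t₁ + t₂) s₃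
  | ite_true (e : Expr) (p q : Prog) (s s' : State) (t : ℕ) : e.Fits W s → e.eval s ≠ 0 →
      Exec W p s t s' → Exec W (.ite e p q) s (e.cost + 1 + t) s'
  | ite_false (e : Expr) (p q : Prog) (s s' : State) (t : ℕ) : e.Fits W s → e.eval s = 0 →
      Exec W q s t s' → Exec W (.ite e p q) s (e.cost + 1 + t) s'
  | while_false (e : Expr) (p : Prog) (s : State) : e.Fits W s → e.eval s = 0 →
      Exec W (.while e p) s (e.cost + 1) s
  | while_true (e : Expr) (p : Prog) (s₁ s₂ s₃ : State) (t₁ t₂ : ℕ) : e.Fits W s₁ →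
      e.eval s₁ ≠ 0 → Exec W p s₁ t₁ s₂ → Exec W (.while e p) s₂ t₂ s₃ →
      Exec W (.while e p) s₁ (e.cost + 1 + t₁ + t₂) s₃

end RAM

/-! ## Input and output -/

/-- `adj v` lists the neighbours of `v`, each of them once, in an arbitrary order. -/
def IsAdjLists {n : ℕ} (G : SimpleGraph (Fin n)) (adj : Fin n → List (Fin n)) : Prop :=
  ∀ v, (adj v).Nodup ∧ ∀ u, u ∈ adj v ↔ G.Adj v u

/-- The initial state for adjacency lists `adj` and a number `r`. Register `0` holds the number
`n` of vertices and register `1` holds `r`. Array `1` holds the concatenation of the lists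
`adj 0, …, adj (n - 1)`, and cell `i ≤ n` of array `0` holds the position at which the list `adj i`
starts in it (for `i = n`, the total length). Everything else is `0`. -/
def inputState {n : ℕ} (adj : Fin n → List (Fin n)) (r : ℕ) : RAM.State where
  reg x := if x = 0 then n else if x = 1 then r else 0
  arr a i :=
    if a = 0 then
      if i ≤ n then (((List.ofFn adj).take i).map List.length).sum else 0
    else if a = 1 then ((List.ofFn adj).flatten.map Fin.val).getD i 0
    else 0

/-- Cells `0, …, n - 1` of array `2` list the vertices in increasing order with respect to `L`. -/
def OutputsOrder {n : ℕ} (s : RAM.State) (L : LinearOrder (Fin n)) : Prop :=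
  ∃ e : Fin n ≃ Fin n, (∀ i j, i ≤ j ↔ L.le (e i) (e j)) ∧ ∀ i : Fin n, s.arr 2 i = e i

/-- Cells `0, …, n - 1` of array `3` are the characteristic vector of `D`. -/
def OutputsSet {n : ℕ} (s : RAM.State) (D : Finset (Fin n)) : Prop :=
  ∀ v : Fin n, s.arr 3 v = if v ∈ D then 1 else 0

/-- The size `|V(G)| + |E(G)|` of the input graph, plus one. -/
noncomputable def graphSize {n : ℕ} (G : SimpleGraph (Fin n)) : ℕ :=
  n + G.edgeSet.ncard + 1

/-! ### Memory updates. -/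

namespace RAM

/-! The order comes from fraternal augmentations. Orient the edges of the graph with bounded
in-degree; then, for `2 * r` rounds, join any two nonadjacent vertices that have arcs to a common
vertex, and orient the new edges with bounded in-degree again. In-degrees stay bounded because every
arc is realised by a path of bounded length in the original graph, with a bounded number of these
paths through each inner vertex (`Routed`, `Routed.fraternal`). Such arcs have bounded average
degree on every vertex set (`Routed.two_mul_card_le`): a positive proportion of the paths have
pairwise disjoint interiors, for a positive proportion of these some vertex set contains the ends
and avoids the interiors, and the remaining paths form a shallow minor. Hence the graph of new edges
is degenerate, and a degeneracy order orients it.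

After `t` rounds, every walk of length at most `t` contains a vertex `y` from which directed paths
with at most `t` arcs lead to both ends (`IsFraternalChain.exists_common_ancestor`): where two arcs
of a walk meet head to head, the next round supplies a shortcut. With in-degree at most `d`, a
vertex has at most `(1 + d) ^ t` such ancestors, so the graph that joins vertices to their ancestors
is degenerate too. Let `L` be the reverse of a degeneracy order of it. If `u` is the least vertex of
a path from `v`, then `u` is the common ancestor `y` or one of its few neighbours on one side in the
order. Counting the choices of `y` and then of `u` bounds the weakly reachable sets
(`IsFraternalChain.witnessesWcolLE`).

For domination, the least vertex weakly `r`-reachable from `w` is the least vertex of the ball of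
radius `r` around `w` (`isMinWReach_iff`). If `m` dominates `w`, then walking from `m` over `w` to
that vertex stays in the ball, so the vertex is weakly `2 * r`-reachable from `m`. Charging it to
`m` gives the approximation ratio (`isDistDominatingApprox_of_witnesses`).

For the running time, it suffices to count loop iterations (`wp.exec`). Degeneracy orders are found
by removing vertices of degree below a threshold that grows only when no such vertex is left
(`wp_peel`); the program thus needs no knowledge of the class. Adjacency is tested in an `n` by `n`
array that is never initialised or cleared: it starts with zeros, and the graph of ancestors uses a
larger mark than the earlier rounds (`EdgeInv`). -/

@[simp] theorem State.setReg_reg (s : State) (x v y : ℕ) :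
    (s.setReg x v).reg y = if y = x then v else s.reg y := by
  simp [State.setReg, Function.update_apply]

@[simp] theorem State.setReg_arr (s : State) (x v : ℕ) : (s.setReg x v).arr = s.arr := rfl

@[simp] theorem State.setArr_reg (s : State) (a i v : ℕ) : (s.setArr a i v).reg = s.reg := rfl

@[simp] theorem State.setArr_arr (s : State) (a i v b : ℕ) :
    (s.setArr a i v).arr b = if b = a then Function.update (s.arr a) i v else s.arr b := by
  by_cases h : b = a
  · subst h; simp [State.setArr]
  · simp [State.setArr, h]

/-! ### Counting loop iterations instead of steps -/

/-- `Run p s t s'`: started in state `s`, the program `p` halts in state `s'`, and `t` is the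
total number of iterations of loops. -/
inductive Run : Prog → State → ℕ → State → Prop
  | skip (s : State) : Run .skip s 0 s
  | assign (s : State) (x : ℕ) (e : Expr) : Run (.assign x e) s 0 (s.setReg x (e.eval s))
  | write (s : State) (a : ℕ) (i e : Expr) :
      Run (.write a i e) s 0 (s.setArr a (i.eval s) (e.eval s))
  | seq {p q : Prog} {s₁ s₂ s₃ : State} {t₁ t₂ : ℕ} :
      Run p s₁ t₁ s₂ → Run q s₂ t₂ s₃ → Run (.seq p q) s₁ (t₁ + t₂) s₃
  | ite_true {e : Expr} {p q : Prog} {s s' : State} {t : ℕ} : e.eval s ≠ 0 →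
      Run p s t s' → Run (.ite e p q) s t s'
  | ite_false {e : Expr} {p q : Prog} {s s' : State} {t : ℕ} : e.eval s = 0 →
      Run q s t s' → Run (.ite e p q) s t s'
  | while_false {e : Expr} {p : Prog} {s : State} : e.eval s = 0 → Run (.while e p) s 0 s
  | while_true {e : Expr} {p : Prog} {s₁ s₂ s₃ : State} {t₁ t₂ : ℕ} : e.eval s₁ ≠ 0 →
      Run p s₁ t₁ s₂ → Run (.while e p) s₂ t₂ s₃ → Run (.while e p) s₁ (t₁ + t₂ + 1) s₃

/-- An upper bound on the number of steps outside of repeated loop iterations. -/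
def Prog.weight : Prog → ℕ
  | .skip => 1
  | .assign _ e => e.cost + 1
  | .write _ i e => i.cost + e.cost + 1
  | .seq p q => p.weight + q.weight
  | .ite e p q => e.cost + 1 + (p.weight + q.weight)
  | .while e p => e.cost + 1 + p.weight

/-- The numbers in the evaluation of an expression are at most the power with this exponent of
any bound `B ≥ 2` on the contents of the memory. -/
def Expr.exponent : Expr → ℕ
  | .const k => k
  | .reg _ => 1
  | .read _ i => i.exponent + 1
  | .op _ e₁ e₂ => e₁.exponent + e₂.exponent + 1

/-- The largest exponent that is needed for the expressions in a program. -/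
def Prog.exponent : Prog → ℕ
  | .skip => 0
  | .assign _ e => e.exponent
  | .write _ i e => i.exponent + e.exponent
  | .seq p q => p.exponent + q.exponent
  | .ite e p q => e.exponent + (p.exponent + q.exponent)
  | .while e p => e.exponent + p.exponent

/-- Expressions whose value exceeds the contents of the memory by at most one. -/
def Expr.isSlow : Expr → Bool
  | .const k => decide (k ≤ 2)
  | .reg _ => true
  | .read _ _ => true
  | .op .sub e _ => e.isSlow
  | .op .add (.reg _) (.const 1) => true
  | .op .add (.read _ _) (.const 1) => true
  | .op _ _ _ => false

/-- All values that the program stores are those of slow expressions. -/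
def Prog.isSlow : Prog → Bool
  | .skip => true
  | .assign _ e => e.isSlow
  | .write _ _ e => e.isSlow
  | .seq p q => p.isSlow && q.isSlow
  | .ite _ p q => p.isSlow && q.isSlow
  | .while _ p => p.isSlow

/-- All registers and cells contain numbers that are at most `B`. -/
def State.BoundedBy (s : State) (B : ℕ) : Prop :=
  (∀ x, s.reg x ≤ B) ∧ ∀ a i, s.arr a i ≤ B

theorem State.BoundedBy.mono {s : State} {B B' : ℕ} (h : s.BoundedBy B) (hB : B ≤ B') :
    s.BoundedBy B' :=
  ⟨fun x => (h.1 x).trans hB, fun a i => (h.2 a i).trans hB⟩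

theorem State.BoundedBy.setReg {s : State} {B : ℕ} (h : s.BoundedBy B) {v : ℕ} (hv : v ≤ B)
    (x : ℕ) : (s.setReg x v).BoundedBy B := by
  refine ⟨fun y => ?_, h.2⟩
  rw [State.setReg_reg]
  split_ifs
  exacts [hv, h.1 y]

theorem State.BoundedBy.setArr {s : State} {B : ℕ} (h : s.BoundedBy B) {v : ℕ} (hv : v ≤ B)
    (a i : ℕ) : (s.setArr a i v).BoundedBy B := by
  refine ⟨h.1, fun b j => ?_⟩
  rw [State.setArr_arr]
  split_ifs
  · rw [Function.update_apply]
    split_ifs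
    exacts [hv, h.2 a j]
  · exact h.2 b j

theorem Expr.Fits.mono {W W' : ℕ} (hW : W ≤ W') {s : State} {e : Expr} (h : e.Fits W s) :
    e.Fits W' s := by
  induction e with
  | const k => exact le_trans h hW
  | reg x => exact le_trans h hW
  | read a i ih => exact ⟨ih h.1, h.2.trans hW⟩
  | op o e₁ e₂ ih₁ ih₂ => exact ⟨ih₁ h.1, ih₂ h.2.1, h.2.2.trans hW⟩

theorem Exec.mono {W W' : ℕ} (hW : W ≤ W') {p : Prog} {s s' : State} {t : ℕ}
    (h : Exec W p s t s') : Exec W' p s t s' := by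
  induction h with
  | skip s => exact .skip s
  | assign s x e h => exact .assign s x e (h.mono hW)
  | write s a i e h h' => exact .write s a i e (h.mono hW) (h'.mono hW)
  | seq p q s₁ s₂ s₃ t₁ t₂ _ _ ih₁ ih₂ => exact .seq p q s₁ s₂ s₃ t₁ t₂ ih₁ ih₂
  | ite_true e p q s s' t h he _ ih => exact .ite_true e p q s s' t (h.mono hW) he ih
  | ite_false e p q s s' t h he _ ih => exact .ite_false e p q s s' t (h.mono hW) he ih
  | while_false e p s h he => exact .while_false e p s (h.mono hW) he
  | while_true e p s₁ s₂ s₃ t₁ t₂ h he _ _ ih₁ ih₂ =>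
    exact .while_true e p s₁ s₂ s₃ t₁ t₂ (h.mono hW) he ih₁ ih₂

/-- The final `+ 1` in the exponent supplies a factor of at least `2`, which is needed for sums;
products fit without it, and the other operations are smaller still. -/
theorem Op.eval_le_pow {B : ℕ} (hB : 2 ≤ B) (o : Op) {a b m k : ℕ} (ha : a ≤ B ^ m)
    (hb : b ≤ B ^ k) : o.eval a b ≤ B ^ (m + k + 1) := by
  have h1 : 1 ≤ B ^ m := Nat.one_le_pow _ _ (by omega)
  have h2 : 1 ≤ B ^ k := Nat.one_le_pow _ _ (by omega)
  have h3 : B ^ m * B ^ k * 2 ≤ B ^ (m + k + 1) := by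
    rw [pow_succ, pow_add]; gcongr
  have h4 : B ^ m ≤ B ^ m * B ^ k := Nat.le_mul_of_pos_right _ h2
  have h5 : B ^ k ≤ B ^ m * B ^ k := Nat.le_mul_of_pos_left _ h1
  cases o with
  | add => simp only [Op.eval]; omega
  | sub => simp only [Op.eval]; omega
  | mul =>
    simp only [Op.eval]
    have := Nat.mul_le_mul ha hb
    omega
  | div =>
    simp only [Op.eval]
    have := Nat.div_le_self a b
    omega
  | lt => simp only [Op.eval]; split_ifs <;> omega
  | eq => simp only [Op.eval]; split_ifs <;> omega

theorem Expr.fits_and_eval_le {B : ℕ} (hB : 2 ≤ B) {s : State} (hs : s.BoundedBy B) (e : Expr) :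
    e.Fits (B ^ e.exponent) s ∧ e.eval s ≤ B ^ e.exponent := by
  induction e with
  | const k =>
    have : k ≤ B ^ k := (Nat.lt_pow_self (by omega)).le
    exact ⟨this, this⟩
  | reg x =>
    have : s.reg x ≤ B ^ 1 := by simpa using hs.1 x
    exact ⟨this, this⟩
  | read a i ih =>
    have h1 : s.arr a (i.eval s) ≤ B ^ (i.exponent + 1) :=
      (hs.2 _ _).trans (Nat.le_self_pow (by omega) B)
    exact ⟨⟨ih.1.mono (Nat.pow_le_pow_right (by omega) (by simp [exponent])), h1⟩, h1⟩
  | op o e₁ e₂ ih₁ ih₂ =>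
    have h := Op.eval_le_pow hB o ih₁.2 ih₂.2
    exact ⟨⟨ih₁.1.mono (Nat.pow_le_pow_right (by omega) (by simp [exponent]; omega)),
      ih₂.1.mono (Nat.pow_le_pow_right (by omega) (by simp [exponent]; omega)), h⟩, h⟩

theorem Expr.eval_le_of_isSlow {B : ℕ} (hB : 2 ≤ B) {s : State} (hs : s.BoundedBy B) {e : Expr}
    (h : e.isSlow) : e.eval s ≤ B + 1 := by
  induction e using Expr.isSlow.induct with
  | case1 k =>
    simp only [isSlow, decide_eq_true_eq] at h
    simp only [eval]; omega
  | case2 x => exact (hs.1 x).trans (by omega)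
  | case3 a i => exact (hs.2 _ _).trans (by omega)
  | case4 e e' ih =>
    have := ih (by simpa [isSlow] using h)
    simp only [eval, Op.eval]; omega
  | case5 x =>
    have := hs.1 x
    simp only [eval, Op.eval]; omega
  | case6 a i =>
    have := hs.2 a (i.eval s)
    simp only [eval, Op.eval]; omega
  | case7 o e₁ e₂ h1 h2 h3 => simp [isSlow] at h

/-- Between two loop iterations only boundedly many steps pass. A slow program raises the largest
number in memory by at most one per step, so after `t'` stems the memory is bounded by `B + t'`, and
intermediate values are bounded by a fixed power of that. Without slowness, repeated squaring could
produce huge numbers in few steps. -/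
theorem Run.exec {p : Prog} {s s' : State} {t : ℕ} (h : Run p s t s') :
    ∀ {B : ℕ}, 2 ≤ B → s.BoundedBy B → p.isSlow →
      ∃ t' ≤ p.weight * (t + 1), Exec ((B + t') ^ p.exponent) p s t' s' ∧
        s'.BoundedBy (B + t') := by
  have fits : ∀ {B : ℕ} {s : State} (e : Expr) (t m : ℕ), 2 ≤ B → s.BoundedBy B →
      e.exponent ≤ m → e.Fits ((B + t) ^ m) s := fun e t m hB hs hm =>
    (e.fits_and_eval_le hB hs).1.mono ((Nat.pow_le_pow_left (by omega) _).trans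
      (Nat.pow_le_pow_right (by omega) hm))
  have up : ∀ {B C k m : ℕ}, 2 ≤ B → B ≤ C → k ≤ m → B ^ k ≤ C ^ m := fun hB hC hk =>
    (Nat.pow_le_pow_left hC _).trans (Nat.pow_le_pow_right (by omega) hk)
  induction h with
  | skip s => exact fun hB hs _ => ⟨1, by simp [Prog.weight], .skip s, hs.mono (by omega)⟩
  | assign s x e =>
    intro B hB hs hp
    refine ⟨_, by simp [Prog.weight], .assign s x e (fits e _ _ hB hs le_rfl), ?_⟩
    exact (hs.mono (by omega)).setReg
      ((e.eval_le_of_isSlow hB hs hp).trans (by omega)) x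
  | write s a i e =>
    intro B hB hs hp
    refine ⟨_, by simp [Prog.weight], .write s a i e
      (fits i _ _ hB hs (by simp [Prog.exponent])) (fits e _ _ hB hs (by simp [Prog.exponent])), ?_⟩
    exact (hs.mono (by omega)).setArr
      ((e.eval_le_of_isSlow hB hs hp).trans (by omega)) a _
  | @seq p q s₁ s₂ s₃ t₁ t₂ _ _ ih₁ ih₂ =>
    intro B hB hs hp
    simp only [Prog.isSlow, Bool.and_eq_true] at hp
    obtain ⟨u₁, hu₁, he₁, hb₁⟩ := ih₁ hB hs hp.1
    obtain ⟨u₂, hu₂, he₂, hb₂⟩ := ih₂ (by omega) hb₁ hp.2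
    refine ⟨u₁ + u₂, ?_, .seq _ _ _ s₂ _ _ _ (he₁.mono (up (by omega) (by omega) ?_))
      (he₂.mono (up (by omega) (by omega) ?_)), hb₂.mono (by omega)⟩
    · simp only [Prog.weight]; nlinarith
    · simp [Prog.exponent]
    · simp [Prog.exponent]
  | @ite_true e p q s s' t he _ ih =>
    intro B hB hs hp
    simp only [Prog.isSlow, Bool.and_eq_true] at hp
    obtain ⟨u, hu, hx, hb⟩ := ih hB hs hp.1
    refine ⟨e.cost + 1 + u, ?_, .ite_true _ _ _ _ _ _ (fits e _ _ hB hs (by simp [Prog.exponent]))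
      he (hx.mono (up (by omega) (by omega) (by simp [Prog.exponent]; omega))),
      hb.mono (by omega)⟩
    simp only [Prog.weight]; nlinarith
  | @ite_false e p q s s' t he _ ih =>
    intro B hB hs hp
    simp only [Prog.isSlow, Bool.and_eq_true] at hp
    obtain ⟨u, hu, hx, hb⟩ := ih hB hs hp.2
    refine ⟨e.cost + 1 + u, ?_, .ite_false _ _ _ _ _ _ (fits e _ _ hB hs (by simp [Prog.exponent]))
      he (hx.mono (up (by omega) (by omega) (by simp [Prog.exponent]; omega))),
      hb.mono (by omega)⟩
    simp only [Prog.weight]; nlinarith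
  | @while_false e p s he =>
    intro B hB hs hp
    exact ⟨e.cost + 1, by simp [Prog.weight],
      .while_false _ _ _ (fits e _ _ hB hs (by simp [Prog.exponent])) he, hs.mono (by omega)⟩
  | @while_true e p s₁ s₂ s₃ t₁ t₂ he _ _ ih₁ ih₂ =>
    intro B hB hs hp
    obtain ⟨u₁, hu₁, he₁, hb₁⟩ := ih₁ hB hs hp
    obtain ⟨u₂, hu₂, he₂, hb₂⟩ := ih₂ (by omega) hb₁ hp
    refine ⟨e.cost + 1 + u₁ + u₂, ?_, .while_true _ _ _ s₂ _ _ _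
      (fits e _ _ hB hs (by simp [Prog.exponent])) he
      (he₁.mono (up (by omega) (by omega) (by simp [Prog.exponent])))
      (he₂.mono (up (by omega) (by omega) (by simp))), hb₂.mono (by omega)⟩
    simp only [Prog.weight] at hu₂ ⊢; nlinarith

/-! ### Modified registers and arrays -/

/-- The registers that a program may change. -/
def Prog.regs : Prog → List ℕ
  | .skip => []
  | .assign x _ => [x]
  | .write _ _ _ => []
  | .seq p q => p.regs ++ q.regs
  | .ite _ p q => p.regs ++ q.regs
  | .while _ p => p.regs

/-- The arrays that a program may change. -/
def Prog.arrs : Prog → List ℕ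
  | .skip => []
  | .assign _ _ => []
  | .write a _ _ => [a]
  | .seq p q => p.arrs ++ q.arrs
  | .ite _ p q => p.arrs ++ q.arrs
  | .while _ p => p.arrs

/-- The two states agree outside of what the program may change. -/
def Prog.Frame (p : Prog) (s s' : State) : Prop :=
  (∀ x ∉ p.regs, s'.reg x = s.reg x) ∧ ∀ a ∉ p.arrs, s'.arr a = s.arr a

/-- This lets loop invariants mention only what changes; all other facts are recovered by deciding
membership in two explicit lists. -/
theorem Run.frame {p : Prog} {s s' : State} {t : ℕ} (h : Run p s t s') : p.Frame s s' := by
  induction h with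
  | skip s => exact ⟨fun _ _ => rfl, fun _ _ => rfl⟩
  | assign s x e =>
    exact ⟨fun y hy => by simp [Prog.regs] at hy; simp [hy], fun _ _ => rfl⟩
  | write s a i e =>
    exact ⟨fun _ _ => rfl, fun b hb => by simp [Prog.arrs] at hb; simp [hb]⟩
  | seq _ _ ih₁ ih₂ =>
    simp only [Prog.Frame, Prog.regs, Prog.arrs, List.mem_append, not_or] at *
    exact ⟨fun x hx => (ih₂.1 x hx.2).trans (ih₁.1 x hx.1),
      fun a ha => (ih₂.2 a ha.2).trans (ih₁.2 a ha.1)⟩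
  | ite_true _ _ ih =>
    simp only [Prog.Frame, Prog.regs, Prog.arrs, List.mem_append, not_or] at *
    exact ⟨fun x hx => ih.1 x hx.1, fun a ha => ih.2 a ha.1⟩
  | ite_false _ _ ih =>
    simp only [Prog.Frame, Prog.regs, Prog.arrs, List.mem_append, not_or] at *
    exact ⟨fun x hx => ih.1 x hx.2, fun a ha => ih.2 a ha.2⟩
  | while_false _ => exact ⟨fun _ _ => rfl, fun _ _ => rfl⟩
  | while_true _ _ _ ih₁ ih₂ =>
    exact ⟨fun x hx => (ih₂.1 x hx).trans (ih₁.1 x hx),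
      fun a ha => (ih₂.2 a ha).trans (ih₁.2 a ha)⟩

/-! ### Weakest preconditions -/

/-- Started in `s`, the program halts after at most `t` loop iterations in a state with `Q`. -/
def wp (p : Prog) (t : ℕ) (Q : State → Prop) (s : State) : Prop :=
  ∃ t' ≤ t, ∃ s', Run p s t' s' ∧ Q s'

theorem wp.mono {p : Prog} {t t' : ℕ} {Q Q' : State → Prop} {s : State} (h : wp p t Q s)
    (ht : t ≤ t') (hQ : ∀ s', Q s' → Q' s') : wp p t' Q' s := by
  obtain ⟨u, hu, s', hr, hq⟩ := h
  exact ⟨u, hu.trans ht, s', hr, hQ s' hq⟩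

theorem wp.frame {p : Prog} {t : ℕ} {Q Q' : State → Prop} {s : State} (h : wp p t Q s)
    (hQ : ∀ s', Q s' → p.Frame s s' → Q' s') : wp p t Q' s := by
  obtain ⟨u, hu, s', hr, hq⟩ := h
  exact ⟨u, hu, s', hr, hQ s' hq hr.frame⟩

theorem wp_skip {t : ℕ} {Q : State → Prop} {s : State} (h : Q s) : wp .skip t Q s :=
  ⟨0, Nat.zero_le _, s, .skip s, h⟩

theorem wp_assign {x : ℕ} {e : Expr} {t : ℕ} {Q : State → Prop} {s : State}
    (h : Q (s.setReg x (e.eval s))) : wp (.assign x e) t Q s :=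
  ⟨0, Nat.zero_le _, _, .assign s x e, h⟩

theorem wp_write {a : ℕ} {i e : Expr} {t : ℕ} {Q : State → Prop} {s : State}
    (h : Q (s.setArr a (i.eval s) (e.eval s))) : wp (.write a i e) t Q s :=
  ⟨0, Nat.zero_le _, _, .write s a i e, h⟩

theorem wp_seq {p q : Prog} {t : ℕ} (t₁ t₂ : ℕ) {Q : State → Prop} {s : State}
    (h : wp p t₁ (wp q t₂ Q) s) (ht : t₁ + t₂ ≤ t) : wp (.seq p q) t Q s := by
  obtain ⟨u₁, hu₁, s₁, hr₁, u₂, hu₂, s₂, hr₂, hQ⟩ := h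
  exact ⟨u₁ + u₂, by omega, s₂, .seq hr₁ hr₂, hQ⟩

theorem wp_seq_zero {p q : Prog} {t : ℕ} {Q : State → Prop} {s : State}
    (h : wp p 0 (wp q t Q) s) : wp (.seq p q) t Q s :=
  wp_seq 0 t h (by omega)

theorem wp_seq_assign {x : ℕ} {e : Expr} {q : Prog} {t : ℕ} {Q : State → Prop} {s : State}
    (h : wp q t Q (s.setReg x (e.eval s))) : wp (.seq (.assign x e) q) t Q s :=
  wp_seq_zero (wp_assign h)

theorem wp_seq_write {a : ℕ} {i e : Expr} {q : Prog} {t : ℕ} {Q : State → Prop} {s : State}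
    (h : wp q t Q (s.setArr a (i.eval s) (e.eval s))) : wp (.seq (.write a i e) q) t Q s :=
  wp_seq_zero (wp_write h)

theorem wp_ite {e : Expr} {p q : Prog} {t : ℕ} {Q : State → Prop} {s : State}
    (hp : e.eval s ≠ 0 → wp p t Q s) (hq : e.eval s = 0 → wp q t Q s) :
    wp (.ite e p q) t Q s := by
  by_cases he : e.eval s = 0
  · obtain ⟨u, hu, s', hr, h⟩ := hq he
    exact ⟨u, hu, s', .ite_false he hr, h⟩
  · obtain ⟨u, hu, s', hr, h⟩ := hp he
    exact ⟨u, hu, s', .ite_true he hr, h⟩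

/-- `Φ` is a potential: each round must release one unit for itself and `c` units for the loops
inside the body. This permits amortised bounds. -/
theorem wp_while {e : Expr} {p : Prog} (I : State → Prop) (Φ : State → ℕ) {Q : State → Prop}
    (hstep : ∀ s, I s → e.eval s ≠ 0 → ∃ c, wp p c (fun s' => I s' ∧ c + 1 + Φ s' ≤ Φ s) s)
    (hend : ∀ s, I s → e.eval s = 0 → Q s) {t : ℕ} {s : State} (h : I s) (ht : Φ s ≤ t) :
    wp (.while e p) t Q s := by
  suffices H : ∀ m s, Φ s ≤ m → I s → wp (.while e p) m Q s from
    (H (Φ s) s le_rfl h).mono ht fun _ h => h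
  intro m
  induction m using Nat.strong_induction_on with
  | _ m ih =>
    intro s hm hI
    by_cases he : e.eval s = 0
    · exact ⟨0, Nat.zero_le _, s, .while_false he, hend s hI he⟩
    · obtain ⟨c, u, hu, s', hr, hI', hc⟩ := hstep s hI he
      obtain ⟨u', hu', s'', hr', hQ⟩ := ih (Φ s') (by omega) s' le_rfl hI'
      exact ⟨u + u' + 1, by omega, s'', .while_true he hr hr', hQ⟩

/-! ### Counting loops, and the passage from iterations to steps. -/

/-- The loop `for x = 0, …, b - 1`. -/
def Prog.for (x : ℕ) (b : Expr) (p : Prog) : Prog :=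
  .seq (.assign x (.const 0)) (.while (.op .lt (.reg x) b)
    (.seq p (.assign x (.op .add (.reg x) (.const 1)))))

theorem Prog.Frame.refl (p : Prog) (s : State) : p.Frame s s :=
  ⟨fun _ _ => rfl, fun _ _ => rfl⟩

theorem Prog.Frame.trans {p : Prog} {s s' s'' : State} (h : p.Frame s s') (h' : p.Frame s' s'') :
    p.Frame s s'' :=
  ⟨fun x hx => (h'.1 x hx).trans (h.1 x hx), fun a ha => (h'.2 a ha).trans (h.2 a ha)⟩

theorem Prog.Frame.for_body {x : ℕ} {b : Expr} {p : Prog} {s s' : State} (h : p.Frame s s') :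
    (Prog.for x b p).Frame s s' :=
  ⟨fun y hy => h.1 y fun hy' => hy (by simp [Prog.for, Prog.regs, hy']),
    fun a ha => h.2 a (by simpa [Prog.for, Prog.arrs] using ha)⟩

theorem Prog.Frame.setReg {p : Prog} {s s' : State} (h : p.Frame s s') {x : ℕ} (hx : x ∈ p.regs)
    (v : ℕ) : p.Frame s (s'.setReg x v) :=
  ⟨fun y hy => by simp [show y ≠ x from fun e => hy (e ▸ hx), h.1 y hy], h.2⟩

/-- The bound `b` is evaluated anew in every round, so it has to keep the value `N`. The invariant
must not depend on the counter register, which is incremented after the body. -/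
theorem wp_for {x : ℕ} {b : Expr} {p : Prog} {N : ℕ} (I : ℕ → State → Prop) (c : Fin N → ℕ)
    {Q : State → Prop} {t : ℕ} {s : State} (hx : x ∉ p.regs) (h₀ : I 0 s)
    (hI : ∀ k s v, I k s → I k (s.setReg x v))
    (hb : ∀ k s', (Prog.for x b p).Frame s s' → I k s' → b.eval s' = N)
    (hstep : ∀ (k : Fin N) s', (Prog.for x b p).Frame s s' → s'.reg x = k → I k s' →
      wp p (c k) (I (k + 1)) s')
    (hend : ∀ s', (Prog.for x b p).Frame s s' → I N s' → Q s')
    (ht : ∑ k, (c k + 1) ≤ t) : wp (.for x b p) t Q s := by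
  have hxr : x ∈ (Prog.for x b p).regs := by simp [Prog.for, Prog.regs]
  refine wp_seq_assign ?_
  -- The costs are extended by `0` to all numbers, so that the potential is a sum over the interval
  -- of the remaining rounds.
  let d : ℕ → ℕ := fun k => if h : k < N then c ⟨k, h⟩ + 1 else 0
  refine wp_while (fun s' => s'.reg x ≤ N ∧ (Prog.for x b p).Frame s s' ∧ I (s'.reg x) s')
    (fun s' => ∑ k ∈ Finset.Ico (s'.reg x) N, d k) ?_ ?_
    ⟨by simp [Expr.eval], (Prog.Frame.refl _ _).setReg hxr _, by simpa [Expr.eval] using hI 0 s 0 h₀⟩ ?_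
  · rintro s' ⟨hxN, hf, hs⟩ he
    simp only [Expr.eval, Op.eval, hb _ _ hf hs, ne_eq, ite_eq_right_iff, one_ne_zero, imp_false,
      not_not] at he
    refine ⟨c ⟨s'.reg x, he⟩, wp_seq (c ⟨s'.reg x, he⟩) 0
      ((hstep ⟨s'.reg x, he⟩ s' hf rfl hs).frame ?_) (by omega)⟩
    intro s'' hI' hf'
    have hx' : s''.reg x = s'.reg x := hf'.1 x hx
    refine wp_assign ?_
    simp only [Expr.eval, Op.eval, hx', State.setReg_reg, if_true]
    refine ⟨⟨by omega, (hf.trans hf'.for_body).setReg hxr _, hI _ _ _ hI'⟩, ?_⟩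
    rw [Finset.sum_eq_sum_Ico_succ_bot he]
    simp [d, he]
  · rintro s' ⟨hxN, hf, hs⟩ he
    simp only [Expr.eval, Op.eval, hb _ _ hf hs, ite_eq_right_iff, one_ne_zero, imp_false,
      not_lt] at he
    have : s'.reg x = N := by omega
    exact hend s' hf (this ▸ hs)
  · simp only [Expr.eval, State.setReg_reg, if_true]
    refine le_trans (le_of_eq ?_) ht
    rw [← Finset.range_eq_Ico, Finset.sum_range]
    simp [d]

/-- A program with few loop iterations is fast and needs only small numbers. -/
theorem wp.exec {p : Prog} {t B : ℕ} {Q : State → Prop} {s : State} (h : wp p t Q s)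
    (hB : 2 ≤ B) (hs : s.BoundedBy B) (hp : p.isSlow) :
    ∃ t' ≤ p.weight * (t + 1), ∃ s', Exec ((B + p.weight * (t + 1)) ^ p.exponent) p s t' s' ∧
      Q s' := by
  obtain ⟨u, hu, s', hr, hQ⟩ := h
  obtain ⟨t', ht', he, -⟩ := hr.exec hB hs hp
  have h' : p.weight * (u + 1) ≤ p.weight * (t + 1) := Nat.mul_le_mul_left _ (by omega)
  exact ⟨t', by omega, s', he.mono (Nat.pow_le_pow_left (by omega) _), hQ⟩

end RAM

/-! ### Selecting positive proportions of a family. -/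

open Finset in
-- Take `B` maximal. Every member of `A` outside of `B` meets some member of `B`, and a member of
-- `B` is met by at most `m * q` others; the `+ 1` counts the member itself.
theorem Finset.exists_pairwiseDisjoint_subset {α V : Type*} [DecidableEq α] [DecidableEq V]
    (A : Finset α) (I : α → Finset V) {m q : ℕ} (hI : ∀ a ∈ A, #(I a) ≤ m)
    (hq : ∀ z, #{a ∈ A | z ∈ I a} ≤ q) :
    ∃ B ⊆ A, (B : Set α).PairwiseDisjoint I ∧ #A ≤ #B * (m * q + 1) := by
  classical
  obtain ⟨B, hB, hmax⟩ := exists_max_image (A.powerset.filter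
    fun B : Finset α => (B : Set α).PairwiseDisjoint I) card ⟨∅, by simp⟩
  simp only [mem_filter, mem_powerset] at hB hmax
  refine ⟨B, hB.1, hB.2, ?_⟩
  have hsub : A ⊆ B.biUnion fun b => insert b ((I b).biUnion fun z => {a ∈ A | z ∈ I a}) := by
    intro a ha
    simp only [mem_biUnion, mem_insert, mem_filter]
    by_cases haB : a ∈ B
    · exact ⟨a, haB, .inl rfl⟩
    by_contra! hcon
    have : #(insert a B) ≤ #B := hmax _ ⟨insert_subset ha hB.1, by
      rw [coe_insert]
      refine hB.2.insert fun b hb _ => ?_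
      rw [Finset.disjoint_left]
      exact fun z hza hzb => (hcon b hb).2 z hzb ha hza⟩
    rw [card_insert_of_notMem haB] at this
    omega
  refine (card_le_card hsub).trans (card_biUnion_le_card_mul _ _ _ fun b hb => ?_)
  refine (card_insert_le _ _).trans (Nat.succ_le_succ ?_)
  exact (card_biUnion_le_card_mul _ _ _ fun z _ => hq z).trans
    (Nat.mul_le_mul_right _ (hI b (hB.1 hb)))

open Finset in
/-- Some set contains all of `S a` and nothing of `I a` for a positive proportion of the `a`. -/
theorem Finset.exists_card_le_two_pow_mul {α V : Type*} [Fintype V] [DecidableEq V]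
    (B : Finset α) (S I : α → Finset V) {m : ℕ} (hd : ∀ a ∈ B, Disjoint (S a) (I a))
    (hm : ∀ a ∈ B, #(S a) + #(I a) ≤ m) :
    ∃ X : Finset V, #B ≤ 2 ^ m * #{a ∈ B | S a ⊆ X ∧ Disjoint X (I a)} := by
  by_contra! hcon
  have h1 : ∑ X : Finset V, 2 ^ m * #{a ∈ B | S a ⊆ X ∧ Disjoint X (I a)} <
      ∑ _X : Finset V, #B := sum_lt_sum_of_nonempty univ_nonempty fun X _ => hcon X
  have h0 : ∑ X : Finset V, #{a ∈ B | S a ⊆ X ∧ Disjoint X (I a)} =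
      ∑ a ∈ B, #(bipartiteBelow (fun (X : Finset V) a => S a ⊆ X ∧ Disjoint X (I a)) univ a) :=
    sum_card_bipartiteAbove_eq_sum_card_bipartiteBelow _
  rw [← mul_sum, h0, sum_const, card_univ, Fintype.card_finset, mul_sum, smul_eq_mul,
    mul_comm] at h1
  refine absurd h1 (not_lt.2 ?_)
  rw [← smul_eq_mul]
  refine card_nsmul_le_sum _ _ _ fun a ha => ?_
  -- The good sets for `a` form the interval from `S a` to the complement of `I a`. At least a
  -- fraction `2 ^ (-m)` of all sets belongs to it, so an average set is good for that fraction of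
  -- `B`.
  have h2 : bipartiteBelow (fun (X : Finset V) a => S a ⊆ X ∧ Disjoint X (I a)) univ a =
      Icc (S a) (I a)ᶜ := by
    ext X
    simp [bipartiteBelow, subset_compl_iff_disjoint_right]
  have h3 : S a ⊆ (I a)ᶜ := subset_compl_iff_disjoint_right.2 (hd a ha)
  rw [h2, card_Icc_finset h3, card_compl, ← pow_add]
  have := hm a ha
  exact Nat.pow_le_pow_right (by norm_num) (by omega)

/-! ### Arcs realised by short paths, and the minors they yield. -/

open Finset in
/-- The arcs in `A` are realised by paths of length at most `ℓ` in `G` such that every vertex is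
an inner vertex of at most `q` of them. -/
def Routed {V : Type*} [DecidableEq V] (G : SimpleGraph V) (ℓ q : ℕ) (A : Finset (V × V)) :
    Prop :=
  ∃ I : V × V → Finset V,
    (∀ a ∈ A, a.1 ≠ a.2 ∧ ∃ p : G.Walk a.1 a.2, p.IsPath ∧ p.length ≤ ℓ ∧
      ∀ z, z ∈ I a ↔ z ∈ p.support ∧ z ≠ a.1 ∧ z ≠ a.2) ∧
    ∀ z, #{a ∈ A | z ∈ I a} ≤ q

open Finset in
theorem Routed.subset {V : Type*} [DecidableEq V] {G : SimpleGraph V} {ℓ q : ℕ} {A B : Finset (V × V)}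
    (h : Routed G ℓ q A) (hB : B ⊆ A) : Routed G ℓ q B := by
  obtain ⟨I, h1, h2⟩ := h
  exact ⟨I, fun a ha => h1 a (hB ha),
    fun z => (card_le_card (filter_subset_filter _ hB)).trans (h2 z)⟩

/-- The walks stay inside of `S`, so they witness distances in the induced subgraph, with `x` as its
centre. -/
theorem SimpleGraph.connected_and_radius_induce_le {V : Type*} {G : SimpleGraph V} {r : ℕ}
    {S : Set V} {x : V} (hx : x ∈ S)
    (h : ∀ y ∈ S, ∃ p : G.Walk x y, p.length ≤ r ∧ ∀ z ∈ p.support, z ∈ S) :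
    ((⊤ : G.Subgraph).induce S).Connected ∧ ((⊤ : G.Subgraph).induce S).coe.radius ≤ r := by
  have h' : ∀ y : S, ∃ p : (G.induce S).Walk ⟨x, hx⟩ y, p.length ≤ r := by
    rintro ⟨y, hy⟩
    obtain ⟨p, hp, hpS⟩ := h y hy
    refine ⟨p.induce S hpS, ?_⟩
    rwa [← Walk.length_map (Embedding.induce S).toHom, Walk.map_induce]
  have h'' : (G.induce S).radius ≤ r := by
    refine radius_le_eccent.trans ((eccent_le_iff ⟨x, hx⟩ r).2 fun y => ?_)
    obtain ⟨p, hp⟩ := h' y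
    exact p.edist_le.trans (by exact_mod_cast hp)
  refine ⟨connected_induce_iff.1 ((connected_iff_exists_forall_reachable _).2
    ⟨⟨x, hx⟩, fun y => (h' y).elim fun p _ => ⟨p⟩⟩), ?_⟩
  rwa [← induce_eq_coe_induce_top]

open Finset in
/-- Internally disjoint paths of length at most `ℓ` between vertices of `X` whose inner vertices
are not in `X` yield a depth-`ℓ` minor. -/
theorem IsDepthMinor.of_disjoint_paths {n : ℕ} {G : SimpleGraph (Fin n)} {ℓ k : ℕ}
    (hG : ∀ (m : ℕ) (H : SimpleGraph (Fin m)), IsDepthMinor ℓ H G → avgDegree H ≤ k)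
    (A : Finset (Fin n × Fin n)) (I : Fin n × Fin n → Finset (Fin n))
    (hA : ∀ a ∈ A, a.1 ≠ a.2 ∧ ∃ p : G.Walk a.1 a.2, p.IsPath ∧ p.length ≤ ℓ ∧
      ∀ z, z ∈ I a ↔ z ∈ p.support ∧ z ≠ a.1 ∧ z ≠ a.2)
    (hswap : ∀ a ∈ A, a.swap ∉ A) (hI : (A : Set (Fin n × Fin n)).PairwiseDisjoint I)
    (X : Finset (Fin n)) (hX : ∀ a ∈ A, a.1 ∈ X ∧ a.2 ∈ X ∧ Disjoint X (I a)) :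
    2 * #A ≤ k * #X := by
  let e : Fin #X ≃ X := X.equivFin.symm
  let H : SimpleGraph (Fin #X) :=
    { Adj i j := ((e i : Fin n), (e j : Fin n)) ∈ A ∨ ((e j : Fin n), (e i : Fin n)) ∈ A
      symm := ⟨fun i j h => h.symm⟩
      loopless := ⟨fun i h => (hA _ (h.elim id id)).1 rfl⟩ }
  -- A branch set consists of a vertex of `X` and the interiors of all paths that start there. The
  -- last edge of a path then leads to the branch set of its other end.
  let S : Fin #X → Set (Fin n) := fun i => {z | z = e i ∨ ∃ a ∈ A, a.1 = e i ∧ z ∈ I a}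
  have hminor : IsDepthMinor ℓ H G := by
    refine ⟨fun i => (⊤ : G.Subgraph).induce (S i), fun i => ?_, fun i j hij => ?_, ?_⟩
    · refine SimpleGraph.connected_and_radius_induce_le (x := (e i : Fin n)) (.inl rfl) ?_
      rintro y (rfl | ⟨a, ha, hai, hy⟩)
      · exact ⟨.nil, by simp, by simp [S]⟩
      · obtain ⟨-, p, hp, hl, hpI⟩ := hA a ha
        have hyp := (hpI y).1 hy
        -- The initial segment up to the inner vertex `y` avoids the far end, because `p` is a path.
        have hsub : ∀ z ∈ (p.takeUntil y hyp.1).support, z ∈ S i := by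
          intro z hz
          by_cases hza : z = a.1
          · exact .inl (hza.trans hai)
          · refine .inr ⟨a, ha, hai, (hpI z).2 ⟨?_, hza, ?_⟩⟩
            · exact p.support_takeUntil_subset_support _ hz
            · rintro rfl
              exact SimpleGraph.Walk.endpoint_notMem_support_takeUntil hp hyp.1
                (Ne.symm hyp.2.2) hz
        refine ⟨(p.takeUntil y hyp.1).copy hai rfl, ?_, ?_⟩
        · rw [SimpleGraph.Walk.length_copy]
          exact (p.length_takeUntil_le_length _).trans hl
        · rwa [SimpleGraph.Walk.support_copy]
    · have hij' : (e i : Fin n) ≠ e j := fun h => hij (e.injective (Subtype.ext h))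
      refine Set.disjoint_left.2 ?_
      rintro z (rfl | ⟨a, ha, hai, hz⟩) (hj | ⟨b, hb, hbj, hz'⟩)
      · exact hij' hj
      · exact Finset.disjoint_left.1 (hX b hb).2.2 (e i).2 hz'
      · exact Finset.disjoint_left.1 (hX a ha).2.2 (hj ▸ (e j).2) hz
      · have hab : a = b := by
          by_contra hab
          exact Finset.disjoint_left.1 (hI ha hb hab) hz hz'
        exact hij' (by rw [← hai, ← hbj, hab])
    · have key : ∀ i j, ((e i : Fin n), (e j : Fin n)) ∈ A →
          ∃ u ∈ S i, ∃ v ∈ S j, G.Adj u v := by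
        intro i j hij
        obtain ⟨hne, p, hp, hl, hpI⟩ := hA _ hij
        have hadj := p.adj_penultimate (SimpleGraph.Walk.not_nil_of_ne hne)
        refine ⟨p.penultimate, ?_, e j, .inl rfl, hadj⟩
        by_cases h : p.penultimate = e i
        · exact .inl h
        · exact .inr ⟨_, hij, rfl, (hpI _).2 ⟨List.mem_of_mem_dropLast
            (p.penultimate_mem_dropLast_support (SimpleGraph.Walk.not_nil_of_ne hne)), h, hadj.ne⟩⟩
      rintro i j (hij | hij)
      · exact key i j hij
      · obtain ⟨u, hu, v, hv, huv⟩ := key j i hij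
        exact ⟨v, hv, u, hu, huv.symm⟩
  -- No arc occurs together with its reverse, so forgetting orientations is injective on `A`.
  have hcard : #A ≤ H.edgeSet.ncard := by
    have h1 : #(A.image fun a => s(a.1, a.2)) = #A := card_image_of_injOn fun a ha b hb hab => by
      rcases Sym2.eq_iff.1 hab with h | h
      · exact Prod.ext h.1 h.2
      · exact absurd (Prod.ext h.1 h.2 : a = b.swap) fun h => hswap b hb (h ▸ ha)
    rw [← h1, ← Set.ncard_coe_finset]
    refine le_trans (Set.ncard_le_ncard ?_ (Set.toFinite _))
      (Set.ncard_image_le (f := Sym2.map fun i => (e i : Fin n)) H.edgeSet.toFinite)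
    intro s hs
    obtain ⟨a, ha, rfl⟩ := Finset.mem_image.1 hs
    refine ⟨s(e.symm ⟨a.1, (hX a ha).1⟩, e.symm ⟨a.2, (hX a ha).2.1⟩), ?_, by simp⟩
    exact .inl (by simpa using ha)
  have h := hG _ H hminor
  rw [avgDegree, Nat.card_eq_fintype_card, Fintype.card_fin] at h
  rcases X.eq_empty_or_nonempty with rfl | hXne
  · have : A = ∅ := Finset.eq_empty_of_forall_notMem fun a ha => by simpa using (hX a ha).1
    simp [this]
  · rw [div_le_iff₀ (by exact_mod_cast hXne.card_pos)] at h
    have h' : 2 * H.edgeSet.ncard ≤ k * #X := by exact_mod_cast h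
    omega

/-- The average degree of graphs on a set of vertices is at most `routedDegree ℓ q k` if their
edges are realised by paths of length at most `ℓ` that pass at most `q` times through a vertex,
in a graph all of whose depth-`ℓ` minors have average degree at most `k`. -/
def routedDegree (ℓ q k : ℕ) : ℕ := ((ℓ + 1) * q + 1) * 2 ^ (ℓ + 3) * k

open Finset in
-- First thin out to disjoint interiors, losing a factor `(ℓ + 1) * q + 1`; then choose a set `Y`
-- that contains the ends and avoids the interiors of a proportion `2 ^ (-(ℓ + 3))` of the rest. The
-- exponent counts two ends and at most `ℓ + 1` inner vertices. The surviving arcs form a depth-`ℓ`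
-- minor on `X ∩ Y`.
theorem Routed.two_mul_card_le {n : ℕ} {G : SimpleGraph (Fin n)} {ℓ q k : ℕ}
    (hG : ∀ (m : ℕ) (H : SimpleGraph (Fin m)), IsDepthMinor ℓ H G → avgDegree H ≤ k)
    {A : Finset (Fin n × Fin n)} (hA : Routed G ℓ q A) (hswap : ∀ a ∈ A, a.swap ∉ A)
    (X : Finset (Fin n)) (hX : ∀ a ∈ A, a.1 ∈ X ∧ a.2 ∈ X) :
    2 * #A ≤ routedDegree ℓ q k * #X := by
  obtain ⟨I, hI, hq⟩ := hA
  have hcard : ∀ a ∈ A, #(I a) ≤ ℓ + 1 := by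
    intro a ha
    obtain ⟨-, p, -, hl, hpI⟩ := hI a ha
    calc #(I a) ≤ #p.support.toFinset :=
          card_le_card fun z hz => List.mem_toFinset.2 ((hpI z).1 hz).1
      _ ≤ p.support.length := p.support.toFinset_card_le
      _ ≤ ℓ + 1 := by rw [SimpleGraph.Walk.length_support]; omega
  obtain ⟨B, hBA, hBI, hAB⟩ := exists_pairwiseDisjoint_subset A I hcard hq
  obtain ⟨Y, hY⟩ := exists_card_le_two_pow_mul B (fun a => {a.1, a.2}) I (m := ℓ + 3)
    (fun a ha => by
      obtain ⟨-, p, -, -, hpI⟩ := hI a (hBA ha)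
      simp [hpI])
    (fun a ha => by
      have h1 := hcard a (hBA ha)
      have h2 : #{a.1, a.2} ≤ 2 := card_le_two
      show #{a.1, a.2} + #(I a) ≤ ℓ + 3
      omega)
  set D := {a ∈ B | {a.1, a.2} ⊆ Y ∧ Disjoint Y (I a)} with hD
  have hDB : D ⊆ B := filter_subset _ _
  have h := IsDepthMinor.of_disjoint_paths hG D I (fun a ha => hI a (hBA (hDB ha)))
    (fun a ha h => hswap a (hBA (hDB ha)) (hBA (hDB h))) (hBI.subset (by exact_mod_cast hDB))
    (X ∩ Y) (fun a ha => by
      have h1 := (mem_filter.1 ha).2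
      simp only [insert_subset_iff, singleton_subset_iff] at h1
      have h2 := hX a (hBA (hDB ha))
      exact ⟨mem_inter.2 ⟨h2.1, h1.1.1⟩, mem_inter.2 ⟨h2.2, h1.1.2⟩,
        h1.2.mono_left inter_subset_right⟩)
  have h3 : #(X ∩ Y) ≤ #X := card_le_card inter_subset_left
  calc 2 * #A ≤ 2 * (2 ^ (ℓ + 3) * #D * ((ℓ + 1) * q + 1)) := by
        gcongr
        exact hAB.trans (Nat.mul_le_mul_right _ hY)
    _ = ((ℓ + 1) * q + 1) * 2 ^ (ℓ + 3) * (2 * #D) := by ring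
    _ ≤ ((ℓ + 1) * q + 1) * 2 ^ (ℓ + 3) * (k * #X) := by
        exact Nat.mul_le_mul_left _ (h.trans (Nat.mul_le_mul_left _ h3))
    _ = routedDegree ℓ q k * #X := by rw [routedDegree]; ring

open Finset in
-- If all degrees inside of `X` were larger, so would be their average. Only the arcs from smaller
-- to larger vertices are counted, since the bound for routed families excludes pairs of opposite
-- arcs.
theorem Routed.exists_card_filter_le {n : ℕ} {G : SimpleGraph (Fin n)} {ℓ q k : ℕ}
    (hG : ∀ (m : ℕ) (H : SimpleGraph (Fin m)), IsDepthMinor ℓ H G → avgDegree H ≤ k)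
    {A : Finset (Fin n × Fin n)} (hA : Routed G ℓ q A) (N : Fin n → Finset (Fin n))
    (hN : ∀ x y, y ∈ N x → x ∈ N y) (hNA : ∀ x y, y ∈ N x → (x, y) ∈ A)
    {X : Finset (Fin n)} (hX : X.Nonempty) :
    ∃ v ∈ X, #{u ∈ N v | u ∈ X} ≤ routedDegree ℓ q k := by
  by_contra! hcon
  let E : Finset (Fin n × Fin n) := {a | a.1 ∈ X ∧ a.2 ∈ X ∧ a.2 ∈ N a.1}
  let E' : Finset (Fin n × Fin n) := {a ∈ E | a.1 < a.2}
  have hne : ∀ a ∈ E, a.1 ≠ a.2 := by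
    intro a ha
    obtain ⟨I, hI, -⟩ := hA
    exact (hI a (hNA _ _ (mem_filter.1 ha).2.2.2)).1
  have h1 : 2 * #E' ≤ routedDegree ℓ q k * #X := by
    refine Routed.two_mul_card_le hG (hA.subset fun a ha => ?_) (fun a ha ha' => ?_) X
      fun a ha => ?_
    · exact hNA _ _ (mem_filter.1 (mem_filter.1 ha).1).2.2.2
    · exact lt_asymm (mem_filter.1 ha).2 (mem_filter.1 ha').2
    · have := (mem_filter.1 (mem_filter.1 ha).1).2
      exact ⟨this.1, this.2.1⟩
  have h2 : E ⊆ E' ∪ E'.image Prod.swap := by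
    intro a ha
    rcases lt_or_gt_of_ne (hne a ha) with h | h
    · exact mem_union_left _ (mem_filter.2 ⟨ha, h⟩)
    · refine mem_union_right _ (mem_image.2 ⟨a.swap, mem_filter.2 ⟨?_, h⟩, a.swap_swap⟩)
      simp only [E, mem_filter, mem_univ, true_and, Prod.fst_swap, Prod.snd_swap] at ha ⊢
      exact ⟨ha.2.1, ha.1, hN _ _ ha.2.2⟩
  have h3 : #E ≤ 2 * #E' := by
    have := (card_le_card h2).trans (card_union_le _ _)
    have := card_image_le (s := E') (f := Prod.swap)
    omega
  have h4 : #E = ∑ v ∈ X, #{a ∈ E | a.1 = v} :=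
    card_eq_sum_card_fiberwise fun a ha => (mem_filter.1 ha).2.1
  have h5 : ∑ _v ∈ X, routedDegree ℓ q k < ∑ v ∈ X, #{a ∈ E | a.1 = v} := by
    refine sum_lt_sum_of_nonempty hX fun v hv => (hcon v hv).trans_le ?_
    refine card_le_card_of_injOn (fun u => (v, u)) (fun u hu => ?_) (by simp)
    have hu' := mem_filter.1 hu
    simp [E, hv, hu'.1, hu'.2]
  rw [sum_const, smul_eq_mul, mul_comm] at h5
  omega

open Finset in
theorem Routed.of_adj {V : Type*} [DecidableEq V] {G : SimpleGraph V} {A : Finset (V × V)}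
    (hA : ∀ a ∈ A, G.Adj a.1 a.2) : Routed G 1 0 A := by
  refine ⟨fun _ => ∅, fun a ha => ⟨(hA a ha).ne, (hA a ha).toWalk, ?_, by simp, fun z => ?_⟩,
    by simp⟩
  · simp [(hA a ha).ne]
  · simp
    tauto

open Finset in
-- Arcs in both families keep their path from the first one, so the congestions just add up.
theorem Routed.union {V : Type*} [DecidableEq V] {G : SimpleGraph V} {ℓ ℓ' q q' : ℕ}
    {A B : Finset (V × V)} (hA : Routed G ℓ q A) (hB : Routed G ℓ' q' B) (hl : ℓ ≤ ℓ') :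
    Routed G ℓ' (q + q') (A ∪ B) := by
  obtain ⟨I, h1, h2⟩ := hA
  obtain ⟨J, h3, h4⟩ := hB
  refine ⟨fun a => if a ∈ A then I a else J a, fun a ha => ?_, fun z => ?_⟩
  · by_cases haA : a ∈ A
    · obtain ⟨h5, p, hp, hpl, h6⟩ := h1 a haA
      exact ⟨h5, p, hp, hpl.trans hl, by simpa [haA] using h6⟩
    · simpa [haA] using h3 a ((mem_union.1 ha).resolve_left haA)
  · refine le_trans (card_le_card ?_) ((card_union_le _ _).trans (add_le_add (h2 z) (h4 z)))
    intro a ha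
    simp only [mem_filter, mem_union] at ha ⊢
    by_cases haA : a ∈ A
    · simp_all
    · simp_all

open Finset in
/-- Pairs of vertices with a common out-neighbour are realised by the concatenations of two
paths. -/
theorem Routed.fraternal {V : Type*} [Fintype V] [DecidableEq V] {G : SimpleGraph V}
    {ℓ q d : ℕ} {A F : Finset (V × V)} (hA : Routed G ℓ q A)
    (hd : ∀ z, #{x | (x, z) ∈ A} ≤ d)
    (hF : ∀ a ∈ F, a.1 ≠ a.2 ∧ ∃ z, (a.1, z) ∈ A ∧ (a.2, z) ∈ A) :
    Routed G (2 * ℓ) (d * d + q * d + q * d) F := by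
  obtain ⟨I, h1, h2⟩ := hA
  have hF' : ∀ a ∈ F, ∃ z, (a.1, z) ∈ A ∧ (a.2, z) ∈ A := fun a ha => (hF a ha).2
  rcases F.eq_empty_or_nonempty with rfl | ⟨a₀, -⟩
  · exact ⟨fun _ => ∅, by simp, by simp⟩
  have : Nonempty V := ⟨a₀.1⟩
  choose! m hm using hF'
  have key : ∀ a ∈ F, ∃ p : G.Walk a.1 a.2, p.IsPath ∧ p.length ≤ 2 * ℓ ∧
      ∀ t ∈ p.support, t ≠ a.1 → t ≠ a.2 → t = m a ∨ t ∈ I (a.1, m a) ∨ t ∈ I (a.2, m a) := by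
    intro a ha
    obtain ⟨-, p₁, -, hl₁, hp₁⟩ := h1 _ (hm a ha).1
    obtain ⟨-, p₂, -, hl₂, hp₂⟩ := h1 _ (hm a ha).2
    refine ⟨(p₁.append p₂.reverse).bypass, SimpleGraph.Walk.bypass_isPath _,
      (SimpleGraph.Walk.length_bypass_le_length _).trans ?_, fun t ht ht1 ht2 => ?_⟩
    · rw [SimpleGraph.Walk.length_append, SimpleGraph.Walk.length_reverse]
      simp only at hl₁ hl₂
      omega
    · have := SimpleGraph.Walk.support_bypass_subset_support _ ht
      rw [SimpleGraph.Walk.mem_support_append_iff, SimpleGraph.Walk.support_reverse,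
        List.mem_reverse] at this
      by_cases htm : t = m a
      · exact .inl htm
      · exact .inr (this.imp (fun h => (hp₁ t).2 ⟨h, ht1, htm⟩) fun h => (hp₂ t).2 ⟨h, ht2, htm⟩)
  choose p hp hpl hpI using key
  refine ⟨fun a => if ha : a ∈ F then {t ∈ (p a ha).support.toFinset | t ≠ a.1 ∧ t ≠ a.2} else ∅,
    fun a ha => ⟨(hF a ha).1, p a ha, hp a ha, hpl a ha, by simp [ha]⟩, fun t => ?_⟩
  -- A vertex `t` inside the path for a pair is the chosen common out-neighbour, which allows `d *
  -- d` pairs, or it is inside one of the two old paths. In that case one of at most `q` arcs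
  -- through `t` is used, and the other vertex of the pair is one of at most `d` in-neighbours of
  -- its head.
  have hsub : {a ∈ F | t ∈ if ha : a ∈ F then
      {t ∈ (p a ha).support.toFinset | t ≠ a.1 ∧ t ≠ a.2} else ∅} ⊆
      ({x | (x, t) ∈ A} : Finset V) ×ˢ ({x | (x, t) ∈ A} : Finset V) ∪
      ({b ∈ A | t ∈ I b}.biUnion fun b => ({y | (y, b.2) ∈ A} : Finset V).image (b.1, ·)) ∪
      ({b ∈ A | t ∈ I b}.biUnion fun b => ({y | (y, b.2) ∈ A} : Finset V).image (·, b.1)) := by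
    intro a ha
    obtain ⟨haF, hta⟩ := mem_filter.1 ha
    simp only [haF, dite_true, mem_filter, List.mem_toFinset] at hta
    obtain ⟨hm1, hm2⟩ := hm a haF
    rcases hpI a haF t hta.1 hta.2.1 hta.2.2 with rfl | h | h
    · exact mem_union_left _ (mem_union_left _ (by simp [hm1, hm2]))
    · refine mem_union_left _ (mem_union_right _ (mem_biUnion.2 ⟨_, mem_filter.2 ⟨hm1, h⟩,
        mem_image.2 ⟨a.2, by simp [hm2], rfl⟩⟩))
    · refine mem_union_right _ (mem_biUnion.2 ⟨_, mem_filter.2 ⟨hm2, h⟩,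
        mem_image.2 ⟨a.1, by simp [hm1], rfl⟩⟩)
  refine (card_le_card hsub).trans ((card_union_le _ _).trans (add_le_add
    ((card_union_le _ _).trans (add_le_add ?_ ?_)) ?_))
  · rw [card_product]
    exact Nat.mul_le_mul (hd t) (hd t)
  · exact (card_biUnion_le_card_mul _ _ _ fun b _ => card_image_le.trans (hd b.2)).trans
      (Nat.mul_le_mul_right _ (h2 t))
  · exact (card_biUnion_le_card_mul _ _ _ fun b _ => card_image_le.trans (hd b.2)).trans
      (Nat.mul_le_mul_right _ (h2 t))

/-! ### Degenerate neighbourhood lists -/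

/-- Every nonempty set of vertices contains a vertex with at most `k` neighbours in the set. -/
def Degenerate {n : ℕ} (nb : Fin n → List (Fin n)) (k : ℕ) : Prop :=
  ∀ X : Finset (Fin n), X.Nonempty → ∃ v ∈ X, (nb v).countP (· ∈ X) ≤ k

/-- Neighbourhood lists of a simple graph. -/
structure IsNbLists {n : ℕ} (nb : Fin n → List (Fin n)) (N : Fin n → Fin n → Prop) : Prop where
  nodup : ∀ v, (nb v).Nodup
  mem_iff : ∀ x y, y ∈ nb x ↔ N x y

theorem List.Nodup.countP_mem_eq_card {α : Type*} [DecidableEq α] {l : List α} (hl : l.Nodup)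
    (X : Finset α) : l.countP (· ∈ X) = (l.toFinset.filter (· ∈ X)).card := by
  rw [List.countP_eq_length_filter, ← List.toFinset_card_of_nodup (hl.filter _),
    List.toFinset_filter]
  simp

theorem IsNbLists.degenerate_of_routed {n : ℕ} {G : SimpleGraph (Fin n)} {ℓ q k : ℕ}
    (hG : ∀ (m : ℕ) (H : SimpleGraph (Fin m)), IsDepthMinor ℓ H G → avgDegree H ≤ k)
    {nb : Fin n → List (Fin n)} {N : Fin n → Fin n → Prop} (hnb : IsNbLists nb N)
    (hN : ∀ x y, N x y → N y x) {A : Finset (Fin n × Fin n)} (hA : Routed G ℓ q A)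
    (hNA : ∀ x y, N x y → (x, y) ∈ A) : Degenerate nb (routedDegree ℓ q k) := by
  intro X hX
  obtain ⟨v, hv, h⟩ := hA.exists_card_filter_le hG (fun x => (nb x).toFinset)
    (fun x y h => by simp only [List.mem_toFinset, hnb.mem_iff] at h ⊢; exact hN _ _ h)
    (fun x y h => by simp only [List.mem_toFinset, hnb.mem_iff] at h; exact hNA _ _ h) hX
  exact ⟨v, hv, by rwa [(hnb.nodup v).countP_mem_eq_card]⟩

open Finset in
/-- A graph with an orientation of small degree is degenerate. -/
theorem IsNbLists.degenerate_of_orientation {n : ℕ} {nb : Fin n → List (Fin n)}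
    {N : Fin n → Fin n → Prop} (hnb : IsNbLists nb N) (T : Fin n → List (Fin n)) {k : ℕ}
    (hT : ∀ v, (T v).length ≤ k) (hNT : ∀ x y, N x y → y ∈ T x ∨ x ∈ T y) :
    Degenerate nb (2 * k) := by
  intro X hX
  by_contra! hcon
  have h1 : ∀ v, #(T v).toFinset ≤ k := fun v => (T v).toFinset_card_le.trans (hT v)
  have h2 : ∑ _v ∈ X, 2 * k < ∑ v ∈ X, (#(T v).toFinset + #{u ∈ X | v ∈ T u}) := by
    refine sum_lt_sum_of_nonempty hX fun v hv => (hcon v hv).trans_le ?_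
    rw [(hnb.nodup v).countP_mem_eq_card]
    refine (card_le_card ?_).trans (card_union_le _ _)
    intro u hu
    simp only [mem_filter, List.mem_toFinset, hnb.mem_iff, mem_union] at hu ⊢
    exact (hNT _ _ hu.1).imp id fun h => ⟨hu.2, h⟩
  -- The second summand counts each oriented edge at its other end, so it has the same total as the
  -- out-degrees.
  have h3 : ∑ v ∈ X, #{u ∈ X | v ∈ T u} = ∑ u ∈ X, #{v ∈ X | v ∈ T u} :=
    sum_card_bipartiteAbove_eq_sum_card_bipartiteBelow _
  have h4 : ∑ u ∈ X, #{v ∈ X | v ∈ T u} ≤ ∑ _u ∈ X, k := sum_le_sum fun u _ =>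
    (card_le_card fun v hv => List.mem_toFinset.2 (mem_filter.1 hv).2).trans (h1 u)
  have h5 : ∑ v ∈ X, #(T v).toFinset ≤ ∑ _u ∈ X, k := sum_le_sum fun u _ => h1 u
  rw [sum_add_distrib, h3, ← mul_sum] at h2
  omega

/-- The neighbours of `v` that come after it in the order given by `pos`. -/
def laterNb {n : ℕ} (nb : Fin n → List (Fin n)) (pos : Fin n → ℕ) (v : Fin n) : List (Fin n) :=
  (nb v).filter fun u => pos v < pos u

theorem mem_laterNb {n : ℕ} {nb : Fin n → List (Fin n)} {pos : Fin n → ℕ} {u v : Fin n} :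
    u ∈ laterNb nb pos v ↔ u ∈ nb v ∧ pos v < pos u := by
  simp [laterNb]

open Finset in
/-- The total length of the neighbourhood lists of a graph with few later neighbours. -/
theorem IsNbLists.sum_length_le {n : ℕ} {nb : Fin n → List (Fin n)} {N : Fin n → Fin n → Prop}
    (hnb : IsNbLists nb N) (hN : ∀ x y, N x y → N y x ∧ x ≠ y) {pos : Fin n → ℕ}
    (hpos : Function.Injective pos) {k : ℕ} (hk : ∀ v, (laterNb nb pos v).length ≤ k) :
    ∑ v, (nb v).length ≤ 2 * k * n := by
  have h1 : ∀ v, #{u | u ∈ nb v ∧ pos v < pos u} ≤ k := by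
    intro v
    refine le_trans ?_ (hk v)
    refine le_trans (card_le_card ?_) (laterNb nb pos v).toFinset_card_le
    intro u hu
    simpa [laterNb] using hu
  have h2 : ∀ v, (nb v).length ≤
      #{u | u ∈ nb v ∧ pos v < pos u} + #{u | v ∈ nb u ∧ pos u < pos v} := by
    intro v
    rw [← List.toFinset_card_of_nodup (hnb.nodup v)]
    refine (card_le_card ?_).trans (card_union_le _ _)
    intro u hu
    simp only [List.mem_toFinset, hnb.mem_iff, mem_union, mem_filter, mem_univ, true_and] at hu ⊢
    have := hN _ _ hu
    rcases lt_or_gt_of_ne (fun h => this.2 (hpos h)) with h | h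
    · exact .inl ⟨hu, h⟩
    · exact .inr ⟨this.1, h⟩
  have h3 : ∑ v, #{u | v ∈ nb u ∧ pos u < pos v} = ∑ u, #{v | v ∈ nb u ∧ pos u < pos v} :=
    sum_card_bipartiteAbove_eq_sum_card_bipartiteBelow _
  calc ∑ v, (nb v).length ≤ ∑ v, (#{u | u ∈ nb v ∧ pos v < pos u} +
        #{u | v ∈ nb u ∧ pos u < pos v}) := sum_le_sum fun v _ => h2 v
    _ = ∑ v, #{u | u ∈ nb v ∧ pos v < pos u} + ∑ v, #{u | u ∈ nb v ∧ pos v < pos u} := by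
      rw [sum_add_distrib, h3]
    _ ≤ ∑ _v : Fin n, k + ∑ _v : Fin n, k :=
      add_le_add (sum_le_sum fun v _ => h1 v) (sum_le_sum fun v _ => h1 v)
    _ = 2 * k * n := by simp; ring

/-! ### Fraternal augmentations -/

/-- The arcs from the members of the lists. -/
def arcs {n : ℕ} (A : Fin n → List (Fin n)) : Finset (Fin n × Fin n) := {a | a.1 ∈ A a.2}

theorem mem_arcs {n : ℕ} {A : Fin n → List (Fin n)} {x y : Fin n} : (x, y) ∈ arcs A ↔ x ∈ A y := by
  simp [arcs]

/-- Two vertices with a common out-neighbour that are not yet adjacent. -/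
def FraternalPair {n : ℕ} (A : Fin n → List (Fin n)) (x y : Fin n) : Prop :=
  x ≠ y ∧ ¬ (x ∈ A y ∨ y ∈ A x) ∧ ∃ z, x ∈ A z ∧ y ∈ A z

theorem FraternalPair.symm {n : ℕ} {A : Fin n → List (Fin n)} {x y : Fin n}
    (h : FraternalPair A x y) : FraternalPair A y x :=
  ⟨h.1.symm, fun h' => h.2.1 h'.symm, h.2.2.imp fun _ h => h.symm⟩

/-- Bounds for the augmentations of the graphs in a class of bounded expansion: the length of the
paths that realise arcs, their number through a vertex, and the in-degree. -/
def augBound (f : ℕ → ℕ) : ℕ → ℕ × ℕ × ℕ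
  | 0 => (1, 0, routedDegree 1 0 (f 1))
  | t + 1 =>
    let (ℓ, q, d) := augBound f t
    let q' := d * d + q * d + q * d
    (2 * ℓ, q + q', d + routedDegree (2 * ℓ) q' (f (2 * ℓ)))

/-- The bound on the degeneracy of the graph of the arcs that are added in a round. -/
def newDegree (f : ℕ → ℕ) (t : ℕ) : ℕ :=
  let (ℓ, q, d) := augBound f t
  routedDegree (2 * ℓ) (d * d + q * d + q * d) (f (2 * ℓ))

/-- The arcs obey the bounds for `t` rounds. -/
def AugBounded {n : ℕ} (G : SimpleGraph (Fin n)) (f : ℕ → ℕ) (t : ℕ) (A : Fin n → List (Fin n)) :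
    Prop :=
  Routed G (augBound f t).1 (augBound f t).2.1 (arcs A) ∧
    ∀ v, (A v).length ≤ (augBound f t).2.2

/-- The depth-`r` minors of the graph have average degree at most `f r`. -/
def ExpansionLE {n : ℕ} (G : SimpleGraph (Fin n)) (f : ℕ → ℕ) : Prop :=
  ∀ (r m : ℕ) (H : SimpleGraph (Fin m)), IsDepthMinor r H G → avgDegree H ≤ f r

section
variable {n : ℕ} {G : SimpleGraph (Fin n)} {f : ℕ → ℕ} {nb A : Fin n → List (Fin n)}

theorem routed_adj (G : SimpleGraph (Fin n)) :
    ∃ E, Routed G 1 0 E ∧ ∀ x y, G.Adj x y → (x, y) ∈ E := by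
  classical
  exact ⟨({a | G.Adj a.1 a.2} : Finset _), Routed.of_adj (by simp), by simp⟩

theorem IsNbLists.degenerate_of_adj (hG : ExpansionLE G f) (hnb : IsNbLists nb G.Adj) :
    Degenerate nb (routedDegree 1 0 (f 1)) := by
  obtain ⟨E, hE, hGE⟩ := routed_adj G
  exact hnb.degenerate_of_routed (hG 1) (fun _ _ h => h.symm) hE hGE

theorem IsNbLists.augBounded_zero (hnb : IsNbLists nb G.Adj) {pos : Fin n → ℕ}
    (hk : ∀ v, (laterNb nb pos v).length ≤ routedDegree 1 0 (f 1)) :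
    AugBounded G f 0 (laterNb nb pos) := by
  refine ⟨Routed.of_adj ?_, hk⟩
  rintro ⟨x, y⟩ h
  rw [mem_arcs, mem_laterNb, hnb.mem_iff] at h
  exact h.1.symm

theorem AugBounded.card_le {t : ℕ} (hA : AugBounded G f t A) (z : Fin n) :
    Finset.card {x | (x, z) ∈ arcs A} ≤ (augBound f t).2.2 := by
  refine le_trans (le_trans (Finset.card_le_card fun x hx => ?_) (A z).toFinset_card_le) (hA.2 z)
  simpa [arcs] using hx

theorem AugBounded.routed_fraternal {t : ℕ} (hA : AugBounded G f t A) :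
    ∃ E, Routed G (2 * (augBound f t).1) ((augBound f t).2.2 * (augBound f t).2.2 +
      (augBound f t).2.1 * (augBound f t).2.2 + (augBound f t).2.1 * (augBound f t).2.2) E ∧
      ∀ x y, FraternalPair A x y → (x, y) ∈ E := by
  classical
  refine ⟨({a | FraternalPair A a.1 a.2} : Finset _), hA.1.fraternal hA.card_le ?_, by simp⟩
  intro a ha
  have h := (Finset.mem_filter.1 ha).2
  exact ⟨h.1, h.2.2.imp fun z hz => ⟨mem_arcs.2 hz.1, mem_arcs.2 hz.2⟩⟩

theorem IsNbLists.degenerate_of_fraternal (hG : ExpansionLE G f) {t : ℕ} (hA : AugBounded G f t A)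
    (hnb : IsNbLists nb (FraternalPair A)) : Degenerate nb (newDegree f t) := by
  obtain ⟨E, hE, hAE⟩ := hA.routed_fraternal
  exact hnb.degenerate_of_routed (hG _) (fun _ _ h => h.symm) hE hAE

/-- Later neighbours become in-neighbours, so few later neighbours mean a small increase of the
in-degree. Old and new arcs are routed separately, and their congestions are added. -/
theorem IsNbLists.augBounded_succ {t : ℕ} (hA : AugBounded G f t A)
    (hnb : IsNbLists nb (FraternalPair A)) {pos : Fin n → ℕ}
    (hk : ∀ v, (laterNb nb pos v).length ≤ newDegree f t) :
    AugBounded G f (t + 1) fun v => A v ++ laterNb nb pos v := by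
  obtain ⟨E, hE, hAE⟩ := hA.routed_fraternal
  refine ⟨(hA.1.union hE (by omega)).subset ?_, fun v => ?_⟩
  · rintro ⟨x, y⟩ h
    rw [mem_arcs, List.mem_append, mem_laterNb, hnb.mem_iff] at h
    exact Finset.mem_union.2 (h.imp mem_arcs.2 fun h => hAE _ _ h.1.symm)
  · rw [List.length_append]
    exact Nat.add_le_add (hA.2 v) (hk v)

/-- The first `t + 1` members of a sequence of augmentations of `G`. -/
structure IsFraternalChain (G : SimpleGraph (Fin n)) (A : ℕ → Fin n → List (Fin n)) (t : ℕ) :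
    Prop where
  adj : ∀ x y, G.Adj x y → x ∈ A 0 y ∨ y ∈ A 0 x
  subset : ∀ j < t, ∀ v, A j v ⊆ A (j + 1) v
  fraternal : ∀ j < t, ∀ x y z, x ≠ y → x ∈ A j z → y ∈ A j z → x ∈ A (j + 1) y ∨ y ∈ A (j + 1) x

theorem IsNbLists.isFraternalChain_zero (hnb : IsNbLists nb G.Adj) {pos : Fin n → ℕ}
    (hpos : Function.Injective pos) : IsFraternalChain G (fun _ => laterNb nb pos) 0 := by
  refine ⟨fun x y h => ?_, by simp, by simp⟩
  simp only [mem_laterNb, hnb.mem_iff]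
  rcases lt_or_gt_of_ne (fun e => h.ne (hpos e)) with h' | h'
  · exact .inr ⟨h, h'⟩
  · exact .inl ⟨h.symm, h'⟩

/-- Two distinct vertices with arcs to a common vertex are either adjacent already, and old arcs
persist, or they form a new pair, which injectivity of `pos` orients. -/
theorem IsNbLists.isFraternalChain_succ {t : ℕ} {A : ℕ → Fin n → List (Fin n)}
    (hA : IsFraternalChain G A t) (hnb : IsNbLists nb (FraternalPair (A t))) {pos : Fin n → ℕ}
    (hpos : Function.Injective pos) :
    IsFraternalChain G (fun j => if j ≤ t then A j else fun v => A t v ++ laterNb nb pos v)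
      (t + 1) := by
  refine ⟨by simpa using hA.adj, fun j hj v => ?_, fun j hj x y z hxy hx hy => ?_⟩
  · rcases Nat.lt_succ_iff_lt_or_eq.1 hj with h | rfl
    · simpa [h.le, Nat.succ_le_iff.2 h] using hA.subset j h v
    · simp
  · rcases Nat.lt_succ_iff_lt_or_eq.1 hj with h | rfl
    · simp only [h.le, if_true, Nat.succ_le_iff.2 h] at hx hy ⊢
      exact hA.fraternal j h x y z hxy hx hy
    · simp only [le_refl, if_true] at hx hy
      simp only [add_le_iff_nonpos_right, nonpos_iff_eq_zero, one_ne_zero, if_false,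
        List.mem_append, mem_laterNb, hnb.mem_iff]
      by_cases h : x ∈ A j y ∨ y ∈ A j x
      · exact h.imp .inl .inl
      · have hf : FraternalPair (A j) x y := ⟨hxy, h, z, hx, hy⟩
        rcases lt_or_gt_of_ne (fun e => hxy (hpos e)) with h' | h'
        · exact .inr (.inr ⟨hf, h'⟩)
        · exact .inl (.inr ⟨hf.symm, h'⟩)

/-! ### Ancestors and weak reachability -/

/-- The vertices from which a directed path with at most `t` arcs leads to `v`. -/
def ancestors (A : Fin n → List (Fin n)) : ℕ → Fin n → List (Fin n)
  | 0, v => [v]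
  | t + 1, v => ancestors A t v ++ (ancestors A t v).flatMap A

theorem length_ancestors_le {d : ℕ} (hA : ∀ v, (A v).length ≤ d) (t : ℕ) (v : Fin n) :
    (ancestors A t v).length ≤ (1 + d) ^ t := by
  induction t with
  | zero => simp [ancestors]
  | succ t ih =>
    rw [ancestors, List.length_append, List.length_flatMap, pow_succ, mul_one_add]
    refine Nat.add_le_add ih (le_trans ?_ (Nat.mul_le_mul_right _ ih))
    refine (List.sum_le_card_nsmul _ d ?_).trans (by simp)
    simp only [List.mem_map]
    rintro _ ⟨x, -, rfl⟩
    exact hA x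

theorem ancestors_subset_succ (t : ℕ) (v : Fin n) : ancestors A t v ⊆ ancestors A (t + 1) v :=
  List.subset_append_left _ _

theorem ancestors_mono {t t' : ℕ} (h : t ≤ t') (v : Fin n) :
    ancestors A t v ⊆ ancestors A t' v := by
  induction t', h using Nat.le_induction with
  | base => exact List.Subset.refl _
  | succ t' _ ih => exact List.Subset.trans ih (ancestors_subset_succ t' v)

theorem mem_ancestors_succ {t : ℕ} {x y v : Fin n} (hx : x ∈ A v) (hy : y ∈ ancestors A t x) :
    y ∈ ancestors A (t + 1) v := by
  induction t generalizing y with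
  | zero =>
    rw [ancestors, List.mem_singleton] at hy
    subst hy
    simpa [ancestors] using .inr hx
  | succ t ih =>
    rw [ancestors, List.mem_append, List.mem_flatMap] at hy
    rcases hy with hy | ⟨z, hz, hy⟩
    · exact ancestors_subset_succ _ _ (ih hy)
    · rw [ancestors, List.mem_append, List.mem_flatMap]
      exact .inr ⟨z, ih hz, hy⟩

/-- `DirPath A a y v`: a directed walk with `a` arcs leads from `y` to `v`. -/
inductive DirPath (A : Fin n → List (Fin n)) : ℕ → Fin n → Fin n → Prop
  | nil (v : Fin n) : DirPath A 0 v v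
  | concat {a : ℕ} {y x v : Fin n} : DirPath A a y x → x ∈ A v → DirPath A (a + 1) y v

theorem DirPath.mono {A' : Fin n → List (Fin n)} (h : ∀ v, A v ⊆ A' v) {a : ℕ} {y v : Fin n}
    (hp : DirPath A a y v) : DirPath A' a y v := by
  induction hp with
  | nil v => exact .nil v
  | concat _ hx ih => exact .concat ih (h _ hx)

theorem DirPath.mem_ancestors {a : ℕ} {y v : Fin n} (hp : DirPath A a y v) :
    y ∈ ancestors A a v := by
  induction hp with
  | nil v => simp [ancestors]
  | concat _ hx ih => exact mem_ancestors_succ hx ih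

theorem IsFraternalChain.subset_of_le {A : ℕ → Fin n → List (Fin n)} {t : ℕ}
    (hA : IsFraternalChain G A t) {i j : ℕ} (hij : i ≤ j) (hj : j ≤ t) (v : Fin n) :
    A i v ⊆ A j v := by
  induction j, hij using Nat.le_induction with
  | base => exact List.Subset.refl _
  | succ j _ ih => exact List.Subset.trans (ih (by omega)) (hA.subset j (by omega) v)

/-- Walks can be shortened at vertices at which two arcs meet. -/
theorem IsFraternalChain.exists_dirPath_cons {A : ℕ → Fin n → List (Fin n)} {t : ℕ}
    (hA : IsFraternalChain G A t) {v x y u : Fin n} {a b j : ℕ} (hj : j + a + b + 1 ≤ t)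
    (hvx : v ∈ A j x ∨ x ∈ A j v) (hyx : DirPath (A j) a y x) (hyu : DirPath (A j) b y u) :
    ∃ j' a' b' y', j' + a' + b' ≤ j + a + b + 1 ∧ (y' = y ∨ y' = v) ∧
      DirPath (A j') a' y' v ∧ DirPath (A j') b' y' u := by
  -- The arc between `v` and `x` is pushed towards `y`. If it points to `v`, it prolongs the
  -- directed path. If it points to `x`, it meets the last arc of the path there, whose tail `x'`
  -- either equals `v` or is joined to `v` in round `j + 1`; then `x'` replaces `x`, and the
  -- increase of `j` is paid for by the shorter path. If `y = x` is reached with an arc from `v`,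
  -- then `v` takes the role of `y`.
  induction a generalizing j x with
  | zero =>
    cases hyx
    rcases hvx with h | h
    · have : DirPath (A j) (b + 1) v u := by
        clear hj
        induction hyu with
        | nil y => exact .concat (.nil v) h
        | concat _ hx ih => exact .concat (ih h) hx
      exact ⟨j, 0, b + 1, v, by omega, .inr rfl, .nil v, this⟩
    · exact ⟨j, 1, b, _, by omega, .inl rfl, .concat (.nil _) h, hyu⟩
  | succ a ih =>
    rcases hvx with h | h
    · obtain _ | @⟨_, _, x', _, hyx', hx'⟩ := hyx
      have hsub := hA.subset j (by omega)
      by_cases hvx' : v = x'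
      · subst hvx'
        exact ⟨j, a, b, y, by omega, .inl rfl, hyx', hyu⟩
      · obtain ⟨j', a', b', y', h1, h2⟩ := ih (j := j + 1) (by omega)
          (hA.fraternal j (by omega) v x' x hvx' h hx') (hyx'.mono hsub) (hyu.mono hsub)
        exact ⟨j', a', b', y', by omega, h2⟩
    · exact ⟨j, a + 1 + 1, b, y, by omega, .inl rfl, .concat hyx h, hyu⟩

/-- Rounds are charged to the length of the walk: the sum `j + a + b` grows by at most one with each
edge, so `t` rounds suffice for walks of length `t`. -/
theorem IsFraternalChain.exists_dirPath {A : ℕ → Fin n → List (Fin n)} {t : ℕ}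
    (hA : IsFraternalChain G A t) {v u : Fin n} (p : G.Walk v u) (hp : p.length ≤ t) :
    ∃ j a b y, j + a + b ≤ p.length ∧ y ∈ p.support ∧
      DirPath (A j) a y v ∧ DirPath (A j) b y u := by
  induction p with
  | nil => exact ⟨0, 0, 0, _, by simp, by simp, .nil _, .nil _⟩
  | @cons v x u h p ih =>
    rw [SimpleGraph.Walk.length_cons] at hp
    obtain ⟨j, a, b, y, h1, h2, h3, h4⟩ := ih (by omega)
    have hsub := hA.subset_of_le (Nat.zero_le j) (by omega)
    obtain ⟨j', a', b', y', h5, h6, h7⟩ := hA.exists_dirPath_cons (by omega)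
      ((hA.adj v x h).imp (fun e => hsub _ e) fun e => hsub _ e) h3 h4
    refine ⟨j', a', b', y', by rw [SimpleGraph.Walk.length_cons]; omega, ?_, h7⟩
    rw [SimpleGraph.Walk.support_cons]
    rcases h6 with rfl | rfl
    · exact List.mem_cons_of_mem _ h2
    · exact List.mem_cons_self

/-- Vertices that have an ancestor in common with their weak neighbours. -/
theorem IsFraternalChain.exists_common_ancestor {A : ℕ → Fin n → List (Fin n)} {t : ℕ}
    (hA : IsFraternalChain G A t) {v u : Fin n} (p : G.Walk v u) (hp : p.length ≤ t) :
    ∃ y ∈ p.support, y ∈ ancestors (A t) t v ∧ y ∈ ancestors (A t) t u := by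
  obtain ⟨j, a, b, y, h1, h2, h3, h4⟩ := hA.exists_dirPath p hp
  have hsub := hA.subset_of_le (show j ≤ t by omega) le_rfl
  exact ⟨y, h2, ancestors_mono (by omega) _ (h3.mono hsub).mem_ancestors,
    ancestors_mono (by omega) _ (h4.mono hsub).mem_ancestors⟩

/-- Adjacency to a proper ancestor. -/
def AncestorPair (A : Fin n → List (Fin n)) (t : ℕ) (x y : Fin n) : Prop :=
  x ≠ y ∧ (y ∈ ancestors A t x ∨ x ∈ ancestors A t y)

theorem AncestorPair.symm {t : ℕ} {x y : Fin n} (h : AncestorPair A t x y) :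
    AncestorPair A t y x :=
  ⟨h.1.symm, h.2.symm⟩

open Finset in
/-- The reverse of an order with few later neighbours in the graph of ancestors has small weakly
reachable sets. -/
theorem IsFraternalChain.witnessesWcolLE {A : ℕ → Fin n → List (Fin n)} {t d k : ℕ}
    (hA : IsFraternalChain G A t) (hd : ∀ v, (A t v).length ≤ d)
    (hnb : IsNbLists nb (AncestorPair (A t) t)) {pos : Fin n → ℕ}
    (hpos : Function.Injective pos) (hk : ∀ v, (laterNb nb pos v).length ≤ k)
    (L : LinearOrder (Fin n)) (hL : ∀ x y, L.le x y ↔ pos y ≤ pos x) :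
    WitnessesWcolLE G L t ((1 + d) ^ t * (k + 1)) := by
  intro v
  have hsub : WReach G L t v ⊆ ((ancestors (A t) t v).toFinset.biUnion fun y =>
      insert y (laterNb nb pos y).toFinset : Finset (Fin n)) := by
    rintro u ⟨p, -, hpl, hpu⟩
    obtain ⟨y, hy, hyv, hyu⟩ := hA.exists_common_ancestor p hpl
    simp only [coe_biUnion, Set.mem_iUnion, mem_coe, List.mem_toFinset, mem_insert]
    refine ⟨y, hyv, ?_⟩
    by_cases huy : u = y
    · exact .inl huy
    -- Since `y` lies on the path and `u` is its minimum, `u` precedes `y` in `L`, which means that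
    -- `pos u` is larger than `pos y`.
    · refine .inr (mem_laterNb.2 ⟨(hnb.mem_iff _ _).2 ⟨Ne.symm huy, .inr hyu⟩, ?_⟩)
      exact lt_of_le_of_ne ((hL _ _).1 (hpu y hy)) fun h => huy (hpos h.symm)
  refine (Set.ncard_le_ncard hsub (Finset.finite_toSet _)).trans ?_
  rw [Set.ncard_coe_finset]
  refine (card_biUnion_le_card_mul _ _ (k + 1) fun y _ => ?_).trans ?_
  · refine (card_insert_le _ _).trans (Nat.succ_le_succ ?_)
    exact (List.toFinset_card_le _).trans (hk y)
  · exact Nat.mul_le_mul_right _ ((List.toFinset_card_le _).trans (length_ancestors_le hd t v))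

/-- Orienting every edge towards the ancestor gives out-degrees bounded by the number of ancestors.
-/
theorem IsNbLists.degenerate_of_ancestors {t d : ℕ} (hd : ∀ v, (A v).length ≤ d)
    (hnb : IsNbLists nb (AncestorPair A t)) : Degenerate nb (2 * (1 + d) ^ t) :=
  hnb.degenerate_of_orientation _ (fun v => length_ancestors_le hd t v) fun _ _ h => h.2

end

/-! ### Least weakly reachable vertices and domination -/

section
variable {V : Type*} {G : SimpleGraph V}

/-- Some walk of length at most `r` leads from `u` to `v`. -/
def SimpleGraph.WalkLE (G : SimpleGraph V) (r : ℕ) (u v : V) : Prop :=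
  ∃ p : G.Walk u v, p.length ≤ r

theorem SimpleGraph.walkLE_iff_edist_le {r : ℕ} {u v : V} : G.WalkLE r u v ↔ G.edist u v ≤ r := by
  refine ⟨fun ⟨p, hp⟩ => p.edist_le.trans (by exact_mod_cast hp), fun h => ?_⟩
  obtain ⟨p, hp⟩ := SimpleGraph.exists_walk_of_edist_ne_top
    (ne_top_of_le_ne_top (ENat.natCast_ne_top r) h)
  exact ⟨p, by rw [← hp] at h; exact_mod_cast h⟩

/-- All vertices on a walk of length at most `r` from `w` are themselves in the ball, so none of
them precedes the least vertex `v` of the ball. -/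
theorem mem_wReach_of_forall_le {L : LinearOrder V} {r : ℕ} {w v : V} (hv : G.WalkLE r w v)
    (h : ∀ u, G.WalkLE r w u → L.le v u) : v ∈ WReach G L r w := by
  classical
  obtain ⟨p, hp⟩ := hv
  refine ⟨p.bypass, p.bypass_isPath, p.length_bypass_le_length.trans hp, fun x hx => h x ?_⟩
  exact ⟨p.takeUntil x (p.support_bypass_subset_support hx),
    (p.length_takeUntil_le_length _).trans hp⟩

theorem SimpleGraph.exists_walkLE_forall_le [Finite V] (G : SimpleGraph V) (L : LinearOrder V)
    (r : ℕ) (w : V) : ∃ v, G.WalkLE r w v ∧ ∀ u, G.WalkLE r w u → L.le v u :=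
  let ⟨v, hv⟩ := (Set.toFinite {u | G.WalkLE r w u}).exists_minimalFor id _
    ⟨w, .nil, Nat.zero_le _⟩
  ⟨v, hv.1, fun u hu => (L.le_total v u).elim id fun h => hv.2 hu h⟩

theorem isMinWReach_iff [Finite V] {L : LinearOrder V} {r : ℕ} {w v : V} :
    IsMinWReach G L r w v ↔ G.WalkLE r w v ∧ ∀ u, G.WalkLE r w u → L.le v u := by
  refine ⟨fun h => ⟨?_, fun u hu => ?_⟩, fun h => ⟨mem_wReach_of_forall_le h.1 h.2, ?_⟩⟩
  · obtain ⟨p, -, hp, -⟩ := h.1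
    exact ⟨p, hp⟩
  · obtain ⟨m, hm, hmin⟩ := G.exists_walkLE_forall_le L r w
    exact L.le_trans _ _ _ (h.2 m (mem_wReach_of_forall_le hm hmin)) (hmin u hu)
  · rintro u ⟨p, -, hp, -⟩
    exact h.2 u ⟨p, hp⟩

open Finset in
-- Each `v` in `D` is least in the ball of some `w`, and some `m` in `M` lies in this ball. The walk
-- from `m` over `w` to `v` stays in the ball, so `v` is weakly `2 * r`-reachable from `m`, and `m`
-- is charged at most `k` times.
theorem isDistDominatingApprox_of_witnesses [Fintype V] {L : LinearOrder V} {r k : ℕ}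
    (hL : WitnessesWcolLE G L (2 * r) k) {D : Finset V}
    (hD : ∀ v, v ∈ D ↔ ∃ w, IsMinWReach G L r w v) : IsDistDominatingApprox G r k D := by
  classical
  simp only [isMinWReach_iff] at hD
  refine ⟨fun w => ?_, fun M hM => ?_⟩
  · obtain ⟨v, hv, hmin⟩ := G.exists_walkLE_forall_le L r w
    refine ⟨v, (hD v).2 ⟨w, hv, hmin⟩, ?_⟩
    rw [SimpleGraph.edist_comm]
    exact SimpleGraph.walkLE_iff_edist_le.1 hv
  · have hsub : D ⊆ M.biUnion fun m => (WReach G L (2 * r) m).toFinset := by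
      intro v hv
      obtain ⟨w, ⟨p, hp⟩, hmin⟩ := (hD v).1 hv
      obtain ⟨m, hm, hmw⟩ := hM w
      obtain ⟨q, hq⟩ := SimpleGraph.walkLE_iff_edist_le.2 hmw
      refine mem_biUnion.2 ⟨m, hm, Set.mem_toFinset.2 ⟨(q.append p).bypass,
        SimpleGraph.Walk.bypass_isPath _, (SimpleGraph.Walk.length_bypass_le_length _).trans ?_,
        fun x hx => hmin x ?_⟩⟩
      · rw [SimpleGraph.Walk.length_append]
        omega
      · have hx' := SimpleGraph.Walk.support_bypass_subset_support _ hx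
        rw [SimpleGraph.Walk.mem_support_append_iff] at hx'
        rcases hx' with hx' | hx'
        · refine ⟨(q.dropUntil x hx').reverse, ?_⟩
          rw [SimpleGraph.Walk.length_reverse]
          exact (q.length_dropUntil_le_length hx').trans hq
        · exact ⟨p.takeUntil x hx', (p.length_takeUntil_le_length _).trans hp⟩
    refine (card_le_card hsub).trans ((card_biUnion_le_card_mul _ _ k fun m _ => ?_).trans
      (mul_comm _ _).le)
    rw [← Set.ncard_eq_toFinset_card']
    exact hL m

end

namespace RAM

infixr:60 " ;; " => Prog.seq

/-! ### Tables of lists -/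

theorem cell_inj {n i j : ℕ} {x y : Fin n} : i * n + x = j * n + y ↔ i = j ∧ x = y := by
  refine ⟨fun h => ?_, by rintro ⟨rfl, rfl⟩; rfl⟩
  have hn : 0 < n := x.pos
  have h1 := congrArg (· % n) h
  simp only [Nat.mul_add_mod', Nat.mod_eq_of_lt x.2, Nat.mod_eq_of_lt y.2] at h1
  rw [h1, Nat.add_right_cancel_iff] at h
  exact ⟨Nat.eq_of_mul_eq_mul_right hn h, Fin.ext h1⟩

/-- The array `c` contains the lengths of the lists, and the array `a` their entries. -/
structure IsTable {n : ℕ} (a c : ℕ → ℕ) (f : Fin n → List (Fin n)) : Prop where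
  length : ∀ v : Fin n, c v = (f v).length
  get : ∀ (v : Fin n) (j : ℕ) (h : j < (f v).length), a (j * n + v) = (f v)[j]

/-- The expression `i * n + j`. -/
def Expr.idx (i j : Expr) : Expr := .op .add (.op .mul i (.reg 0)) j

/-- Append `e` to the list with number `v` in the table with entries `a` and lengths `c`. -/
def push (a c : ℕ) (v e : Expr) : Prog :=
  .write a (.idx (.read c v) v) e ;; .write c v (.op .add (.read c v) (.const 1))

theorem IsTable.push {n : ℕ} {a c : ℕ → ℕ} {f : Fin n → List (Fin n)} (h : IsTable a c f)
    (v x : Fin n) :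
    IsTable (Function.update a (c v * n + v) x) (Function.update c v (c v + 1))
      (Function.update f v (f v ++ [x])) := by
  refine ⟨fun u => ?_, fun u j hj => ?_⟩
  · by_cases huv : u = v
    · subst huv; simp [h.length]
    · have : (u : ℕ) ≠ v := fun e => huv (Fin.ext e)
      simp [huv, this, h.length]
  · by_cases huv : u = v
    · subst huv
      simp only [Function.update_self, List.length_append, List.length_singleton] at hj
      by_cases hjl : j < (f u).length
      · have hne : j * n + (u : ℕ) ≠ c u * n + u := by
          rw [ne_eq, cell_inj, h.length]; omega
        simp [Function.update_of_ne hne, List.getElem_append_left hjl, h.get u j hjl]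
      · have : j = (f u).length := by omega
        subst this
        simp [h.length]
    · have hne : j * n + (u : ℕ) ≠ c v * n + v := by
        rw [ne_eq, cell_inj]; tauto
      simp only [Function.update_of_ne huv, Function.update_of_ne hne] at hj ⊢
      exact h.get u j hj

theorem IsTable.nil {n : ℕ} {a c : ℕ → ℕ} (h : ∀ v : Fin n, c v = 0) :
    IsTable a c fun _ : Fin n => [] :=
  ⟨by simpa using h, by simp⟩

/-- The index `v` is evaluated again after the entry has been written, whence the hypothesis that
its value survives a write to `a`. -/
theorem wp_push {n a c : ℕ} {v e : Expr} {f : Fin n → List (Fin n)} {s : State} (hac : a ≠ c)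
    (h0 : s.reg 0 = n) {x y : Fin n}
    (hv : ∀ i w, v.eval (s.setArr a i w) = x) (hv' : v.eval s = x) (he : e.eval s = y)
    (h : IsTable (s.arr a) (s.arr c) f) {Q : State → Prop}
    (hQ : ∀ s', s'.reg = s.reg → (∀ b, b ≠ a → b ≠ c → s'.arr b = s.arr b) →
      IsTable (s'.arr a) (s'.arr c) (Function.update f x (f x ++ [y])) → Q s') :
    wp (RAM.push a c v e) 0 Q s := by
  refine wp_seq_write (wp_write ?_)
  simp only [Expr.idx, Expr.eval, Op.eval, h0, hv, hv', he]
  refine hQ _ rfl (fun b hb hb' => by simp [hb, hb']) ?_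
  simpa [hac, hac.symm] using h.push x y

/-! ### Graphs under construction -/

/-- The arrays `nbA`, `cntA` contain the neighbourhood lists of the graph with the edges from `R`
that are not in `old`. The entries of the matrix `M` are at most `st`, and `st` means that a pair
belongs to `old` or the graph. -/
def EdgeInv {n : ℕ} (old R : Fin n → Fin n → Prop) (st : ℕ) (M nbA cntA : ℕ → ℕ) : Prop :=
  ∃ nb, IsTable nbA cntA nb ∧
    IsNbLists nb (fun x y => x ≠ y ∧ ¬ old x y ∧ (R x y ∨ R y x)) ∧
    ∀ x y : Fin n, (st ≤ M (x * n + y) ↔ old x y ∨ x ≠ y ∧ (R x y ∨ R y x)) ∧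
      M (x * n + y) ≤ st

/-- Add an edge between the vertices in the registers `5` and `6`. -/
def addEdge : Prog :=
  .ite (.op .eq (.reg 5) (.reg 6)) .skip
    (.ite (.op .lt (.read 4 (.idx (.reg 5) (.reg 6))) (.reg 7))
      (.write 4 (.idx (.reg 5) (.reg 6)) (.reg 7) ;; .write 4 (.idx (.reg 6) (.reg 5)) (.reg 7) ;;
        push 5 6 (.reg 5) (.reg 6) ;; push 5 6 (.reg 6) (.reg 5))
      .skip)

theorem EdgeInv.congr {n : ℕ} {old R R' : Fin n → Fin n → Prop} {st : ℕ} {M nbA cntA : ℕ → ℕ}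
    (h : EdgeInv old R st M nbA cntA)
    (hR : ∀ x y, x ≠ y → ¬ old x y → (R x y ∨ R y x ↔ R' x y ∨ R' y x)) :
    EdgeInv old R' st M nbA cntA := by
  obtain ⟨nb, h1, h2, h3⟩ := h
  refine ⟨nb, h1, ⟨h2.nodup, fun x y => ?_⟩, fun x y => ⟨?_, (h3 x y).2⟩⟩
  · rw [h2.mem_iff]
    have := hR x y
    tauto
  · rw [(h3 x y).1]
    have := hR x y
    tauto

/-- Loops and pairs that are marked already leave the graph as it is. A new pair is marked in both
directions and enters two lists, which therefore remain free of repetitions. -/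
theorem wp_addEdge {n : ℕ} {old R R' : Fin n → Fin n → Prop} {s : State} {x y : Fin n}
    (hold : ∀ x y, old x y → old y x) (h0 : s.reg 0 = n) (h5 : s.reg 5 = x) (h6 : s.reg 6 = y)
    (h : EdgeInv old R (s.reg 7) (s.arr 4) (s.arr 5) (s.arr 6))
    (hR : ∀ a b, R' a b ↔ R a b ∨ a = x ∧ b = y) :
    wp addEdge 0 (fun s' => EdgeInv old R' (s.reg 7) (s'.arr 4) (s'.arr 5) (s'.arr 6)) s := by
  refine wp_ite (fun he => wp_skip (h.congr fun a b hab _ => ?_)) fun he => ?_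
  · simp only [Expr.eval, Op.eval, h5, h6, ne_eq, ite_eq_right_iff, one_ne_zero, imp_false,
      not_not, ← Fin.ext_iff] at he
    subst he
    rw [hR, hR]
    constructor
    · tauto
    · rintro ((h | ⟨rfl, rfl⟩) | (h | ⟨rfl, rfl⟩)) <;> tauto
  simp only [Expr.eval, Op.eval, h5, h6, ite_eq_right_iff, one_ne_zero, imp_false,
    ← Fin.ext_iff] at he
  obtain ⟨nb, ht, hnb, hM⟩ := id h
  refine wp_ite (fun hlt => ?_) fun hlt => wp_skip (h.congr fun a b _ hab => ?_)
  · simp only [Expr.eval, Op.eval, Expr.idx, h0, h5, h6, ne_eq, ite_eq_right_iff, one_ne_zero,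
      imp_false, not_not] at hlt
    have hxy : ¬ (old x y ∨ x ≠ y ∧ (R x y ∨ R y x)) := by
      rw [← (hM x y).1]; omega
    have hyx : ¬ (old y x ∨ y ≠ x ∧ (R y x ∨ R x y)) := by
      have := hold y x
      tauto
    have hy : y ∉ nb x := by rw [hnb.mem_iff]; tauto
    have hx : x ∉ nb y := by rw [hnb.mem_iff]; tauto
    refine wp_seq_write (wp_seq_write (wp_seq_zero (wp_push (f := nb) (x := x) (y := y)
      (by decide) (by simpa using h0) (by simpa [Expr.eval] using h5)
      (by simpa [Expr.eval] using h5) (by simpa [Expr.eval] using h6) (by simpa using ht) ?_)))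
    intro s₁ hr₁ ha₁ ht₁
    refine wp_push (x := y) (y := x)
      (by decide) (by simpa [hr₁] using h0) (by simpa [Expr.eval, hr₁] using h6)
      (by simpa [Expr.eval, hr₁] using h6) (by simpa [Expr.eval, hr₁] using h5) ht₁ ?_
    intro s₂ hr₂ ha₂ ht₂
    have h4 : s₂.arr 4 = Function.update (Function.update (s.arr 4) (x * n + y) (s.reg 7))
        (y * n + x) (s.reg 7) := by
      rw [ha₂ 4 (by decide) (by decide), ha₁ 4 (by decide) (by decide)]
      simp [Expr.eval, Op.eval, Expr.idx, h0, h5, h6]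
    refine ⟨_, ht₂, ⟨fun v => ?_, fun a b => ?_⟩, fun a b => ?_⟩
    · have h1 : (nb x ++ [y]).Nodup := (List.nodup_append_comm).2 (by simp [hnb.nodup, hy])
      have h2 : (nb y ++ [x]).Nodup := (List.nodup_append_comm).2 (by simp [hnb.nodup, hx])
      by_cases hvy : v = y
      · subst hvy
        simpa [Ne.symm he] using h2
      · by_cases hvx : v = x
        · subst hvx
          simpa [hvy] using h1
        · simpa [hvy, hvx] using hnb.nodup v
    · rw [hR, hR]
      have hmem := hnb.mem_iff a b
      by_cases hay : a = y
      · subst hay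
        by_cases hbx : b = x
        · subst hbx; simp; tauto
        · simp [Ne.symm he, hbx, hmem]
      · by_cases hax : a = x
        · subst hax
          by_cases hby : b = y
          · subst hby; simp [hay]; tauto
          · simp [hay, hby, hmem]
        · simp [hay, hax, hmem]
    · rw [h4, hR, hR]
      have h1 : (a : ℕ) * n + b = x * n + y ↔ a = x ∧ b = y := by
        rw [cell_inj, ← Fin.ext_iff]
      have h2 : (a : ℕ) * n + b = y * n + x ↔ a = y ∧ b = x := by
        rw [cell_inj, ← Fin.ext_iff]
      simp only [Function.update_apply, h1, h2]
      have h3 := hM a b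
      by_cases hab1 : a = x ∧ b = y
      · obtain ⟨rfl, rfl⟩ := hab1
        simp [he]
      · by_cases hab2 : a = y ∧ b = x
        · obtain ⟨rfl, rfl⟩ := hab2
          simp [Ne.symm he]
        · rw [and_comm (a := b = x)]
          simp only [hab1, hab2, if_false, or_false]
          exact h3
  · simp only [Expr.eval, Op.eval, Expr.idx, h0, h5, h6, ite_eq_right_iff, one_ne_zero,
      imp_false, not_lt] at hlt
    have hxy := ((hM x y).1).1 hlt
    have hyx := hold x y
    rw [hR, hR]
    constructor
    · tauto
    · rintro ((h | ⟨rfl, rfl⟩) | (h | ⟨rfl, rfl⟩))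
      · tauto
      · tauto
      · tauto
      · have := hold b a
        tauto

end RAM

namespace RAM

theorem mem_take_succ {α : Type*} {l : List α} {j : ℕ} (h : j < l.length) {x : α} :
    x ∈ l.take (j + 1) ↔ x ∈ l.take j ∨ x = l[j] := by
  rw [List.take_add_one, List.getElem?_eq_getElem h, List.mem_append]
  simp

/-! ### Loops that add edges -/

/-- Remove all edges. -/
def clearEdges : Prog := .for 2 (.reg 0) (.write 6 (.reg 2) (.const 0))

theorem wp_clearEdges {n : ℕ} {s : State} (h0 : s.reg 0 = n) :
    wp clearEdges n (fun s' => ∀ v : Fin n, s'.arr 6 v = 0) s := by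
  refine wp_for (N := n) (fun k s' => ∀ v : Fin n, v.1 < k → s'.arr 6 v = 0) (fun _ => 0)
    (by decide) (by simp) (fun _ _ _ h => h) (fun k s' hf _ => ?_) (fun k s' hf hk h => ?_)
    (fun s' _ h v => h v v.2) (by simp)
  · exact (hf.1 0 (by decide)).trans h0
  · refine wp_write fun v hv => ?_
    simp only [Expr.eval, hk, State.setArr_arr, if_true, Function.update_apply]
    split_ifs with hvk
    · rfl
    · exact h v (by omega)

/-- Only the list lengths have to be reset: old marks in the matrix either stand for `old` pairs or
lie below the current mark. Resetting the matrix would take quadratic time. -/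
theorem EdgeInv.of_clear {n : ℕ} {old : Fin n → Fin n → Prop} {st : ℕ} {M nbA cntA : ℕ → ℕ}
    (h : ∀ v : Fin n, cntA v = 0)
    (hM : ∀ x y : Fin n, (st ≤ M (x * n + y) ↔ old x y) ∧ M (x * n + y) ≤ st) :
    EdgeInv old (fun _ _ => False) st M nbA cntA :=
  ⟨fun _ => [], .nil h, ⟨by simp, by simp⟩, by simpa using hM⟩

/-- Add edges from every vertex to the members of its list, which has length `b` and entries
`e`. -/
def addLists (b e : Expr) : Prog :=
  .for 2 (.reg 0) (.for 3 b (.assign 5 (.reg 2) ;; .assign 6 e ;; addEdge))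

theorem wp_addLists {n : ℕ} {b e : Expr} {s : State} {T : Fin n → List (Fin n)}
    {old R : Fin n → Fin n → Prop} (hold : ∀ x y, old x y → old y x) (h0 : s.reg 0 = n)
    (hb : ∀ s' (v : Fin n), (addLists b e).Frame s s' → s'.reg 2 = v → b.eval s' = (T v).length)
    (he : ∀ s' (v : Fin n) (j : ℕ) (h : j < (T v).length), (addLists b e).Frame s s' →
      s'.reg 2 = v → s'.reg 3 = j → e.eval s' = (T v)[j])
    (h : EdgeInv old (fun _ _ => False) (s.reg 7) (s.arr 4) (s.arr 5) (s.arr 6))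
    (hR : ∀ x y, R x y ↔ y ∈ T x) {t : ℕ} (ht : ∑ v, ((T v).length + 1) ≤ t) :
    wp (addLists b e) t
      (fun s' => EdgeInv old R (s.reg 7) (s'.arr 4) (s'.arr 5) (s'.arr 6)) s := by
  have hregs : ∀ x, x ∉ (addLists b e).regs ↔ x ∉ [2, 3, 5, 6] := by
    intro x
    simp [addLists, Prog.for, Prog.regs, addEdge, push]
    tauto
  refine wp_for (N := n) (fun k s' => EdgeInv old (fun x y => x.1 < k ∧ y ∈ T x) (s.reg 7)
      (s'.arr 4) (s'.arr 5) (s'.arr 6)) (fun v => (T v).length)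
    (by simp [Prog.for, Prog.regs, addEdge, push])
    (by simpa using h) (fun _ _ _ h => h)
    (fun k s' hf _ => (hf.1 0 ((hregs 0).2 (by decide))).trans h0)
    (fun k s' hf hk h => ?_) (fun s' _ h => by simpa [← hR] using h) ht
  refine wp_for (N := (T k).length) (fun j s' => EdgeInv old
      (fun x y => x.1 < k ∧ y ∈ T x ∨ x = k ∧ y ∈ (T k).take j) (s.reg 7)
      (s'.arr 4) (s'.arr 5) (s'.arr 6)) (fun _ => 0) (by simp [Prog.regs, addEdge, push])
    (by simpa using h) (fun _ _ _ h => h) (fun j s'' hf' _ => hb s'' k (hf.trans hf'.for_body) ?_)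
    (fun j s'' hf' hj h' => ?_) (fun s'' _ h => h.congr fun x y _ _ => ?_) (by simp)
  · exact (hf'.1 2 (by simp [Prog.for, Prog.regs, addEdge, push])).trans hk
  · have hk' := (hf'.1 2 (by simp [Prog.for, Prog.regs, addEdge, push])).trans hk
    have hf'' : (addLists b e).Frame s s'' := hf.trans hf'.for_body
    refine wp_seq_assign (wp_seq_assign ?_)
    have hs5 := hf''.setReg (x := 5) (by simp [addLists, Prog.for, Prog.regs]) ((Expr.reg 2).eval s'')
    have h7 := hf''.1 7 ((hregs 7).2 (by decide))
    have h0' := (hf''.1 0 ((hregs 0).2 (by decide))).trans h0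
    refine (wp_addEdge (n := n) (x := k) (y := (T k)[j])
        (R' := fun x y => x.1 < k ∧ y ∈ T x ∨ x = k ∧ y ∈ (T k).take (j + 1))
          hold (by simpa using h0')
      (by simpa [Expr.eval] using hk') ?_ (by simpa [h7] using h') ?_).mono le_rfl ?_
    · simpa using he _ k j j.2 hs5 (by simpa using hk') (by simpa using hj)
    · intro x y
      rw [mem_take_succ j.2]
      simp only [Fin.getElem_fin]
      tauto
    · simp [h7]
  · have key : ∀ x y : Fin n, (x.1 < k ∧ y ∈ T x ∨ x = k ∧ y ∈ (T k).take (T k).length) ↔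
        (x.1 < k.1 + 1 ∧ y ∈ T x) := by
      intro x y
      rw [List.take_length, Nat.lt_succ_iff_lt_or_eq, or_and_right]
      refine or_congr_right ⟨?_, ?_⟩
      · rintro ⟨rfl, h⟩
        exact ⟨rfl, h⟩
      · rintro ⟨h, h'⟩
        obtain rfl := Fin.ext h
        exact ⟨rfl, h'⟩
    rw [key, key]

/-- Add the pairs of vertices with a common out-neighbour. -/
def addFraternal : Prog :=
  .for 2 (.reg 0) (.for 3 (.read 8 (.reg 2)) (.assign 5 (.read 7 (.idx (.reg 3) (.reg 2))) ;;
    .for 4 (.read 8 (.reg 2)) (.assign 6 (.read 7 (.idx (.reg 4) (.reg 2))) ;; addEdge)))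

theorem wp_addFraternal {n : ℕ} {s : State} {A : Fin n → List (Fin n)}
    {old R : Fin n → Fin n → Prop} (hold : ∀ x y, old x y → old y x) (h0 : s.reg 0 = n)
    (hA : IsTable (s.arr 7) (s.arr 8) A)
    (h : EdgeInv old (fun _ _ => False) (s.reg 7) (s.arr 4) (s.arr 5) (s.arr 6))
    (hR : ∀ x y, R x y ↔ ∃ z, x ∈ A z ∧ y ∈ A z) {d t : ℕ} (hd : ∀ v, (A v).length ≤ d)
    (ht : n * (d * (d + 1) + 1) ≤ t) :
    wp addFraternal t
      (fun s' => EdgeInv old R (s.reg 7) (s'.arr 4) (s'.arr 5) (s'.arr 6)) s := by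
  refine wp_for (N := n) (fun k s' => EdgeInv old (fun x y => ∃ z, z.1 < k ∧ x ∈ A z ∧ y ∈ A z)
      (s.reg 7) (s'.arr 4) (s'.arr 5) (s'.arr 6)) (fun v => d * (d + 1))
    (by decide) (by simpa using h) (fun _ _ _ h => h)
    (fun k s' hf _ => (hf.1 0 (by decide)).trans h0)
    (fun k s' hf hk h => ?_) (fun s' _ h => by simpa [← hR] using h) (by simpa using ht)
  have h0' := (hf.1 0 (by decide)).trans h0
  have h7 := hf.1 7 (by decide)
  have hA' : IsTable (s'.arr 7) (s'.arr 8) A := by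
    rwa [hf.2 7 (by decide), hf.2 8 (by decide)]
  clear hf
  refine wp_for (N := (A k).length) (fun i s'' => EdgeInv old
      (fun x y => (∃ z, z.1 < k.1 ∧ x ∈ A z ∧ y ∈ A z) ∨ x ∈ (A k).take i ∧ y ∈ A k)
      (s.reg 7) (s''.arr 4) (s''.arr 5) (s''.arr 6)) (fun _ => d) (by decide)
    (by simpa using h) (fun _ _ _ h => h) (fun i s'' hf' _ => ?_) (fun i s'' hf' hi h' => ?_)
    (fun s'' _ h => h.congr fun x y _ _ => ?_) (le_trans (by simp) (Nat.mul_le_mul_right _ (hd k)))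
  · simp only [Expr.eval]
    rw [hf'.2 8 (by decide), hf'.1 2 (by decide), hk, hA'.length]
  · have hk'' := (hf'.1 2 (by decide)).trans hk
    have h0'' := (hf'.1 0 (by decide)).trans h0'
    have h7'' := (hf'.1 7 (by decide)).trans h7
    have hA'' : IsTable (s''.arr 7) (s''.arr 8) A := by
      rwa [hf'.2 7 (by decide), hf'.2 8 (by decide)]
    clear hf'
    refine wp_seq_assign ?_
    have hx : Expr.eval s'' (.read 7 (.idx (.reg 3) (.reg 2))) = (A k)[i] := by
      simpa [Expr.eval, Expr.idx, Op.eval, h0'', hk'', hi] using hA''.get k i i.2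
    rw [hx]
    refine wp_for (N := (A k).length) (fun j s'' => EdgeInv old
        (fun x y => ((∃ z, z.1 < k.1 ∧ x ∈ A z ∧ y ∈ A z) ∨ x ∈ (A k).take i ∧ y ∈ A k) ∨
          x = (A k)[i] ∧ y ∈ (A k).take j)
        (s.reg 7) (s''.arr 4) (s''.arr 5) (s''.arr 6)) (fun _ => 0) (by decide)
      (by simpa using h') (fun _ _ _ h => h) (fun j u hf _ => ?_) (fun j u hf hj hu => ?_)
      (fun u _ h => h.congr fun x y _ _ => ?_) (by simpa using hd k)
    · simp only [Expr.eval]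
      rw [hf.2 8 (by decide), hf.1 2 (by decide)]
      simp [hk'', hA''.length]
    · refine wp_seq_assign ?_
      have h2 : u.reg 2 = k := (hf.1 2 (by decide)).trans (by simpa using hk'')
      have h5 : u.reg 5 = (A k)[i] := (hf.1 5 (by decide)).trans (by simp)
      have h0u : u.reg 0 = n := (hf.1 0 (by decide)).trans (by simpa using h0'')
      have h7u : u.reg 7 = s.reg 7 := (hf.1 7 (by decide)).trans (by simpa using h7'')
      have hy : Expr.eval u (.read 7 (.idx (.reg 4) (.reg 2))) = (A k)[j] := by
        have := hA''.get k j j.2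
        simp only [Expr.eval, Expr.idx, Op.eval, h0u, h2, hj, hf.2 7 (by decide)]
        simpa using this
      rw [hy]
      refine (wp_addEdge (n := n) (x := (A k)[i]) (y := (A k)[j])
        (R' := fun x y => ((∃ z, z.1 < k.1 ∧ x ∈ A z ∧ y ∈ A z) ∨
          x ∈ (A k).take i ∧ y ∈ A k) ∨ x = (A k)[i] ∧ y ∈ (A k).take (j + 1))
          hold (by simpa using h0u)
        (by simpa using h5) (by simp) (by simpa [h7u] using hu) ?_).mono le_rfl ?_
      · intro x y
        rw [mem_take_succ j.2, and_or_left, ← or_assoc]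
        rfl
      · simp [h7u]
    · have key : ∀ x y, (((∃ z, z.1 < k.1 ∧ x ∈ A z ∧ y ∈ A z) ∨ x ∈ (A k).take i ∧ y ∈ A k) ∨
          x = (A k)[i] ∧ y ∈ (A k).take (A k).length) ↔
          ((∃ z, z.1 < k.1 ∧ x ∈ A z ∧ y ∈ A z) ∨ x ∈ (A k).take (i + 1) ∧ y ∈ A k) := by
        intro x y
        rw [mem_take_succ i.2, List.take_length, or_and_right, or_assoc]
        rfl
      rw [key, key]
  · have key : ∀ x y, ((∃ z, z.1 < k.1 ∧ x ∈ A z ∧ y ∈ A z) ∨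
        x ∈ (A k).take (A k).length ∧ y ∈ A k) ↔ ∃ z, z.1 < k.1 + 1 ∧ x ∈ A z ∧ y ∈ A z := by
      intro x y
      rw [List.take_length]
      simp only [Nat.lt_succ_iff_lt_or_eq, or_and_right, exists_or]
      refine or_congr_right ⟨fun h => ⟨k, rfl, h⟩, ?_⟩
      rintro ⟨z, hz, h⟩
      rwa [← Fin.ext hz]
    rw [key, key]

end RAM

namespace RAM

/-! ### Degeneracy orders -/

/-- The state of the elimination of the vertices of small degree: the first `tl` vertices of the
order `Q` are determined, and the first `h` are removed. `pos v` is the position of `v` in `Q`,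
or `n`, and `dg v < d` for the vertices in `Q`. -/
structure QueueInv {n : ℕ} (nb : Fin n → List (Fin n)) (dg pos Q : ℕ → ℕ) (h tl d : ℕ) :
    Prop where
  le : h ≤ tl
  pos_cases : ∀ v : Fin n, pos v = n ∨ pos v < tl
  Q_pos : ∀ v : Fin n, pos v < n → Q (pos v) = v
  pos_Q : ∀ i < tl, ∃ v : Fin n, Q i = v ∧ pos v = i
  queued : ∀ v : Fin n, pos v < n → dg v < d
  later : ∀ v : Fin n, pos v < h → (nb v).countP (fun u : Fin n => pos v < pos u) < d

section
variable {n : ℕ} {nb : Fin n → List (Fin n)} {dg pos Q : ℕ → ℕ} {h tl d : ℕ}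

theorem QueueInv.tl_le (H : QueueInv nb dg pos Q h tl d) : tl ≤ n := by
  choose f hf using fun i : Fin tl => H.pos_Q i i.2
  have hinj : Function.Injective f := fun i j hij => Fin.ext (by rw [← (hf i).2, hij, (hf j).2])
  simpa using Fintype.card_le_of_injective f hinj

/-- The queue lists distinct vertices and `v` is not among them. -/
theorem QueueInv.tl_lt (H : QueueInv nb dg pos Q h tl d) {v : Fin n} (hv : pos v = n) :
    tl < n := by
  choose f hf using fun i : Fin tl => H.pos_Q i i.2
  have hinj : Function.Injective f := fun i j hij => Fin.ext (by rw [← (hf i).2, hij, (hf j).2])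
  have hne : v ∉ Set.range f := by
    rintro ⟨i, rfl⟩
    have := (hf i).2
    have := H.tl_le
    have := i.2
    omega
  simpa using Fintype.card_lt_of_injective_of_notMem f hinj hne

theorem QueueInv.pos_injOn (H : QueueInv nb dg pos Q h tl d) {u v : Fin n} (hu : pos u < n)
    (huv : pos u = pos v) : u = v := by
  have h1 := H.Q_pos u hu
  have h2 := H.Q_pos v (huv ▸ hu)
  rw [huv] at h1
  exact Fin.ext (h1.symm.trans h2)

theorem QueueInv.lt_n (H : QueueInv nb dg pos Q h tl d) {v : Fin n} (hv : pos v ≠ n) :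
    pos v < n :=
  ((H.pos_cases v).resolve_left hv).trans_le H.tl_le

theorem QueueInv.enqueue (H : QueueInv nb dg pos Q h tl d) {v : Fin n} (hv : pos v = n)
    (hd : dg v < d) :
    QueueInv nb dg (Function.update pos v tl) (Function.update Q tl v) h (tl + 1) d := by
  have htl := H.tl_lt hv
  have hne : ∀ u : Fin n, u ≠ v → (u : ℕ) ≠ v := fun u hu e => hu (Fin.ext e)
  have hle := H.le
  refine ⟨by omega, fun u => ?_, fun u hu => ?_, fun i hi => ?_, fun u hu => ?_, fun u hu => ?_⟩
  · by_cases huv : u = v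
    · subst huv; simp
    · simp only [Function.update_of_ne (hne u huv)]
      have := H.pos_cases u
      omega
  · by_cases huv : u = v
    · subst huv; simp
    · simp only [Function.update_of_ne (hne u huv)] at hu ⊢
      have := (H.pos_cases u).resolve_left hu.ne
      rw [Function.update_of_ne this.ne, H.Q_pos u hu]
  · by_cases hit : i = tl
    · subst hit; exact ⟨v, by simp⟩
    · obtain ⟨u, hu, hui⟩ := H.pos_Q i (by omega)
      have huv : u ≠ v := by rintro rfl; omega
      refine ⟨u, ?_, ?_⟩
      · rwa [Function.update_of_ne hit]
      · rwa [Function.update_of_ne (hne u huv)]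
  · by_cases huv : u = v
    · subst huv; exact hd
    · simp only [Function.update_of_ne (hne u huv)] at hu
      exact H.queued u hu
  · by_cases huv : u = v
    · subst huv; simp at hu; omega
    · simp only [Function.update_of_ne (hne u huv)] at hu ⊢
      refine lt_of_le_of_lt (le_of_eq (List.countP_congr fun w _ => ?_)) (H.later u hu)
      -- The position of `v` changes from `n` to `tl`, and both exceed the positions of removed
      -- vertices, so no count of later neighbours changes.
      by_cases hw : w = v
      · subst hw
        simp only [Function.update_self, decide_eq_true_eq, hv]
        omega
      · simp only [Function.update_of_ne (hne w hw)]

/-- Put the vertex in register `6` into the queue if it is not there and its degree is small. -/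
def tryEnqueue : Prog :=
  .ite (.op .lt (.read 10 (.reg 6)) (.reg 0)) .skip
    (.ite (.op .lt (.read 9 (.reg 6)) (.reg 10))
      (.write 11 (.reg 9) (.reg 6) ;; .write 10 (.reg 6) (.reg 9) ;;
        .assign 9 (.op .add (.reg 9) (.const 1)))
      .skip)

/-- `QueueInv` for the arrays and registers of the program. -/
def PeelInv (nb : Fin n → List (Fin n)) (s : State) : Prop :=
  QueueInv nb (s.arr 9) (s.arr 10) (s.arr 11) (s.reg 8) (s.reg 9) (s.reg 10)

theorem wp_tryEnqueue {s : State} (h0 : s.reg 0 = n) {y : Fin n} (h6 : s.reg 6 = y)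
    (H : PeelInv nb s) : wp tryEnqueue 0 (fun s' => PeelInv nb s' ∧
      (∀ v : Fin n, s'.arr 10 v = n → s.arr 10 v = n) ∧
      (s'.arr 10 y = n → s.reg 10 ≤ s.arr 9 y) ∧
      ∀ v : Fin n, s'.arr 10 v < s.reg 8 ↔ s.arr 10 v < s.reg 8) s := by
  refine wp_ite (fun he => wp_skip ⟨H, by simp, fun hy => ?_, by simp⟩) fun he => wp_ite
    (fun hd => ?_) fun hd => wp_skip ⟨H, by simp, fun _ => ?_, by simp⟩
  · simp [Expr.eval, Op.eval, h0, h6, hy] at he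
  · simp only [Expr.eval, Op.eval, h0, h6, ite_eq_right_iff, one_ne_zero, imp_false, ne_eq,
      not_not] at he hd
    have hy : s.arr 10 y = n := (H.pos_cases y).resolve_right fun h =>
      he (h.trans_le H.tl_le)
    have htl := H.tl_lt hy
    have hle := H.le
    refine wp_seq_write (wp_seq_write (wp_assign ⟨?_, fun v hv => ?_, fun hv => ?_, fun v => ?_⟩))
    · have := H.enqueue hy hd
      simpa [PeelInv, Expr.eval, Op.eval, h6] using this
    · simp [Expr.eval, h6, Function.update_apply] at hv
      split_ifs at hv with h
      · omega
      · exact hv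
    · simp [Expr.eval, h6] at hv
      omega
    · by_cases h : (v : ℕ) = y
      · simp [Expr.eval, h6, h, hy]
        omega
      · simp [Expr.eval, h6, Function.update_of_ne h]
  · simpa [Expr.eval, Op.eval, h6] using hd

/-- Remove the next vertex in the queue. -/
def peelStep : Prog :=
  .assign 5 (.read 11 (.reg 8)) ;; .assign 8 (.op .add (.reg 8) (.const 1)) ;;
  .for 3 (.read 6 (.reg 5)) (.assign 6 (.read 5 (.idx (.reg 3) (.reg 5))) ;;
    .write 9 (.reg 6) (.op .sub (.read 9 (.reg 6)) (.const 1)) ;; tryEnqueue)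

/-- Increase the bound on the degree. -/
def peelScan : Prog :=
  .assign 10 (.op .add (.reg 10) (.const 1)) ;;
  .for 2 (.reg 0) (.assign 6 (.reg 2) ;; tryEnqueue)

/-- Compute a degeneracy order. -/
def peel : Prog :=
  .for 2 (.reg 0) (.write 9 (.reg 2) (.read 6 (.reg 2)) ;; .write 10 (.reg 2) (.reg 0)) ;;
  .assign 8 (.const 0) ;; .assign 9 (.const 0) ;; .assign 10 (.const 0) ;;
  .while (.op .lt (.reg 8) (.reg 0)) (.ite (.op .lt (.reg 8) (.reg 9)) peelStep peelScan)

/-- The number of neighbours that are not yet removed. -/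
def restDegree (nb : Fin n → List (Fin n)) (pos : ℕ → ℕ) (h : ℕ) (v : Fin n) : ℕ :=
  (nb v).countP fun u : Fin n => ¬ pos u < h

theorem restDegree_congr {pos' : ℕ → ℕ} {h : ℕ} (H : ∀ v : Fin n, pos' v < h ↔ pos v < h)
    (v : Fin n) : restDegree nb pos' h v = restDegree nb pos h v :=
  List.countP_congr fun u _ => by simpa using not_congr (H u)

theorem countP_eq_add_count {α : Type*} [DecidableEq α] (l : List α) (x : α)
    (p q : α → Bool) (hx : q x = false) (h : ∀ y, p y = true ↔ q y = true ∨ y = x) :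
    l.countP p = l.countP q + l.count x := by
  induction l with
  | nil => simp
  | cons a l ih =>
    rw [List.countP_cons, List.countP_cons, List.count_cons, ih]
    have := h a
    by_cases hax : a = x
    · subst hax
      simp [hx, this]
      omega
    · have hpq : p a = q a := by
        rw [Bool.eq_iff_iff, this]; simp [hax]
      simp [hax, hpq]
      omega

/-- The invariant of the main loop. -/
structure MainInv (nb : Fin n → List (Fin n)) (s : State) : Prop where
  queue : PeelInv nb s
  unqueued : ∀ v : Fin n, s.arr 10 v = n → s.reg 10 ≤ s.arr 9 v
  degree : ∀ v : Fin n, s.arr 9 v = restDegree nb (s.arr 10) (s.reg 8) v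

/-- When `x` is removed, its later neighbours are among those not yet removed, fewer than the
threshold because `x` was queued. Then the stored degree of each neighbour drops by one. -/
theorem wp_peelStep {s : State} {N : Fin n → Fin n → Prop} (hnb : IsNbLists nb N)
    (hN : ∀ x y, N x y → N y x ∧ x ≠ y) (ht : IsTable (s.arr 5) (s.arr 6) nb) (h0 : s.reg 0 = n)
    (H : MainInv nb s) (hlt : s.reg 8 < s.reg 9) {x : Fin n} (hx : s.arr 10 x = s.reg 8) :
    wp peelStep (nb x).length (fun s' => MainInv nb s' ∧ s'.reg 8 = s.reg 8 + 1 ∧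
      ∀ v : Fin n, s'.arr 10 v < s.reg 8 + 1 ↔ s.arr 10 v < s.reg 8 ∨ v = x) s := by
  have hxn : s.arr 10 x < n := hx ▸ hlt.trans_le H.queue.tl_le
  have hQ : s.arr 11 (s.reg 8) = x := hx ▸ H.queue.Q_pos x hxn
  have hstep : ∀ v : Fin n, s.arr 10 v < s.reg 8 + 1 ↔ s.arr 10 v < s.reg 8 ∨ v = x := by
    intro v
    rw [Nat.lt_succ_iff_lt_or_eq]
    refine or_congr_right ⟨fun h => ?_, fun h => h ▸ hx⟩
    exact (H.queue.pos_injOn hxn (hx.trans h.symm)).symm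
  have hcount : ∀ v, restDegree nb (s.arr 10) (s.reg 8) v =
      restDegree nb (s.arr 10) (s.reg 8 + 1) v + (nb x).count v := by
    intro v
    have : (nb x).count v = (nb v).count x := by
      rw [(hnb.nodup x).count, (hnb.nodup v).count]
      have h1 := hnb.mem_iff x v
      have h2 := hnb.mem_iff v x
      have h3 := hN x v
      have h4 := hN v x
      congr 1
      simp only [eq_iff_iff]
      tauto
    rw [this]
    refine countP_eq_add_count _ _ _ _ (by simp [hx]) fun u => ?_
    have := hstep u
    by_cases hux : u = x
    · subst hux
      simp [hx]
    · simp only [hux, or_false] at this ⊢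
      simpa using not_congr this.symm
  have hq : QueueInv nb (s.arr 9) (s.arr 10) (s.arr 11) (s.reg 8 + 1) (s.reg 9) (s.reg 10) := by
    obtain ⟨g1, g2, g3, g4, g5, g6⟩ := H.queue
    refine ⟨hlt, g2, g3, g4, g5, fun v hv => ?_⟩
    obtain hv | rfl := (hstep v).1 hv
    · exact g6 v hv
    · refine lt_of_le_of_lt ?_ (g5 v hxn)
      rw [H.degree]
      refine List.countP_mono_left fun u _ hu => ?_
      simp only [decide_eq_true_eq] at hu ⊢
      omega
  refine wp_seq_assign (wp_seq_assign ?_)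
  -- During the loop, stored degrees exceed the true ones exactly for the neighbours of `x` that are
  -- still to be visited.
  refine wp_for (N := (nb x).length) (fun i s' => PeelInv nb s' ∧
      (∀ v : Fin n, s'.arr 10 v = n → s.reg 10 ≤ s'.arr 9 v) ∧
      (∀ v : Fin n, s'.arr 9 v = restDegree nb (s'.arr 10) (s.reg 8 + 1) v +
        ((nb x).drop i).count v) ∧
      ∀ v : Fin n, s'.arr 10 v < s.reg 8 + 1 ↔ s.arr 10 v < s.reg 8 + 1) (fun _ => 0)
    (by decide) ⟨?_, ?_, ?_, ?_⟩ (fun k s' v h => ⟨by simpa [PeelInv] using h.1, h.2⟩)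
    (fun i s' hf _ => ?_) (fun i s' hf hi h => ?_) (fun s' hf h => ?_) (by simp)
  · simpa [PeelInv, Expr.eval, Op.eval] using hq
  · simpa using H.unqueued
  · intro v
    simp [H.degree, hcount]
  · simp
  · have h5 : s'.reg 5 = x := (hf.1 5 (by decide)).trans (by simp [Expr.eval, hQ])
    simp [Expr.eval, h5, hf.2 6 (by decide), ht.length]
  · have h5 : s'.reg 5 = x := (hf.1 5 (by decide)).trans (by simp [Expr.eval, hQ])
    have h8 : s'.reg 8 = s.reg 8 + 1 := (hf.1 8 (by decide)).trans (by simp [Expr.eval, Op.eval])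
    have h10 : s'.reg 10 = s.reg 10 := (hf.1 10 (by decide)).trans (by simp)
    have h0' : s'.reg 0 = n := (hf.1 0 (by decide)).trans (by simpa using h0)
    have hy : Expr.eval s' (.read 5 (.idx (.reg 3) (.reg 5))) = (nb x)[i] := by
      have := ht.get x i i.2
      simpa [Expr.eval, Expr.idx, Op.eval, h5, h0', hi, hf.2 5 (by decide)] using this
    generalize hyy : (nb x)[i] = y at hy
    have hdrop : (nb x).drop i = y :: (nb x).drop (i + 1) := by
      rw [List.drop_eq_getElem_cons i.2, ← hyy]
      rfl
    obtain ⟨hq', hu, hdeg, hpos⟩ := h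
    refine wp_seq_assign (wp_seq_write ?_)
    rw [hy]
    refine (wp_tryEnqueue (nb := nb) (n := n) (y := y) (by simpa using h0') (by simp) ?_).frame ?_
    · obtain ⟨g1, g2, g3, g4, g5, g6⟩ := hq'
      refine ⟨by simpa using g1, by simpa using g2, by simpa using g3, by simpa using g4,
        fun v hv => ?_, by simpa using g6⟩
      have := g5 v (by simpa using hv)
      by_cases hvy : v = y
      · subst hvy
        simp [Expr.eval, Op.eval]
        omega
      · have hne : (v : ℕ) ≠ y := fun e => hvy (Fin.ext e)
        simpa [Expr.eval, Function.update_of_ne hne] using this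
    · rintro s'' ⟨g1, g2, g3, g4⟩ hf''
      have ha : s''.arr 9 = Function.update (s'.arr 9) y (s'.arr 9 y - 1) := by
        rw [hf''.2 9 (by decide)]
        simp [Expr.eval, Op.eval]
      simp only [State.setArr_reg, State.setReg_reg, State.setArr_arr, State.setReg_arr, h8,
        h10] at g2 g3 g4
      have hpos' : ∀ v : Fin n, s''.arr 10 v < s.reg 8 + 1 ↔ s'.arr 10 v < s.reg 8 + 1 := by
        simpa using g4
      refine ⟨g1, fun v hv => ?_, fun v => ?_, fun v => (hpos' v).trans (hpos v)⟩
      · rw [ha]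
        by_cases hvy : v = y
        · subst hvy
          simpa [Expr.eval, Op.eval] using g3 hv
        · have hne : (v : ℕ) ≠ y := fun e => hvy (Fin.ext e)
          rw [Function.update_of_ne hne]
          exact hu v (by simpa using g2 v hv)
      · have := hdeg v
        rw [hdrop, List.count_cons] at this
        rw [ha, restDegree_congr hpos']
        by_cases hvy : v = y
        · subst hvy
          simp at this ⊢
          omega
        · have hne : (v : ℕ) ≠ y := fun e => hvy (Fin.ext e)
          rw [Function.update_of_ne hne]
          simpa [Ne.symm hvy] using this
  · have h8 : s'.reg 8 = s.reg 8 + 1 := (hf.1 8 (by decide)).trans (by simp [Expr.eval, Op.eval])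
    have h10 : s'.reg 10 = s.reg 10 := (hf.1 10 (by decide)).trans (by simp)
    obtain ⟨hq', hu, hdeg, hpos⟩ := h
    refine ⟨⟨hq', by rwa [h10], fun v => ?_⟩, h8, fun v => (hpos v).trans (hstep v)⟩
    rw [h8, hdeg]
    simp

/-- Vertices whose degree equals the old threshold may now be queued, so all of them are tried; this
restores the lower bound on the degrees of unqueued vertices. -/
theorem wp_peelScan {s : State} (h0 : s.reg 0 = n) (H : MainInv nb s) :
    wp peelScan n (fun s' => MainInv nb s' ∧ s'.reg 10 = s.reg 10 + 1 ∧
      ∀ v : Fin n, s'.arr 10 v < s.reg 8 ↔ s.arr 10 v < s.reg 8) s := by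
  refine wp_seq_assign ?_
  refine wp_for (N := n) (fun k s' => PeelInv nb s' ∧
    (∀ v : Fin n, v.1 < k → s'.arr 10 v = n → s.reg 10 + 1 ≤ s.arr 9 v) ∧
    ∀ v : Fin n, s'.arr 10 v < s.reg 8 ↔ s.arr 10 v < s.reg 8) (fun _ => 0)
    (by decide) ⟨?_, by simp, by simp⟩ (fun k s' v h => ⟨by simpa [PeelInv] using h.1, h.2⟩)
    (fun k s' hf h => (hf.1 0 (by decide)).trans (by simpa using h0))
    (fun k s' hf hk h => ?_) (fun s' hf h => ?_) (by simp)
  · obtain ⟨h1, h2, h3, h4, h5, h6⟩ := H.queue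
    exact ⟨h1, h2, h3, h4, fun v hv => (h5 v hv).trans (by simp [Expr.eval, Op.eval]),
      fun v hv => (h6 v hv).trans (by simp [Expr.eval, Op.eval])⟩
  · refine wp_seq_assign ?_
    have h8 : s'.reg 8 = s.reg 8 := (hf.1 8 (by decide)).trans (by simp)
    have h10 : s'.reg 10 = s.reg 10 + 1 :=
      (hf.1 10 (by decide)).trans (by simp [Expr.eval, Op.eval])
    have ha : s'.arr 9 = s.arr 9 := hf.2 9 (by decide)
    refine (wp_tryEnqueue (nb := nb) (n := n) (y := k) ?_ (by simpa [Expr.eval] using hk)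
      (by simpa [PeelInv] using h.1)).mono le_rfl fun s'' h' => ⟨h'.1, fun v hv hvn => ?_, ?_⟩
    · simpa using (hf.1 0 (by decide)).trans (by simpa using h0)
    · simp only [State.setReg_arr, State.setReg_reg, ha, h10] at h'
      by_cases hvk : v = k
      · subst hvk
        simpa using h'.2.2.1 hvn
      · refine h.2.1 v ?_ (h'.2.1 v hvn)
        have : (v : ℕ) ≠ k := fun e => hvk (Fin.ext e)
        omega
    · intro v
      have := h'.2.2.2 v
      simp only [State.setReg_arr, State.setReg_reg, h8] at this
      exact (by simpa using this : _ ↔ _).trans (h.2.2 v)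
  · have h8 : s'.reg 8 = s.reg 8 := (hf.1 8 (by decide)).trans (by simp)
    have h10 : s'.reg 10 = s.reg 10 + 1 :=
      (hf.1 10 (by decide)).trans (by simp [Expr.eval, Op.eval])
    have ha : s'.arr 9 = s.arr 9 := hf.2 9 (by decide)
    refine ⟨⟨h.1, fun v hv => ?_, fun v => ?_⟩, h10, h.2.2⟩
    · rw [h10, ha]
      exact h.2.1 v v.2 hv
    · rw [ha, h8, H.degree, restDegree_congr h.2.2]

/-- The threshold never exceeds `K + 1`, so at most `K + 1` scans occur, and every vertex is removed
with fewer than `K + 1` later neighbours. The program itself does not know `K`. -/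
theorem wp_peel {s : State} {N : Fin n → Fin n → Prop} (hnb : IsNbLists nb N)
    (hN : ∀ x y, N x y → N y x ∧ x ≠ y) (ht : IsTable (s.arr 5) (s.arr 6) nb) (h0 : s.reg 0 = n)
    {K : ℕ} (hK : Degenerate nb K) {t : ℕ}
    (hle : n + ∑ v, ((nb v).length + 1) + (K + 1) * (n + 1) ≤ t) :
    wp peel t (fun s' => ∃ pos : Fin n → ℕ, Function.Injective pos ∧ (∀ v, pos v < n) ∧
      (∀ v : Fin n, s'.arr 10 v = pos v) ∧ (∀ v, s'.arr 11 (pos v) = v) ∧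
      ∀ v, (laterNb nb pos v).length ≤ K) s := by
  refine wp_seq n _ (wp_for (N := n) (fun k s' => ∀ v : Fin n, v.1 < k →
    s'.arr 9 v = (nb v).length ∧ s'.arr 10 v = n) (fun _ => 0) (by decide) (by simp)
    (fun _ _ _ h => h) (fun k s' hf _ => (hf.1 0 (by decide)).trans h0) (fun k s' hf hk h => ?_)
    (fun s₁ hf₁ h₁ => ?_) (by simp)) (by rwa [add_assoc] at hle)
  · refine wp_seq_write (wp_write fun v hv => ?_)
    have h6 : s'.arr 6 k = (nb k).length := by rw [hf.2 6 (by decide), ht.length]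
    have h0' : s'.reg 0 = n := (hf.1 0 (by decide)).trans h0
    by_cases hvk : v = k
    · subst hvk
      simp [Expr.eval, hk, h6, h0']
    · have hne : (v : ℕ) ≠ k := fun e => hvk (Fin.ext e)
      simpa [Expr.eval, hk, h6, h0', Function.update_of_ne hne] using h v (by omega)
  have h0₁ : s₁.reg 0 = n := (hf₁.1 0 (by decide)).trans h0
  have ht₁ : IsTable (s₁.arr 5) (s₁.arr 6) nb := by
    rwa [hf₁.2 5 (by decide), hf₁.2 6 (by decide)]
  refine wp_seq_assign (wp_seq_assign (wp_seq_assign ?_))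
  -- Potential: every vertex still to be removed pays for its neighbourhood list, and every possible
  -- increase of the threshold pays for one scan.
  refine wp_while (fun s' => MainInv nb s' ∧ s'.reg 0 = n ∧ s'.reg 10 ≤ K + 1 ∧
      IsTable (s'.arr 5) (s'.arr 6) nb)
    (fun s' => ∑ v : Fin n, (if s'.arr 10 v < s'.reg 8 then 0 else (nb v).length + 1) +
      (K + 1 - s'.reg 10) * (n + 1)) ?_ ?_ ⟨⟨?_, ?_, ?_⟩, ?_, ?_, ?_⟩ ?_
  · rintro s' ⟨H, h0', hd, ht'⟩ he
    simp only [Expr.eval, Op.eval, h0', ne_eq, ite_eq_right_iff, one_ne_zero, imp_false,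
      not_not] at he
    by_cases hlt : s'.reg 8 < s'.reg 9
    · obtain ⟨x, -, hx⟩ := H.queue.pos_Q _ hlt
      refine ⟨(nb x).length, wp_ite (fun _ => ?_) fun h => by simp [Expr.eval, Op.eval, hlt] at h⟩
      refine (wp_peelStep hnb hN ht' h0' H hlt hx).frame fun s'' h hf => ⟨⟨h.1, ?_, ?_, ?_⟩, ?_⟩
      · exact (hf.1 0 (by decide)).trans h0'
      · rwa [hf.1 10 (by decide)]
      · rwa [hf.2 5 (by decide), hf.2 6 (by decide)]
      · simp only [h.2.1, h.2.2, hf.1 10 (by decide)]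
        have key : ∑ v : Fin n, (if s'.arr 10 v < s'.reg 8 ∨ v = x then 0 else (nb v).length + 1) +
            ((nb x).length + 1) =
            ∑ v : Fin n, (if s'.arr 10 v < s'.reg 8 then 0 else (nb v).length + 1) := by
          rw [← Finset.sum_erase_add _ _ (Finset.mem_univ x),
            ← Finset.sum_erase_add (f := fun v : Fin n => if s'.arr 10 v < s'.reg 8 then 0
              else (nb v).length + 1) _ (Finset.mem_univ x)]
          simp only [or_true, if_true, add_zero, hx, lt_irrefl, if_false]
          congr 1
          refine Finset.sum_congr rfl fun v hv => ?_
          simp [Finset.ne_of_mem_erase hv]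
        omega
    · have hht : s'.reg 8 = s'.reg 9 := le_antisymm H.queue.le (not_lt.1 hlt)
      -- The queue is empty, so the remaining vertices are all unqueued, with remaining degree at
      -- least the threshold. There are such vertices, and by degeneracy one of them has at most `K`
      -- remaining neighbours.
      have hdK : s'.reg 10 ≤ K := by
        obtain ⟨v, hv, hvK⟩ := hK {v : Fin n | ¬ s'.arr 10 v < s'.reg 8} (by
          by_contra hemp
          rw [Finset.not_nonempty_iff_eq_empty, Finset.filter_eq_empty_iff] at hemp
          replace hemp : ∀ v : Fin n, s'.arr 10 v < s'.reg 8 := fun v =>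
            not_not.1 (hemp (Finset.mem_univ v))
          have : Function.Injective fun v : Fin n => (⟨s'.arr 10 v, hemp v⟩ : Fin (s'.reg 8)) :=
            fun u v huv => H.queue.pos_injOn ((hemp u).trans he) (congrArg Fin.val huv)
          have := Fintype.card_le_of_injective _ this
          simp at this
          omega)
        have hvn : s'.arr 10 v = n := (H.queue.pos_cases v).resolve_right (by
          have := (Finset.mem_filter.1 hv).2
          rwa [← hht])
        refine ((H.unqueued v hvn).trans (H.degree v).le).trans (le_trans (le_of_eq ?_) hvK)
        exact List.countP_congr (by simp)
      refine ⟨n, wp_ite (fun h => by simp [Expr.eval, Op.eval, hlt] at h) fun _ => ?_⟩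
      refine (wp_peelScan h0' H).frame fun s'' h hf => ⟨⟨h.1, ?_, ?_, ?_⟩, ?_⟩
      · exact (hf.1 0 (by decide)).trans h0'
      · rw [h.2.1]; omega
      · rwa [hf.2 5 (by decide), hf.2 6 (by decide)]
      · have h8 := hf.1 8 (by decide)
        simp only [h.2.1, h8, h.2.2]
        have : K + 1 - s'.reg 10 = K + 1 - (s'.reg 10 + 1) + 1 := by omega
        rw [this, add_mul _ 1]
        omega
  · rintro s' ⟨H, h0', hd, ht'⟩ he
    simp only [Expr.eval, Op.eval, h0', ite_eq_right_iff, one_ne_zero, imp_false,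
      not_lt] at he
    have htl := H.queue.tl_le
    have hle := H.queue.le
    have hlt : ∀ v : Fin n, s'.arr 10 v < n := fun v =>
      H.queue.lt_n fun hv => by have := H.queue.tl_lt hv; omega
    refine ⟨fun v => s'.arr 10 v, fun u v huv => H.queue.pos_injOn (hlt u) huv, hlt,
      fun _ => rfl, fun v => H.queue.Q_pos v (hlt v), fun v => ?_⟩
    have := H.queue.later v ((hlt v).trans_le he)
    rw [laterNb, ← List.countP_eq_length_filter]
    omega
  · refine ⟨by simp [Expr.eval], fun v => .inl (h₁ v v.2).2, fun v hv => ?_, by simp [Expr.eval],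
      fun v hv => ?_, by simp [Expr.eval]⟩
    all_goals
      have := (h₁ v v.2).2
      simp at hv
      omega
  · simp [Expr.eval]
  · intro v
    simp [Expr.eval, restDegree, (h₁ v v.2).1]
  · simpa using h0₁
  · simp [Expr.eval]
  · simpa using ht₁
  · simp [Expr.eval]

end

end RAM

namespace RAM

section
variable {n : ℕ} {s : State} {nb A T adj : Fin n → List (Fin n)}

/-! ### Orientations -/

/-- Append the later neighbours of every vertex to its list. -/
def orient : Prog :=
  .for 2 (.reg 0) (.for 3 (.read 6 (.reg 2)) (.assign 6 (.read 5 (.idx (.reg 3) (.reg 2))) ;;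
    .ite (.op .lt (.read 10 (.reg 2)) (.read 10 (.reg 6))) (push 7 8 (.reg 2) (.reg 6)) .skip))

/-- With the companion lemma below, this describes a table whose first `k` lists are finished, when
list `k` is completed or not yet begun. -/
theorem ite_lt_update {α : Type*} {f g : Fin n → α} (k : Fin n) :
    Function.update (fun v => if v.1 < k.1 then f v else g v) k (f k) =
      fun v => if v.1 < k.1 + 1 then f v else g v := by
  funext v
  by_cases hvk : v = k
  · subst hvk; simp
  · have hne : (v : ℕ) ≠ k := fun e => hvk (Fin.ext e)
    rw [Function.update_of_ne hvk]
    congr 1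
    rw [eq_iff_iff]
    omega

theorem ite_lt_update_self {α : Type*} {f g : Fin n → α} (k : Fin n) :
    Function.update (fun v => if v.1 < k.1 then f v else g v) k (g k) =
      fun v => if v.1 < k.1 then f v else g v :=
  Function.update_eq_self_iff.2 (by simp)

theorem wp_orient (h0 : s.reg 0 = n) (hnb : IsTable (s.arr 5) (s.arr 6) nb)
    (hA : IsTable (s.arr 7) (s.arr 8) A) {pos : Fin n → ℕ} (hpos : ∀ v : Fin n, s.arr 10 v = pos v)
    {t : ℕ} (ht : ∑ v, ((nb v).length + 1) ≤ t) :
    wp orient t (fun s' => IsTable (s'.arr 7) (s'.arr 8) fun v => A v ++ laterNb nb pos v) s := by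
  refine wp_for (N := n) (fun k s' => IsTable (s'.arr 7) (s'.arr 8) fun v =>
    if v.1 < k then A v ++ laterNb nb pos v else A v) (fun v => (nb v).length) (by decide)
    (by simpa using hA) (fun _ _ _ h => h) (fun k s' hf _ => (hf.1 0 (by decide)).trans h0)
    (fun k s' hf hk h => ?_) (fun s' _ h => by simpa using h) ht
  have h0' := (hf.1 0 (by decide)).trans h0
  have h5 := hf.2 5 (by decide)
  have h6 := hf.2 6 (by decide)
  have h10 := hf.2 10 (by decide)
  refine wp_for (N := (nb k).length) (fun i s'' => IsTable (s''.arr 7) (s''.arr 8)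
    (Function.update (fun v => if v.1 < k.1 then A v ++ laterNb nb pos v else A v) k
      (A k ++ ((nb k).take i).filter fun u => pos k < pos u))) (fun _ => 0) (by decide)
    (by
      rw [List.take_zero, List.filter_nil, List.append_nil]
      exact (ite_lt_update_self (g := A) k).symm ▸ h)
    (fun _ _ _ h => h) (fun i s'' hf' _ => ?_)
    (fun i s'' hf' hi h' => ?_) (fun s'' _ h => ?_) (by simp)
  · simp only [Expr.eval, hf'.1 2 (by decide), hf'.2 6 (by decide), h6, hk, hnb.length]
  · have h2 := (hf'.1 2 (by decide)).trans hk
    have h0'' := (hf'.1 0 (by decide)).trans h0'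
    have hy : Expr.eval s'' (.read 5 (.idx (.reg 3) (.reg 2))) = (nb k)[i] := by
      have := hnb.get k i i.2
      simpa [Expr.eval, Expr.idx, Op.eval, h2, h0'', hi, hf'.2 5 (by decide), h5] using this
    have htake : (nb k).take (i + 1) = (nb k).take i ++ [(nb k)[i]] := by simp
    rw [htake, List.filter_append, ← List.append_assoc]
    generalize (nb k)[i] = y at hy
    refine wp_seq_assign ?_
    rw [hy]
    have hc : s''.arr 10 k < s''.arr 10 y ↔ pos k < pos y := by
      rw [hf'.2 10 (by decide), h10, hpos, hpos]
    refine wp_ite (fun he => ?_) fun he => wp_skip ?_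
    · simp only [Expr.eval, Op.eval, State.setReg_reg, State.setReg_arr, if_true, h2,
        ne_eq, ite_eq_right_iff, one_ne_zero, imp_false, not_not, hc,
        show (2 = 6) ↔ False by decide, if_false] at he
      refine wp_push (s := s''.setReg 6 y) (x := k) (y := y) (by decide) (by simpa using h0'')
        (by simpa [Expr.eval] using h2) (by simpa [Expr.eval] using h2) (by simp [Expr.eval]) h' ?_
      intro u _ _ hu
      simpa [he] using hu
    · simp only [Expr.eval, Op.eval, State.setReg_reg, State.setReg_arr, if_true, h2,
        ite_eq_right_iff, one_ne_zero, imp_false, hc,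
        show (2 = 6) ↔ False by decide, if_false] at he
      simpa [he] using h'
  · rw [List.take_length] at h
    exact ite_lt_update (f := fun v => A v ++ laterNb nb pos v) k ▸ h

/-! ### Ancestors -/

/-- Start with the lists that contain only the vertices themselves. -/
def initAncestors : Prog :=
  .for 2 (.reg 0) (.write 12 (.reg 2) (.reg 2) ;; .write 13 (.reg 2) (.const 1))

theorem wp_initAncestors (h0 : s.reg 0 = n) :
    wp initAncestors n (fun s' => IsTable (s'.arr 12) (s'.arr 13) fun v : Fin n => [v]) s := by
  refine wp_for (N := n) (fun k s' => ∀ v : Fin n, v.1 < k → s'.arr 12 v = v ∧ s'.arr 13 v = 1)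
    (fun _ => 0) (by decide) (by simp) (fun _ _ _ h => h)
    (fun k s' hf _ => (hf.1 0 (by decide)).trans h0) (fun k s' hf hk h => ?_)
    (fun s' _ h => ⟨fun v => (h v v.2).2, fun v j hj => ?_⟩) (by simp)
  · refine wp_seq_write (wp_write fun v hv => ?_)
    by_cases hvk : v = k
    · subst hvk
      simp [Expr.eval, hk]
    · have hne : (v : ℕ) ≠ k := fun e => hvk (Fin.ext e)
      simpa [Expr.eval, hk, Function.update_of_ne hne] using h v (by omega)
  · obtain rfl : j = 0 := by simpa using hj
    simpa using (h v v.2).1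

/-- Append to every list of ancestors the in-neighbours of its members. -/
def growAncestors : Prog :=
  .for 2 (.reg 0) (.assign 12 (.read 13 (.reg 2)) ;;
    .for 3 (.reg 12) (.assign 5 (.read 12 (.idx (.reg 3) (.reg 2))) ;;
      .for 4 (.read 8 (.reg 5)) (push 12 13 (.reg 2) (.read 7 (.idx (.reg 4) (.reg 5))))))

theorem wp_growAncestors (h0 : s.reg 0 = n) (hA : IsTable (s.arr 7) (s.arr 8) A)
    (hT : IsTable (s.arr 12) (s.arr 13) T) {d m t : ℕ} (hd : ∀ v, (A v).length ≤ d)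
    (hm : ∀ v, (T v).length ≤ m) (ht : n * (m * (d + 1) + 1) ≤ t) :
    wp growAncestors t
      (fun s' => IsTable (s'.arr 12) (s'.arr 13) fun v => T v ++ (T v).flatMap A) s := by
  refine wp_for (N := n) (fun k s' => IsTable (s'.arr 12) (s'.arr 13) fun v =>
    if v.1 < k then T v ++ (T v).flatMap A else T v) (fun v => m * (d + 1)) (by decide)
    (by simpa using hT) (fun _ _ _ h => h) (fun k s' hf _ => (hf.1 0 (by decide)).trans h0)
    (fun k s' hf hk h => ?_) (fun s' _ h => by simpa using h) (by simpa using ht)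
  have h0' := (hf.1 0 (by decide)).trans h0
  have hA' : IsTable (s'.arr 7) (s'.arr 8) A := by
    rwa [hf.2 7 (by decide), hf.2 8 (by decide)]
  clear hf
  have hlen : s'.arr 13 k = (T k).length := by rw [h.length]; simp
  refine wp_seq_assign ?_
  refine wp_for (N := (T k).length) (fun i s'' => IsTable (s''.arr 12) (s''.arr 13)
    (Function.update (fun v => if v.1 < k.1 then T v ++ (T v).flatMap A else T v) k
      (T k ++ ((T k).take i).flatMap A))) (fun _ => d) (by decide)
    (by
      rw [List.take_zero, List.flatMap_nil, List.append_nil]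
      exact (ite_lt_update_self (g := T) k).symm ▸ h)
    (fun _ _ _ h => h) (fun i s'' hf _ => ?_)
    (fun i s'' hf hi h' => ?_) (fun s'' _ h => ?_)
    (le_trans (by simp) (Nat.mul_le_mul_right _ (hm k)))
  · exact (hf.1 12 (by decide)).trans (by simp [Expr.eval, hk, hlen])
  · have h2 : s''.reg 2 = k := (hf.1 2 (by decide)).trans (by simpa using hk)
    have h0'' : s''.reg 0 = n := (hf.1 0 (by decide)).trans (by simpa using h0')
    have hA'' : IsTable (s''.arr 7) (s''.arr 8) A := by
      rwa [hf.2 7 (by decide), hf.2 8 (by decide)]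
    clear hf
    -- The list of `k` is read while it grows, but entries are only appended, so its original part
    -- is intact. The loop bound is a saved copy of the old length.
    have hx : Expr.eval s'' (.read 12 (.idx (.reg 3) (.reg 2))) = (T k)[i] := by
      have hi' : i.1 < (T k ++ ((T k).take i).flatMap A).length := by
        rw [List.length_append]; omega
      have := h'.get k i (by simpa using hi')
      simp only [Function.update_self, List.getElem_append_left i.2] at this
      simpa [Expr.eval, Expr.idx, Op.eval, h2, h0'', hi] using this
    have htake : (T k).take (i + 1) = (T k).take i ++ [(T k)[i]] := by simp
    rw [htake, List.flatMap_append, List.flatMap_singleton, ← List.append_assoc]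
    generalize (T k)[i] = x at hx
    refine wp_seq_assign ?_
    rw [hx]
    refine wp_for (N := (A x).length) (fun j u => IsTable (u.arr 12) (u.arr 13)
      (Function.update (fun v => if v.1 < k.1 then T v ++ (T v).flatMap A else T v) k
        (T k ++ ((T k).take i).flatMap A ++ (A x).take j))) (fun _ => 0) (by decide)
      (by simpa using h') (fun _ _ _ h => h) (fun j u hf _ => ?_) (fun j u hf hj hu => ?_)
      (fun u _ hu => ?_) (by simpa using hd x)
    · simp only [Expr.eval, hf.1 5 (by decide), hf.2 8 (by decide)]
      simp [hA''.length]
    · have h5u : u.reg 5 = x := (hf.1 5 (by decide)).trans (by simp)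
      have h2u : u.reg 2 = k := (hf.1 2 (by decide)).trans (by simpa using h2)
      have h0u : u.reg 0 = n := (hf.1 0 (by decide)).trans (by simpa using h0'')
      have hy : Expr.eval u (.read 7 (.idx (.reg 4) (.reg 5))) = (A x)[j] := by
        have := hA''.get x j j.2
        simpa [Expr.eval, Expr.idx, Op.eval, h5u, h0u, hj, hf.2 7 (by decide)] using this
      refine wp_push (x := k) (y := (A x)[j]) (by decide) h0u
        (by simpa [Expr.eval] using h2u) (by simpa [Expr.eval] using h2u) hy hu ?_
      intro u' _ _ hu'
      have htake : (A x).take (j + 1) = (A x).take j ++ [(A x)[j]] := by simp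
      rw [htake]
      simpa using hu'
    · rwa [List.take_length] at hu
  · rw [List.take_length] at h
    exact ite_lt_update (f := fun v => T v ++ (T v).flatMap A) k ▸ h

/-! ### Balls -/

/-- The input arrays represent the adjacency lists. -/
structure IsAdjArray (off a : ℕ → ℕ) (adj : Fin n → List (Fin n)) : Prop where
  length : ∀ v : Fin n, off (v + 1) - off v = (adj v).length
  get : ∀ (v : Fin n) (j : ℕ) (h : j < (adj v).length), a (off v + j) = (adj v)[j]

/-- The length of the adjacency list of the vertex in register `2`. -/
def adjLength : Expr :=
  .op .sub (.read 0 (.op .add (.reg 2) (.const 1))) (.read 0 (.reg 2))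

/-- The entry with the index in register `3` in the adjacency list of the vertex in register
`2`. -/
def adjEntry : Expr := .read 1 (.op .add (.read 0 (.reg 2)) (.reg 3))

/-- Copy the positions in the order. -/
def initBest : Prog := .for 2 (.reg 0) (.write 14 (.reg 2) (.read 10 (.reg 2)))

theorem wp_initBest (h0 : s.reg 0 = n) :
    wp initBest n (fun s' => ∀ v : Fin n, s'.arr 14 v = s.arr 10 v) s := by
  refine wp_for (N := n) (fun k s' => ∀ v : Fin n, v.1 < k → s'.arr 14 v = s.arr 10 v)
    (fun _ => 0) (by decide) (by simp) (fun _ _ _ h => h)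
    (fun k s' hf _ => (hf.1 0 (by decide)).trans h0) (fun k s' hf hk h => ?_)
    (fun s' _ h v => h v v.2) (by simp)
  refine wp_write fun v hv => ?_
  by_cases hvk : v = k
  · subst hvk
    simp [Expr.eval, hk, hf.2 10 (by decide)]
  · have hne : (v : ℕ) ≠ k := fun e => hvk (Fin.ext e)
    simpa [Expr.eval, hk, Function.update_of_ne hne] using h v (by omega)

/-- Replace the value of every vertex by the maximum over its closed neighbourhood. -/
def spread : Prog :=
  .for 2 (.reg 0) (.assign 5 (.read 14 (.reg 2)) ;;
    .for 3 adjLength (.assign 6 (.read 14 adjEntry) ;;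
      .ite (.op .lt (.reg 5) (.reg 6)) (.assign 5 (.reg 6)) .skip) ;;
    .write 15 (.reg 2) (.reg 5)) ;;
  .for 2 (.reg 0) (.write 14 (.reg 2) (.read 15 (.reg 2)))

/-- The maximum of the values of a vertex and its neighbours. -/
def maxNb (adj : Fin n → List (Fin n)) (a : Fin n → ℕ) (v : Fin n) : ℕ :=
  (adj v).foldl (fun m u => max m (a u)) (a v)

/-- The maxima are collected in a second array and copied back at the end, so all of them refer to
the old values. -/
theorem wp_spread (h0 : s.reg 0 = n) (hadj : IsAdjArray (s.arr 0) (s.arr 1) adj) {a : Fin n → ℕ}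
    (ha : ∀ v : Fin n, s.arr 14 v = a v) {t : ℕ} (ht : ∑ v, ((adj v).length + 1) + n ≤ t) :
    wp spread t (fun s' => ∀ v : Fin n, s'.arr 14 v = maxNb adj a v) s := by
  refine wp_seq (∑ v, ((adj v).length + 1)) n (wp_for (N := n)
    (fun k s' => ∀ v : Fin n, v.1 < k → s'.arr 15 v = maxNb adj a v) (fun v => (adj v).length)
    (by decide) (by simp) (fun _ _ _ h => h) (fun k s' hf _ => (hf.1 0 (by decide)).trans h0)
    (fun k s' hf hk h => ?_) (fun s' hf h => ?_) le_rfl) ht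
  · refine wp_seq_assign (wp_seq (adj k).length 0 (wp_for (N := (adj k).length)
      (fun i s'' => s''.reg 5 = ((adj k).take i).foldl (fun m u => max m (a u)) (a k)) (fun _ => 0)
      (by decide) ?_ (fun i s'' v h => by simpa using h) (fun i s'' hf' _ => ?_)
      (fun i s'' hf' hi h' => ?_) (fun s'' hf' h' => ?_) (by simp)) (by simp))
    · simp [Expr.eval, hk, hf.2 14 (by decide), ha]
    · have h2 : s''.reg 2 = k := (hf'.1 2 (by decide)).trans (by simpa using hk)
      simp only [adjLength, Expr.eval, Op.eval, h2, hf'.2 0 (by decide), State.setReg_arr,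
        hf.2 0 (by decide), hadj.length]
    · have h2 : s''.reg 2 = k := (hf'.1 2 (by decide)).trans (by simpa using hk)
      have hy : adjEntry.eval s'' = (adj k)[i] := by
        simp only [adjEntry, Expr.eval, Op.eval, h2, hi, hf'.2 0 (by decide),
          hf'.2 1 (by decide), State.setReg_arr, hf.2 0 (by decide), hf.2 1 (by decide)]
        exact hadj.get k i i.2
      have h14 : s''.arr 14 (adj k)[i] = a (adj k)[i] := by
        rw [hf'.2 14 (by decide), State.setReg_arr, hf.2 14 (by decide), ha]
      have htake : (adj k).take (i + 1) = (adj k).take i ++ [(adj k)[i]] := by simp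
      have hx : Expr.eval s'' (.read 14 adjEntry) = a (adj k)[i] := by
        simp only [Expr.eval, hy, h14]
      refine wp_seq_assign ?_
      rw [htake, List.foldl_append, List.foldl_cons, List.foldl_nil, ← h', hx]
      refine wp_ite (fun he => wp_assign ?_) fun he => wp_skip ?_
      all_goals
        simp [Expr.eval, Op.eval] at he ⊢
        omega
    · have h2 : s''.reg 2 = k := (hf'.1 2 (by decide)).trans (by simpa using hk)
      refine wp_write fun v hv => ?_
      by_cases hvk : v = k
      · subst hvk
        simp [Expr.eval, h2, h', maxNb]
      · have hne : (v : ℕ) ≠ k := fun e => hvk (Fin.ext e)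
        have := h v (by omega)
        simpa [Expr.eval, h2, Function.update_of_ne hne, hf'.2 15 (by decide)] using this
  · refine wp_for (N := n) (fun k s'' => ∀ v : Fin n, v.1 < k → s''.arr 14 v = maxNb adj a v)
      (fun _ => 0) (by decide) (by simp) (fun _ _ _ h => h)
      (fun k s'' hf' _ => (hf'.1 0 (by decide)).trans ((hf.1 0 (by decide)).trans h0))
      (fun k s'' hf' hk h' => wp_write fun v hv => ?_) (fun s'' _ h v => h v v.2) (by simp)
    by_cases hvk : v = k
    · subst hvk
      simp [Expr.eval, hk, hf'.2 15 (by decide), h v v.2]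
    · have hne : (v : ℕ) ≠ k := fun e => hvk (Fin.ext e)
      simpa [Expr.eval, hk, Function.update_of_ne hne] using h' v (by omega)

/-- Output the reverse order and the set of the vertices at the positions in array `14`. -/
def output : Prog :=
  .for 2 (.reg 0) (.write 3 (.read 11 (.read 14 (.reg 2))) (.const 1) ;;
    .write 2 (.reg 2) (.read 11 (.op .sub (.op .sub (.reg 0) (.const 1)) (.reg 2))))

theorem wp_output (h0 : s.reg 0 = n) (h3 : ∀ v : Fin n, s.arr 3 v = 0) :
    wp output n (fun s' => (∀ v : Fin n, s'.arr 2 v = s.arr 11 (n - 1 - v)) ∧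
      (∀ v : Fin n, s'.arr 3 v ≤ 1 ∧
        (s'.arr 3 v = 1 ↔ ∃ w : Fin n, s.arr 11 (s.arr 14 w) = v))) s := by
  refine wp_for (N := n) (fun k s' => (∀ v : Fin n, v.1 < k → s'.arr 2 v = s.arr 11 (n - 1 - v)) ∧
      (∀ v : Fin n, s'.arr 3 v ≤ 1 ∧
        (s'.arr 3 v = 1 ↔ ∃ w : Fin n, w.1 < k ∧ s.arr 11 (s.arr 14 w) = v)))
    (fun _ => 0) (by decide) (by simp [h3]) (fun _ _ _ h => h)
    (fun k s' hf _ => (hf.1 0 (by decide)).trans h0) (fun k s' hf hk h => ?_)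
    (fun s' _ h => by simpa using h) (by simp)
  have h0' := (hf.1 0 (by decide)).trans h0
  have h11 := hf.2 11 (by decide)
  have h14 := hf.2 14 (by decide)
  refine wp_seq_write (wp_write ⟨fun v hv => ?_, fun v => ?_⟩)
  · by_cases hvk : v = k
    · subst hvk
      simp [Expr.eval, Op.eval, hk, h0', h11]
    · have hne : (v : ℕ) ≠ k := fun e => hvk (Fin.ext e)
      simpa [Expr.eval, hk, Function.update_of_ne hne] using h.1 v (by omega)
  · have := h.2 v
    have hex : (∃ w : Fin n, w.1 < k.1 + 1 ∧ s.arr 11 (s.arr 14 w) = v) ↔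
        (∃ w : Fin n, w.1 < k ∧ s.arr 11 (s.arr 14 w) = v) ∨ s.arr 11 (s.arr 14 k) = v := by
      simp only [Nat.lt_succ_iff_lt_or_eq, or_and_right, exists_or]
      refine or_congr_right ⟨?_, fun h => ⟨k, rfl, h⟩⟩
      rintro ⟨w, hw, h⟩
      rwa [← Fin.ext hw]
    rw [hex]
    by_cases hv : (v : ℕ) = s.arr 11 (s.arr 14 k)
    · simp [Expr.eval, hk, h11, h14, ← hv]
    · simpa [Expr.eval, hk, h11, h14, Function.update_of_ne hv, Ne.symm hv] using this

end

end RAM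

/-! ### Peeling and orienting in time linear in the number of vertices. -/

namespace RAM

section
variable {n : ℕ} {s : State} {nb : Fin n → List (Fin n)} {G : SimpleGraph (Fin n)} {f : ℕ → ℕ}

theorem wp_peel_of_degenerate {N : Fin n → Fin n → Prop} (hnb : IsNbLists nb N)
    (hN : ∀ x y, N x y → N y x ∧ x ≠ y) (ht : IsTable (s.arr 5) (s.arr 6) nb) (h0 : s.reg 0 = n)
    {K : ℕ} (hK : Degenerate nb K) {t : ℕ} (hle : (3 * K + 3) * (n + 1) ≤ t) :
    wp peel t (fun s' => ∃ pos : Fin n → ℕ, Function.Injective pos ∧ (∀ v, pos v < n) ∧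
      (∀ v : Fin n, s'.arr 10 v = pos v) ∧ (∀ v, s'.arr 11 (pos v) = v) ∧
      ∀ v, (laterNb nb pos v).length ≤ K) s := by
  obtain ⟨u, hu, s', hr, pos, h1, h⟩ := wp_peel hnb hN ht h0 hK le_rfl
  -- The order computed by the run bounds the total length of the lists, and thereby the cost of the
  -- run itself.
  have hsum := hnb.sum_length_le hN h1 h.2.2.2
  rw [Finset.sum_add_distrib] at hu
  simp only [Finset.sum_const, Finset.card_univ, Fintype.card_fin, smul_eq_mul, mul_one] at hu
  exact ⟨u, by nlinarith, s', hr, pos, h1, h⟩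

theorem wp_peel_orient {A : Fin n → List (Fin n)} {N : Fin n → Fin n → Prop}
    (hnb : IsNbLists nb N) (hN : ∀ x y, N x y → N y x ∧ x ≠ y)
    (ht : IsTable (s.arr 5) (s.arr 6) nb) (h0 : s.reg 0 = n)
    (hA : IsTable (s.arr 7) (s.arr 8) A) {K : ℕ} (hK : Degenerate nb K) {t : ℕ}
    (hle : (5 * K + 4) * (n + 1) ≤ t) :
    wp (peel ;; orient) t (fun s' => ∃ pos : Fin n → ℕ, Function.Injective pos ∧
      (∀ v, (laterNb nb pos v).length ≤ K) ∧
      IsTable (s'.arr 7) (s'.arr 8) fun v => A v ++ laterNb nb pos v) s := by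
  refine wp_seq ((3 * K + 3) * (n + 1)) ((2 * K + 1) * (n + 1))
    ((wp_peel_of_degenerate hnb hN ht h0 hK le_rfl).frame ?_) (by nlinarith)
  rintro s' ⟨pos, h1, -, h2, -, h3⟩ hf
  have hsum := hnb.sum_length_le hN h1 h3
  refine (wp_orient (s := s') (nb := nb) ((hf.1 0 (by decide)).trans h0) ?_ ?_ h2 le_rfl).mono ?_
    fun s'' h => ⟨pos, h1, h3, h⟩
  · rwa [hf.2 5 (by decide), hf.2 6 (by decide)]
  · rwa [hf.2 7 (by decide), hf.2 8 (by decide)]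
  · rw [Finset.sum_add_distrib]
    simp only [Finset.sum_const, Finset.card_univ, Fintype.card_fin, smul_eq_mul, mul_one]
    nlinarith

/-! ### Rounds of fraternal augmentations -/

/-- The state after `t` rounds. -/
def RoundInv (G : SimpleGraph (Fin n)) (f : ℕ → ℕ) (t : ℕ) (s : State) : Prop :=
  s.reg 7 = 1 ∧ ∃ A, IsFraternalChain G A t ∧ AugBounded G f t (A t) ∧
    IsTable (s.arr 7) (s.arr 8) (A t) ∧
    ∀ x y : Fin n, (1 ≤ s.arr 4 (x * n + y) ↔ x ∈ A t y ∨ y ∈ A t x) ∧ s.arr 4 (x * n + y) ≤ 1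

/-- Orienting by `pos` turns each new edge into exactly one arc, so the marks in the matrix keep
describing adjacency. -/
theorem mem_append_laterNb_iff {A : Fin n → List (Fin n)} {N : Fin n → Fin n → Prop}
    (hnb : IsNbLists nb N) (hN : ∀ x y, N x y → N y x ∧ x ≠ y) {pos : Fin n → ℕ}
    (hpos : Function.Injective pos) (x y : Fin n) :
    (x ∈ A y ++ laterNb nb pos y ∨ y ∈ A x ++ laterNb nb pos x) ↔
      (x ∈ A y ∨ y ∈ A x) ∨ N x y := by
  simp only [List.mem_append, mem_laterNb, hnb.mem_iff]
  have h1 := hN x y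
  have h2 := hN y x
  have h3 : x ≠ y → pos x < pos y ∨ pos y < pos x := fun h =>
    lt_or_gt_of_ne fun e => h (hpos e)
  tauto

/-- Orient the edges of the input graph. -/
def firstRound : Prog :=
  .assign 7 (.const 1) ;; addLists adjLength adjEntry ;; peel ;; orient

theorem adjLength_eval {adj : Fin n → List (Fin n)} (h : IsAdjArray (s.arr 0) (s.arr 1) adj)
    {v : Fin n} (h2 : s.reg 2 = v) : adjLength.eval s = (adj v).length := by
  simp only [adjLength, Expr.eval, Op.eval, h2, h.length]

theorem adjEntry_eval {adj : Fin n → List (Fin n)} (h : IsAdjArray (s.arr 0) (s.arr 1) adj)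
    {v : Fin n} (h2 : s.reg 2 = v) {j : ℕ} (hj : j < (adj v).length) (h3 : s.reg 3 = j) :
    adjEntry.eval s = (adj v)[j] := by
  simp only [adjEntry, Expr.eval, Op.eval, h2, h3, h.get v j hj]

theorem wp_firstRound {adj : Fin n → List (Fin n)} (hG : ExpansionLE G f)
    (hadj : IsNbLists adj G.Adj) (h0 : s.reg 0 = n) (ha : IsAdjArray (s.arr 0) (s.arr 1) adj)
    (h4 : ∀ i, s.arr 4 i = 0) (h6 : ∀ i, s.arr 6 i = 0) (h8 : ∀ i, s.arr 8 i = 0) {t : ℕ}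
    (ht : ∑ v, ((adj v).length + 1) + (5 * routedDegree 1 0 (f 1) + 4) * (n + 1) ≤ t) :
    wp firstRound t (RoundInv G f 0) s := by
  refine wp_seq_assign (wp_seq _ _ ((wp_addLists (n := n) (T := adj) (old := fun _ _ => False)
    (R := G.Adj) (by simp) (by simpa using h0) (fun s' v hf h2 => adjLength_eval ?_ h2)
    (fun s' v j hj hf h2 h3 => adjEntry_eval ?_ h2 hj h3) (.of_clear (by simp [h6]) ?_)
    (fun x y => (hadj.mem_iff x y).symm) le_rfl).frame ?_) ht)
  · rwa [hf.2 0 (by decide), hf.2 1 (by decide)]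
  · rwa [hf.2 0 (by decide), hf.2 1 (by decide)]
  · simp [h4, Expr.eval]
  · rintro s' ⟨nb, hnt, hnb, hM⟩ hf
    simp only [State.setReg_reg, Expr.eval, if_true] at hM
    have hN : (fun x y => x ≠ y ∧ ¬ False ∧ (G.Adj x y ∨ G.Adj y x)) = G.Adj := by
      funext x y
      have := G.ne_of_adj (a := x) (b := y)
      have := G.adj_comm x y
      rw [eq_iff_iff]
      tauto
    rw [hN] at hnb
    refine (wp_peel_orient hnb (fun x y h => ⟨h.symm, h.ne⟩) hnt
      ((hf.1 0 (by decide)).trans (by simpa using h0)) (A := fun _ => []) (.nil fun v => ?_)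
      (hnb.degenerate_of_adj hG) le_rfl).frame ?_
    · simp [hf.2 8 (by decide), h8]
    · rintro s'' ⟨pos, hpos, hk, hA⟩ hf'
      refine ⟨?_, fun _ => laterNb nb pos, hnb.isFraternalChain_zero hpos,
        hnb.augBounded_zero hk, hA, fun x y => ?_⟩
      · rw [hf'.1 7 (by decide), hf.1 7 (by decide)]
        simp [Expr.eval]
      · rw [hf'.2 4 (by decide)]
        refine ⟨(hM x y).1.trans ?_, (hM x y).2⟩
        have h1 := mem_append_laterNb_iff (A := fun _ => []) hnb
          (fun x y h => ⟨h.symm, h.ne⟩) hpos x y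
        have h2 := (congrFun (congrFun hN x) y).to_iff
        simp only [List.nil_append, List.not_mem_nil, or_self, false_or] at h1
        rw [h1, ← h2]
        tauto

/-- A round of the augmentation. -/
def round : Prog := clearEdges ;; addFraternal ;; peel ;; orient

/-- A bound on the number of loop iterations in a round. -/
def roundCost (f : ℕ → ℕ) (t : ℕ) : ℕ :=
  (augBound f t).2.2 * ((augBound f t).2.2 + 1) + 5 * newDegree f t + 6

theorem wp_round (hG : ExpansionLE G f) (h0 : s.reg 0 = n) {t : ℕ} (H : RoundInv G f t s) :
    wp round (roundCost f t * (n + 1)) (RoundInv G f (t + 1)) s := by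
  obtain ⟨h7, A, hch, hb, htab, hM⟩ := H
  set d := (augBound f t).2.2 with hd
  refine wp_seq n ((d * (d + 1) + 1) * (n + 1) + (5 * newDegree f t + 4) * (n + 1))
    ((wp_clearEdges h0).frame fun s₁ h₁ hf₁ => ?_) (by rw [roundCost, ← hd]; nlinarith)
  refine wp_seq ((d * (d + 1) + 1) * (n + 1)) ((5 * newDegree f t + 4) * (n + 1))
    ((wp_addFraternal (n := n) (A := A t) (old := fun x y => x ∈ A t y ∨ y ∈ A t x)
      (R := fun x y => ∃ z, x ∈ A t z ∧ y ∈ A t z) (fun x y h => h.symm)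
      ((hf₁.1 0 (by decide)).trans h0) ?_ (.of_clear h₁ ?_) (fun x y => Iff.rfl) hb.2
      (by rw [mul_comm]; exact Nat.mul_le_mul_left _ (by omega))).frame ?_) le_rfl
  · rwa [hf₁.2 7 (by decide), hf₁.2 8 (by decide)]
  · rwa [hf₁.2 4 (by decide), hf₁.1 7 (by decide), h7]
  · rintro s₂ ⟨nb, hnt, hnb, hM₂⟩ hf₂
    rw [hf₁.1 7 (by decide), h7] at hM₂
    have hN : (fun x y => x ≠ y ∧ ¬ (x ∈ A t y ∨ y ∈ A t x) ∧
        ((∃ z, x ∈ A t z ∧ y ∈ A t z) ∨ ∃ z, y ∈ A t z ∧ x ∈ A t z)) = FraternalPair (A t) := by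
      funext x y
      have : (∃ z, y ∈ A t z ∧ x ∈ A t z) ↔ ∃ z, x ∈ A t z ∧ y ∈ A t z := by
        simp only [and_comm]
      rw [this, or_self]
      rfl
    rw [hN] at hnb
    have hsym : ∀ x y, FraternalPair (A t) x y → FraternalPair (A t) y x ∧ x ≠ y :=
      fun x y h => ⟨h.symm, h.1⟩
    refine (wp_peel_orient (A := A t) hnb hsym hnt
      ((hf₂.1 0 (by decide)).trans ((hf₁.1 0 (by decide)).trans h0)) ?_
      (hnb.degenerate_of_fraternal hG hb) le_rfl).frame ?_
    · rwa [hf₂.2 7 (by decide), hf₂.2 8 (by decide), hf₁.2 7 (by decide), hf₁.2 8 (by decide)]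
    · rintro s₃ ⟨pos, hpos, hk, hA⟩ hf₃
      refine ⟨?_, _, hnb.isFraternalChain_succ hch hpos, ?_, ?_, fun x y => ?_⟩
      · rw [hf₃.1 7 (by decide), hf₂.1 7 (by decide), hf₁.1 7 (by decide), h7]
      · simpa using hnb.augBounded_succ hb hk
      · simpa using hA
      · rw [hf₃.2 4 (by decide)]
        refine ⟨(hM₂ x y).1.trans ?_, (hM₂ x y).2⟩
        have h1 := mem_append_laterNb_iff (A := A t) hnb hsym hpos x y
        have h2 := (congrFun (congrFun hN x) y).to_iff
        simp only [add_le_iff_nonpos_right, nonpos_iff_eq_zero, one_ne_zero, if_false]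
        rw [h1, ← h2]
        tauto

/-! ### The final order -/

/-- The graph of ancestors, and its degeneracy order. -/
def finalOrder : Prog :=
  initAncestors ;; .for 11 (.op .add (.reg 1) (.reg 1)) growAncestors ;; .assign 7 (.const 2) ;;
  clearEdges ;; addLists (.read 13 (.reg 2)) (.read 12 (.idx (.reg 3) (.reg 2))) ;; peel

/-- A bound on the number of loop iterations of `finalOrder`, for in-degree at most `d`. -/
def finalCost (d t : ℕ) : ℕ := t * ((1 + d) ^ t * (d + 1) + 2) + 7 * (1 + d) ^ t + 6

theorem wp_finalOrder {t d : ℕ} (h0 : s.reg 0 = n) (h1 : s.reg 1 + s.reg 1 = t)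
    {A : Fin n → List (Fin n)} (hd : ∀ v, (A v).length ≤ d)
    (hA : IsTable (s.arr 7) (s.arr 8) A) (hM : ∀ x y : Fin n, s.arr 4 (x * n + y) ≤ 1) :
    wp finalOrder (finalCost d t * (n + 1)) (fun s' => ∃ (nb : Fin n → List (Fin n))
      (pos : Fin n → ℕ), IsNbLists nb (AncestorPair A t) ∧ Function.Injective pos ∧
      (∀ v, pos v < n) ∧ (∀ v : Fin n, s'.arr 10 v = pos v) ∧ (∀ v, s'.arr 11 (pos v) = v) ∧
      ∀ v, (laterNb nb pos v).length ≤ 2 * (1 + d) ^ t) s := by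
  set m := (1 + d) ^ t with hm
  refine wp_seq n ((t * (m * (d + 1) + 2) + 7 * m + 5) * (n + 1))
    ((wp_initAncestors h0).frame fun s₁ h₁ hf₁ => ?_) (by rw [finalCost, ← hm]; nlinarith)
  have h0₁ := (hf₁.1 0 (by decide)).trans h0
  have hA₁ : IsTable (s₁.arr 7) (s₁.arr 8) A := by
    rwa [hf₁.2 7 (by decide), hf₁.2 8 (by decide)]
  refine wp_seq (t * ((m * (d + 1) + 2) * (n + 1))) ((7 * m + 5) * (n + 1)) (wp_for (N := t)
    (fun k s' => IsTable (s'.arr 12) (s'.arr 13) (ancestors A k))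
    (fun _ => n * (m * (d + 1) + 1)) (by decide) h₁ (fun _ _ _ h => h) (fun k s' hf _ => ?_)
    (fun k s' hf hk h => ?_) (fun s₂ hf₂ h₂ => ?_) ?_) (by nlinarith)
  · simp only [Expr.eval, Op.eval]
    rw [hf.1 1 (by decide), hf₁.1 1 (by decide), h1]
  · refine wp_growAncestors ((hf.1 0 (by decide)).trans h0₁) ?_ h hd (fun v => ?_) le_rfl
    · rwa [hf.2 7 (by decide), hf.2 8 (by decide)]
    · exact (length_ancestors_le hd k v).trans (Nat.pow_le_pow_right (by omega) k.2.le)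
  swap
  · simp only [Finset.sum_const, Finset.card_univ, Fintype.card_fin, smul_eq_mul]
    exact Nat.mul_le_mul_left _ (by nlinarith)
  have h0₂ := (hf₂.1 0 (by decide)).trans h0₁
  refine wp_seq_assign (wp_seq n ((7 * m + 4) * (n + 1)) ((wp_clearEdges (n := n)
    (by simpa using h0₂)).frame fun s₃ h₃ hf₃ => ?_) (by nlinarith))
  have h0₃ : s₃.reg 0 = n := (hf₃.1 0 (by decide)).trans (by simpa using h0₂)
  have h7₃ : s₃.reg 7 = 2 := (hf₃.1 7 (by decide)).trans (by simp [Expr.eval])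
  have ht₃ : IsTable (s₃.arr 12) (s₃.arr 13) (ancestors A t) := by
    rw [hf₃.2 12 (by decide), hf₃.2 13 (by decide)]
    exact h₂
  have hm₃ : ∀ x y : Fin n, s₃.arr 4 (x * n + y) ≤ 1 := by
    rw [hf₃.2 4 (by decide), State.setReg_arr, hf₂.2 4 (by decide), hf₁.2 4 (by decide)]
    exact hM
  have hlen : ∀ v, (ancestors A t v).length ≤ m := length_ancestors_le hd t
  refine wp_seq ((m + 1) * (n + 1)) ((6 * m + 3) * (n + 1)) ((wp_addLists (n := n)
    (T := ancestors A t) (old := fun _ _ => False) (R := fun x y => y ∈ ancestors A t x)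
    (by simp) h0₃ (fun s' v hf h2 => ?_) (fun s' v j hj hf h2 h3 => ?_)
    (.of_clear h₃ fun x y => ?_) (fun x y => Iff.rfl) ?_).frame ?_) (by nlinarith)
  · simp only [Expr.eval, h2, hf.2 13 (by decide), ht₃.length]
  · simp only [Expr.eval, Expr.idx, Op.eval, h2, h3, hf.2 12 (by decide), hf.1 0 (by decide), h0₃]
    exact ht₃.get v j hj
  -- The rounds left marks of at most `1`, so with the mark `2` all pairs count as nonadjacent.
  · have := hm₃ x y
    rw [h7₃]
    simp
    omega
  · calc ∑ v, ((ancestors A t v).length + 1) ≤ ∑ _v : Fin n, (m + 1) :=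
          Finset.sum_le_sum fun v _ => Nat.succ_le_succ (hlen v)
      _ ≤ (m + 1) * (n + 1) := by
          simp only [Finset.sum_const, Finset.card_univ, Fintype.card_fin, smul_eq_mul]
          nlinarith
  · rintro s₄ ⟨nb, hnt, hnb, -⟩ hf₄
    have hN : (fun x y => x ≠ y ∧ ¬ False ∧ (y ∈ ancestors A t x ∨ x ∈ ancestors A t y)) =
        AncestorPair A t := by
      funext x y
      simp [AncestorPair]
    rw [hN] at hnb
    refine (wp_peel_of_degenerate hnb (fun x y h => ⟨h.symm, h.1⟩) hnt
      ((hf₄.1 0 (by decide)).trans h0₃) (hnb.degenerate_of_ancestors hd) ?_).mono le_rfl ?_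
    · rw [← hm]; nlinarith
    · rintro s₅ ⟨pos, hpos⟩
      exact ⟨nb, pos, hnb, hpos⟩

/-! ### Balls -/

/-- The values are the largest positions in the balls of radius `i`. -/
def IsBallMax (G : SimpleGraph (Fin n)) (pos : Fin n → ℕ) (i : ℕ) (a : Fin n → ℕ) : Prop :=
  ∀ w, (∃ u, G.WalkLE i w u ∧ a w = pos u) ∧ ∀ u, G.WalkLE i w u → pos u ≤ a w

theorem IsBallMax.zero (G : SimpleGraph (Fin n)) (pos : Fin n → ℕ) : IsBallMax G pos 0 pos := by
  refine fun w => ⟨⟨w, ⟨.nil, le_rfl⟩, rfl⟩, ?_⟩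
  rintro u ⟨p, hp⟩
  rw [SimpleGraph.Walk.eq_of_length_eq_zero (Nat.le_zero.1 hp)]

theorem foldl_max_spec {α : Type*} (a : α → ℕ) (l : List α) (m : ℕ) :
    m ≤ l.foldl (fun m u => max m (a u)) m ∧
      (∀ u ∈ l, a u ≤ l.foldl (fun m u => max m (a u)) m) ∧
      (l.foldl (fun m u => max m (a u)) m = m ∨
        ∃ u ∈ l, l.foldl (fun m u => max m (a u)) m = a u) := by
  induction l generalizing m with
  | nil => simp
  | cons x l ih =>
    obtain ⟨h1, h2, h3⟩ := ih (max m (a x))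
    rw [List.foldl_cons]
    refine ⟨(le_max_left _ _).trans h1, ?_, ?_⟩
    · intro u hu
      obtain rfl | hu := List.mem_cons.1 hu
      · exact (le_max_right _ _).trans h1
      · exact h2 u hu
    · rcases h3 with h3 | ⟨u, hu, h3⟩
      · rw [h3]
        rcases max_choice m (a x) with h | h
        · exact .inl h
        · exact .inr ⟨x, List.mem_cons_self, h⟩
      · exact .inr ⟨u, List.mem_cons_of_mem _ hu, h3⟩

/-- The ball of radius `i + 1` around `w` is the union of the balls of radius `i` around `w` and its
neighbours, by splitting off the first edge of a walk. -/
theorem IsBallMax.succ {pos a : Fin n → ℕ} {i : ℕ} (h : IsBallMax G pos i a)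
    {adj : Fin n → List (Fin n)} (hadj : IsNbLists adj G.Adj) :
    IsBallMax G pos (i + 1) (maxNb adj a) := by
  intro w
  obtain ⟨h1, h2, h3⟩ := foldl_max_spec a (adj w) (a w)
  rw [maxNb]
  refine ⟨?_, ?_⟩
  · rcases h3 with h3 | ⟨x, hx, h3⟩
    · obtain ⟨u, ⟨p, hp⟩, hu⟩ := (h w).1
      exact ⟨u, ⟨p, by omega⟩, h3.trans hu⟩
    · obtain ⟨u, ⟨p, hp⟩, hu⟩ := (h x).1
      rw [hadj.mem_iff] at hx
      exact ⟨u, ⟨.cons hx p, by simpa using hp⟩, h3.trans hu⟩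
  · rintro u ⟨p, hp⟩
    cases p with
    | nil => exact ((h _).2 _ ⟨.nil, Nat.zero_le _⟩).trans h1
    | @cons _ x _ hx p =>
      refine ((h x).2 u ⟨p, by simpa using hp⟩).trans (h2 x ?_)
      rwa [hadj.mem_iff]

/-- Determine the least vertices of all balls, and output the results. -/
def finalOutput : Prog := initBest ;; .for 11 (.reg 1) spread ;; output

theorem wp_finalOutput {adj : Fin n → List (Fin n)} (hadj : IsNbLists adj G.Adj)
    (h0 : s.reg 0 = n) (ha : IsAdjArray (s.arr 0) (s.arr 1) adj) (h3 : ∀ v : Fin n, s.arr 3 v = 0)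
    {pos : Fin n → ℕ} (hpos : ∀ v : Fin n, s.arr 10 v = pos v) {t : ℕ}
    (ht : 2 * n + s.reg 1 * (∑ v, ((adj v).length + 1) + n + 1) ≤ t) :
    wp finalOutput t (fun s' => ∃ a, IsBallMax G pos (s.reg 1) a ∧
      (∀ v : Fin n, s'.arr 2 v = s.arr 11 (n - 1 - v)) ∧
      (∀ v : Fin n, s'.arr 3 v ≤ 1 ∧ (s'.arr 3 v = 1 ↔ ∃ w : Fin n, s.arr 11 (a w) = v))) s := by
  refine wp_seq n _ ((wp_initBest h0).frame fun s₁ h₁ hf₁ => ?_)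
    (show n + (s.reg 1 * (∑ v, ((adj v).length + 1) + n + 1) + n) ≤ t by omega)
  have h0₁ := (hf₁.1 0 (by decide)).trans h0
  refine wp_seq _ n (wp_for (N := s.reg 1) (fun i s' => ∃ a, IsBallMax G pos i a ∧
    ∀ v : Fin n, s'.arr 14 v = a v) (fun _ => ∑ v, ((adj v).length + 1) + n) (by decide)
    ⟨pos, .zero G pos, fun v => (h₁ v).trans (hpos v)⟩ (fun _ _ _ h => h) (fun k s' hf _ => ?_)
    (fun k s' hf hk h => ?_) (fun s₂ hf₂ h₂ => ?_) le_rfl) (by simp)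
  · exact (hf.1 1 (by decide)).trans (hf₁.1 1 (by decide))
  · obtain ⟨a, hb, hv⟩ := h
    refine (wp_spread (adj := adj) ((hf.1 0 (by decide)).trans h0₁) ?_ hv le_rfl).mono le_rfl
      fun s'' h => ⟨_, hb.succ hadj, h⟩
    rwa [hf.2 0 (by decide), hf.2 1 (by decide), hf₁.2 0 (by decide), hf₁.2 1 (by decide)]
  · obtain ⟨a, hb, hv⟩ := h₂
    have h11 : s₂.arr 11 = s.arr 11 := (hf₂.2 11 (by decide)).trans (hf₁.2 11 (by decide))
    refine (wp_output (n := n) ((hf₂.1 0 (by decide)).trans h0₁) ?_).mono le_rfl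
      fun s₃ h => ⟨a, hb, ?_, ?_⟩
    · rwa [hf₂.2 3 (by decide), hf₁.2 3 (by decide)]
    · rw [← h11]
      exact h.1
    · have := h.2
      simp only [h11, hv] at this
      exact this

end

end RAM

/-! ### The complete algorithm on the input. -/

namespace RAM

section
variable {n : ℕ} {G : SimpleGraph (Fin n)} {f : ℕ → ℕ}

theorem isAdjArray_inputState (adj : Fin n → List (Fin n)) (r : ℕ) :
    IsAdjArray ((inputState adj r).arr 0) ((inputState adj r).arr 1) adj := by
  have hoff : ∀ i ≤ n, (inputState adj r).arr 0 i =
      (((List.ofFn adj).take i).map List.length).sum := fun i hi => by simp [inputState, hi]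
  have htake : ∀ v : Fin n, (List.ofFn adj).take (v + 1) = (List.ofFn adj).take v ++ [adj v] := by
    intro v
    rw [List.take_succ_eq_append_getElem (by simp)]
    simp
  refine ⟨fun v => ?_, fun v j hj => ?_⟩
  · rw [hoff _ v.2, hoff _ v.2.le, htake]
    simp
  · rw [hoff _ v.2.le]
    -- The list of `v` is isolated inside the concatenation; the lengths before it add up to its
    -- offset.
    have hsplit : List.ofFn adj =
        (List.ofFn adj).take v ++ adj v :: (List.ofFn adj).drop (v + 1) := by
      conv_lhs => rw [← List.take_append_drop (v + 1) (List.ofFn adj), htake]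
      simp
    simp only [inputState, one_ne_zero, if_false, if_true]
    have : ((List.ofFn adj).flatten.map Fin.val) =
        (((List.ofFn adj).take v).flatten.map Fin.val) ++ ((adj v).map Fin.val ++
          (((List.ofFn adj).drop (v + 1)).flatten.map Fin.val)) := by
      conv_lhs => rw [hsplit]
      simp
    have hlen : (((List.ofFn adj).take v).flatten.map Fin.val).length =
        (((List.ofFn adj).take v).map List.length).sum := by
      rw [List.length_map, List.length_flatten]
    rw [this, List.getD_append_right _ _ _ _ (by rw [hlen]; omega), hlen, Nat.add_sub_cancel_left,
      List.getD_append _ _ _ _ (by simpa using hj), List.getD_eq_getElem _ _ (by simpa using hj),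
      List.getElem_map]

theorem boundedBy_inputState (adj : Fin n → List (Fin n)) (r : ℕ) :
    (inputState adj r).BoundedBy (n + r + ∑ v, (adj v).length) := by
  refine ⟨fun x => ?_, fun a i => ?_⟩
  · simp only [inputState]
    split_ifs <;> omega
  · simp only [inputState]
    split_ifs
    · calc _ ≤ ((List.ofFn adj).map List.length).sum :=
            ((List.take_sublist i (List.ofFn adj)).map _).sum_le_sum fun _ _ => Nat.zero_le _
        _ = ∑ v, (adj v).length := by simp [List.map_ofFn, List.sum_ofFn]
        _ ≤ _ := by omega
    · omega
    · by_cases hi : i < ((List.ofFn adj).flatten.map Fin.val).length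
      · rw [List.getD_eq_getElem _ _ hi, List.getElem_map]
        omega
      · rw [List.getD_eq_default _ _ (by omega)]
        omega
    · omega

theorem sum_length_eq {adj : Fin n → List (Fin n)} (h : IsNbLists adj G.Adj) :
    ∑ v, (adj v).length = 2 * G.edgeSet.ncard := by
  classical
  rw [← SimpleGraph.coe_edgeFinset, Set.ncard_coe_finset, ← G.sum_degrees_eq_twice_card_edges]
  refine Finset.sum_congr rfl fun v _ => ?_
  rw [← SimpleGraph.card_neighborFinset_eq_degree, ← List.toFinset_card_of_nodup (h.nodup v)]
  congr 1
  ext u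
  simp [h.mem_iff]

/-- The algorithm of the main theorem. -/
def domination : Prog :=
  firstRound ;; .for 11 (.op .add (.reg 1) (.reg 1)) round ;; finalOrder ;; finalOutput

/-- A bound on the number of loop iterations of `domination`, relative to the graph size. -/
def dominationCost (f : ℕ → ℕ) (r : ℕ) : ℕ :=
  5 * routedDegree 1 0 (f 1) + 4 + 2 + ∑ k : Fin (r + r), (roundCost f k + 1) +
    finalCost (augBound f (r + r)).2.2 (r + r) + 2 + 3 * r

theorem wp_domination (hG : ExpansionLE G f) {adj : Fin n → List (Fin n)}
    (hadj : IsNbLists adj G.Adj) (r : ℕ) :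
    wp domination (dominationCost f r * graphSize G) (fun s => ∃ (nb A : Fin n → List (Fin n))
      (F : ℕ → Fin n → List (Fin n)) (pos a : Fin n → ℕ) (ord : ℕ → ℕ),
      IsFraternalChain G F (r + r) ∧ F (r + r) = A ∧
      (∀ v, (A v).length ≤ (augBound f (r + r)).2.2) ∧ IsNbLists nb (AncestorPair A (r + r)) ∧
      Function.Injective pos ∧ (∀ v, pos v < n) ∧ (∀ v : Fin n, ord (pos v) = v) ∧
      (∀ v, (laterNb nb pos v).length ≤ 2 * (1 + (augBound f (r + r)).2.2) ^ (r + r)) ∧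
      IsBallMax G pos r a ∧ (∀ v : Fin n, s.arr 2 v = ord (n - 1 - v)) ∧
      ∀ v : Fin n, s.arr 3 v ≤ 1 ∧ (s.arr 3 v = 1 ↔ ∃ w : Fin n, ord (a w) = v))
      (inputState adj r) := by
  have h0 : (inputState adj r).reg 0 = n := rfl
  have h1 : (inputState adj r).reg 1 = r := rfl
  have ha := isAdjArray_inputState adj r
  have hz : ∀ a i, 2 ≤ a → (inputState adj r).arr a i = 0 := fun a i h => by
    simp [inputState, show a ≠ 0 by omega, show a ≠ 1 by omega]
  have hsum : ∑ v, ((adj v).length + 1) = 2 * G.edgeSet.ncard + n := by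
    rw [Finset.sum_add_distrib, sum_length_eq hadj]
    simp
  have hle : n + 1 ≤ graphSize G := by rw [graphSize]; omega
  have hle' : 2 * G.edgeSet.ncard + n ≤ 2 * graphSize G := by rw [graphSize]; omega
  set S := graphSize G
  set t₁ := (5 * routedDegree 1 0 (f 1) + 4 + 2) * S with ht₁
  set t₂ := (∑ k : Fin (r + r), (roundCost f k + 1)) * S with ht₂
  set t₃ := finalCost (augBound f (r + r)).2.2 (r + r) * S with ht₃
  refine wp_seq t₁ (t₂ + (t₃ + (2 + 3 * r) * S)) ((wp_firstRound hG hadj h0 ha (fun i => hz 4 i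
    (by omega)) (fun i => hz 6 i (by omega)) (fun i => hz 8 i (by omega)) ?_).frame
    fun s₁ h₁ hf₁ => ?_) (by rw [dominationCost, ht₁, ht₂, ht₃]; apply le_of_eq; ring)
  · rw [hsum, ht₁]
    nlinarith
  have h0₁ := (hf₁.1 0 (by decide)).trans h0
  have h1₁ := (hf₁.1 1 (by decide)).trans h1
  refine wp_seq _ _ (wp_for (N := r + r) (RoundInv G f) (fun k => roundCost f k * (n + 1))
    (by decide) h₁ (fun k s v h => ?_) (fun k s hf _ => ?_) (fun k s hf _ h => ?_)
    (fun s₂ hf₂ h₂ => ?_) ?_) le_rfl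
  · obtain ⟨h7, h⟩ := h
    exact ⟨by simpa using h7, h⟩
  · simp only [Expr.eval, Op.eval, hf.1 1 (by decide), h1₁]
  · exact wp_round hG ((hf.1 0 (by decide)).trans h0₁) h
  · have h0₂ := (hf₂.1 0 (by decide)).trans h0₁
    have h1₂ := (hf₂.1 1 (by decide)).trans h1₁
    obtain ⟨-, A, hch, hb, htab, hM⟩ := h₂
    refine wp_seq t₃ ((2 + 3 * r) * S) (((wp_finalOrder h0₂ (by rw [h1₂]) hb.2 htab
      fun x y => (hM x y).2).mono (Nat.mul_le_mul_left _ hle) fun _ h => h).frame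
      fun s₃ h₃ hf₃ => ?_) le_rfl
    obtain ⟨nb, pos, hnb, hpos, hlt, h10, h11, hlater⟩ := h₃
    have h1₃ := (hf₃.1 1 (by decide)).trans h1₂
    refine (wp_finalOutput hadj ((hf₃.1 0 (by decide)).trans h0₂) ?_ (fun v => ?_) h10 ?_).mono
      le_rfl fun s₄ h₄ => ?_
    · rwa [hf₃.2 0 (by decide), hf₂.2 0 (by decide), hf₁.2 0 (by decide), hf₃.2 1 (by decide),
        hf₂.2 1 (by decide), hf₁.2 1 (by decide)]
    · rw [hf₃.2 3 (by decide), hf₂.2 3 (by decide), hf₁.2 3 (by decide), hz _ _ (by omega)]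
    · rw [h1₃, hsum]
      nlinarith
    · obtain ⟨a, hmax, h2, h3⟩ := h₄
      rw [h1₃] at hmax
      exact ⟨nb, _, A, pos, a, _, hch, rfl, hb.2, hnb, hpos, hlt, h11, hlater, hmax, h2, h3⟩
  · rw [ht₂, Finset.sum_mul]
    refine Finset.sum_le_sum fun k _ => ?_
    nlinarith

/-! ### From positions to the order and the dominating set. -/

theorem isSlow_domination : domination.isSlow = true := by decide

/-- The order in which vertices of larger position come first. -/
abbrev positionOrder (pos : Fin n → ℕ) (hpos : Function.Injective pos) : LinearOrder (Fin n) :=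
  LinearOrder.lift' (fun v => OrderDual.toDual (pos v)) fun _ _ h => hpos h

theorem positionOrder_le {pos : Fin n → ℕ} (hpos : Function.Injective pos) (x y : Fin n) :
    (positionOrder pos hpos).le x y ↔ pos y ≤ pos x := Iff.rfl

/-- `L` reverses positions, so the vertex with index `i` in `L` has position `n - 1 - i`. -/
theorem outputsOrder_of_positions {pos : Fin n → ℕ} (hpos : Function.Injective pos)
    (hlt : ∀ v, pos v < n) {ord : ℕ → ℕ} (hord : ∀ v : Fin n, ord (pos v) = v) {s : State}
    (hs : ∀ v : Fin n, s.arr 2 v = ord (n - 1 - v)) :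
    OutputsOrder s (positionOrder pos hpos) := by
  let e : Fin n ≃ Fin n := Equiv.ofBijective (fun v => Fin.rev ⟨pos v, hlt v⟩)
    (Finite.injective_iff_bijective.1 fun x y h =>
      hpos (by simpa [Fin.ext_iff] using Fin.rev_injective h))
  have he : ∀ i, pos (e.symm i) = n - 1 - i := fun i => by
    have := congrArg Fin.val (e.apply_symm_apply i)
    have h2 := hlt (e.symm i)
    simp only [e, Equiv.ofBijective_apply, Fin.val_rev] at this h2 ⊢
    omega
  refine ⟨e.symm, fun i j => ?_, fun i => ?_⟩
  · rw [positionOrder_le, he, he, Fin.le_def]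
    omega
  · rw [hs, ← he, hord]

/-- The largest position in a ball belongs to its `L`-least vertex, and `ord` recovers the vertex
from the position. -/
theorem isBallMax_iff_isMinWReach {pos : Fin n → ℕ} (hpos : Function.Injective pos) {r : ℕ}
    {a : Fin n → ℕ} (ha : IsBallMax G pos r a) {ord : ℕ → ℕ}
    (hord : ∀ v : Fin n, ord (pos v) = v) (v w : Fin n) :
    ord (a w) = v ↔ IsMinWReach G (positionOrder pos hpos) r w v := by
  rw [isMinWReach_iff]
  simp only [positionOrder_le]
  obtain ⟨⟨u, hu, hau⟩, hmax⟩ := ha w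
  rw [hau, hord, Fin.val_inj]
  constructor
  · rintro rfl
    exact ⟨hu, fun x hx => hau ▸ hmax x hx⟩
  · rintro ⟨h1, h2⟩
    exact hpos (le_antisymm (h2 u hu) (hau ▸ hmax v h1))

end

end RAM

/-! ### The main theorem. -/

open RAM in
theorem mainTheorem1 (C : GraphClass) (hC : C.BoundedExpansion) :
    ∃ (c : ℕ → ℕ) (P : RAM.Prog) (T : ℕ → ℕ) (k : ℕ),
      ∀ (n : ℕ) (G : SimpleGraph (Fin n)), G ∈ C n →
        ∀ (r : ℕ) (adj : Fin n → List (Fin n)), IsAdjLists G adj →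
          ∃ (t : ℕ) (s : RAM.State) (L : LinearOrder (Fin n)) (D : Finset (Fin n)),
            RAM.Exec (T r * graphSize G ^ k) P (inputState adj r) t s ∧
            t ≤ T r * graphSize G ∧
            OutputsOrder s L ∧
            OutputsSet s D ∧
            WitnessesWcolLE G L (2 * r) (c r) ∧
            (∀ v, v ∈ D ↔ ∃ w, IsMinWReach G L r w v) ∧
            IsDistDominatingApprox G r (c r) D := by
  classical
  obtain ⟨f, hf⟩ := hC
  -- `m r` bounds the number of ancestors after `2 * r` rounds. Each ancestor contributes itself and
  -- at most `2 * m r` later neighbours, which gives the factor `2 * m r + 1`.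
  let m : ℕ → ℕ := fun r => (1 + (augBound f (r + r)).2.2) ^ (r + r)
  -- The summand `r + 4` accounts for the numbers in the input, the other one for the number of
  -- steps. Adding `b r` to its power below makes one function serve for both time and word size,
  -- even if the exponent were `0`.
  let b : ℕ → ℕ := fun r => r + 4 + domination.weight * (dominationCost f r + 1)
  refine ⟨fun r => m r * (2 * m r + 1), domination,
    fun r => b r ^ domination.exponent + b r, domination.exponent, fun n G hG r adj hadj => ?_⟩
  have hnbadj : IsNbLists adj G.Adj := ⟨fun v => (hadj v).1, fun x y => (hadj x).2 y⟩
  have hS : 1 ≤ graphSize G := by rw [graphSize]; omega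
  have hbound : n + r + ∑ v, (adj v).length ≤ (r + 4) * graphSize G := by
    rw [sum_length_eq hnbadj, graphSize]
    nlinarith
  obtain ⟨t, ht, s, hexec, nb, A, F, pos, a, ord, hch, rfl, hd, hnb, hpos, hlt, hord, hlater,
    hmax, h2, h3⟩ := (wp_domination (fun r m H => hf r m n H G hG) hnbadj r).exec
      (B := (r + 4) * graphSize G) (by nlinarith) ((boundedBy_inputState adj r).mono hbound)
      isSlow_domination
  have hw : domination.weight * (dominationCost f r * graphSize G + 1) ≤
      domination.weight * (dominationCost f r + 1) * graphSize G := by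
    rw [mul_assoc]
    exact Nat.mul_le_mul_left _ (by nlinarith)
  have hL : WitnessesWcolLE G (positionOrder pos hpos) (2 * r) (m r * (2 * m r + 1)) := by
    rw [two_mul r]
    exact hch.witnessesWcolLE hd hnb hpos hlater _ (positionOrder_le hpos)
  have hD : ∀ v, v ∈ (Finset.univ.filter fun v =>
      ∃ w, IsMinWReach G (positionOrder pos hpos) r w v) ↔
      ∃ w, IsMinWReach G (positionOrder pos hpos) r w v := by simp
  refine ⟨t, s, positionOrder pos hpos, _, hexec.mono ?_, ht.trans (hw.trans ?_),
    outputsOrder_of_positions hpos hlt hord h2, fun v => ?_, hL, hD,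
    isDistDominatingApprox_of_witnesses hL hD⟩
  · calc _ ≤ (b r * graphSize G) ^ domination.exponent :=
          Nat.pow_le_pow_left (by simp only [b]; nlinarith) _
      _ ≤ _ := by
          rw [mul_pow]
          exact Nat.mul_le_mul_right _ (Nat.le_add_right _ _)
  · exact Nat.mul_le_mul_right _ (by simp only [b]; omega)
  · have h := h3 v
    simp only [isBallMax_iff_isMinWReach hpos hmax hord] at h
    split_ifs with hv
    · exact h.2.2 ((hD v).1 hv)
    · have : s.arr 3 v ≠ 1 := fun e => hv ((hD v).2 (h.2.1 e))
      omega
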